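/- Let $n\ge 0$ be an integer, $D=2n$, $\theta\in\mathbb R\setminus\{0\}$, and $\Theta=\theta\,\mathrm{diag}(j,\dots,j)$ ($n$ blocks) with $j=\begin{pmatrix}0&-1\\1&0\end{pmatrix}$. Write $\mathcal S$, $\mathcal S'$ for the complex Schwartz functions and tempered distributions on $\mathbb R^{D}$. For $a,b\in\mathcal S$ let $$(a\star b)(x)=\frac1{(\pi\theta)^D}\int\!\!\int a(x+y)\,b(x+z)\,e^{-2i\,y\Theta^{-1}z}\,dy\,dz .$$ For $T\in\mathcal S'$, $a\in\mathcal S$ put $\langle T\star a,b\rangle=\langle T,a\star b\rangle$ and $\langle a\star T,b\rangle=\langle T,b\star a\rangle$ for all $b\in\mathcal S$. The Moyal algebra is $\mathcal M=\{T\in\mathcal S' : a\star T\in\mathcal S \text{ and } T\star a\in\mathcal S\ \ \forall a\in\mathcal S\}$, with product $\langle S\star T,b\rangle=\langle S,T\star b\rangle$ and with complex conjugation $\dagger$, $\langle T^\dagger,a\rangle=\overline{\langle T,\overline a\rangle}$. Let $\mathbb A^\bullet=\mathcal M\oplus\mathcal M$, where the first summand has degree $0$ and the second degree $1$, with product $ab=(a_0\star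 b_0+a_1\star b_1,\ a_0\star b_1+a_1\star b_0)$, unit $\mathbb I=(1,0)$ and involution $a^\dagger=(a_0^\dagger,\,i a_1^\dagger)$. The graded bracket $[\cdot,\cdot]_\bullet$ is the bilinear map with $[a,b]_\bullet=ab-(-1)^{|a||b|}ba$ for homogeneous $a,b$, and the center is $\mathcal Z(\mathbb A^\bullet)=\{z:[z,b]_\bullet=0\ \forall b\}$. Let $\mathrm{Der}^\alpha(\mathbb A^\bullet)$, $\alpha\in\mathbb Z_2$, be the space of linear maps $X$ of degree $\alpha$ on $\mathbb A^\bullet$ with $X(ab)=X(a)b+(-1)^{\alpha|a|}aX(b)$ for homogeneous $a$ and all $b$, and $\mathrm{Der}(\mathbb A^\bullet)=\mathrm{Der}^0\oplus\mathrm{Der}^1$, with bracket $[X,Y]_\bullet=XY-(-1)^{|X||Y|}YX$. Put $\mathrm{Ad}_a(b)=[a,b]_\bullet$; a linear map $X$ is called real if $X(a)^\dagger=X(a^\dagger)$ for all $a$. With $\xi_\mu(x)=-\sum_\nu\Theta^{-1}_{\mu\nu}x_\nu$, $\eta_\mu=i\xi_\mu$ and $\eta_{\mu\nu}=i\xi_\mu\xi_\nu$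 (pointwise product), let $T_\mu=(\eta_\mu,0)$, $U_\mu=(0,\eta_\mu)$, $M_{\mu\nu}=(\eta_{\mu\nu},0)$, $J=(0,i)$ for $1\le\mu,\nu\le D$. Then these objects are well defined: $\mathcal S$ and $\mathcal M$ are closed under the products above, $\mathcal M$ is closed under $\dagger$, and the constants, $\eta_\mu$ and $\eta_{\mu\nu}$ lie in $\mathcal M$. Moreover: 1. $\mathrm{Ad}_{T_\mu},\mathrm{Ad}_{M_{\mu\nu}}\in\mathrm{Der}^0(\mathbb A^\bullet)$ and $\mathrm{Ad}_{U_\mu},\mathrm{Ad}_J\in\mathrm{Der}^1(\mathbb A^\bullet)$. The derivations $\mathrm{Ad}_{T_\mu}$, $\mathrm{Ad}_{M_{\mu\nu}}$, $e^{i\pi/4}\mathrm{Ad}_{U_\mu}$, $e^{i\pi/4}\mathrm{Ad}_J$ are real. 2. The following relations hold: $$[T_\mu,T_\nu]_\bullet=i\Theta^{-1}_{\mu\nu}\mathbb I,\quad [M_{\mu\nu},T_\rho]_\bullet=\Theta^{-1}_{\nu\rho}T_\mu+\Theta^{-1}_{\mu\rho}T_\nu,$$ $$[M_{\mu\nu},M_{\rho\sigma}]_\bullet=\Theta^{-1}_{\nu\sigma}M_{\mu\rho}+\Theta^{-1}_{\nu\rho}M_{\mu\sigma}+\Theta^{-1}_{\mu\sigma}M_{\nu\rho}+\Theta^{-1}_{\mu\rho}M_{\nu\sigma},$$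 $$[U_\mu,U_\nu]_\bullet=2iM_{\mu\nu},\quad [T_\mu,U_\nu]_\bullet=\Theta^{-1}_{\mu\nu}J,\quad [M_{\mu\nu},U_\rho]_\bullet=\Theta^{-1}_{\nu\rho}U_\mu+\Theta^{-1}_{\mu\rho}U_\nu,$$ $$[J,J]_\bullet=-2\mathbb I,\quad [T_\mu,J]_\bullet=0,\quad [M_{\mu\nu},J]_\bullet=0,\quad [U_\mu,J]_\bullet=2iT_\mu .$$ 3. The complex linear span $\mathcal G$ of $\mathrm{Ad}_{T_\mu},\mathrm{Ad}_{U_\mu},\mathrm{Ad}_{M_{\mu\nu}},\mathrm{Ad}_J$ ($1\le\mu,\nu\le D$) is a $\mathbb Z_2$-graded Lie subalgebra of $\mathrm{Der}(\mathbb A^\bullet)$: it is a subspace of $\mathrm{Der}(\mathbb A^\bullet)$, the sum of its homogeneous parts, and closed under $[\cdot,\cdot]_\bullet$. 4. $\mathcal Z(\mathbb A^\bullet)$ is a graded unital subalgebra of $\mathbb A^\bullet$, and $\mathcal G$ is a graded module over it for the products $(zX)(a)=z\,X(a)$ and $(Xz)(a)=(-1)^{|a||z|}X(a)\,z$. -/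

import Mathlib

open scoped SchwartzMap

noncomputable section

namespace GradedMoyal

/-! ### The Moyal product on Schwartz functions -/

/-- Labels `μ = 1, …, D` of the coordinates of `ℝ^D`, `D = 2n`: a position in a `2 × 2` block and
the number of the block. -/
abbrev Idx (n : ℕ) := Fin 2 × Fin n

abbrev Space (n : ℕ) := EuclideanSpace ℝ (Idx n)

/-- `Θ = θ Σ` with `Σ = diag(J, …, J)`, `J = !![0, -1; 1, 0]`. -/
def Theta (n : ℕ) (θ : ℝ) : Matrix (Idx n) (Idx n) ℝ :=
  θ • Matrix.blockDiagonal fun _ : Fin n => !![0, -1; 1, 0]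

/-- The entries `Θ⁻¹_{μν}`. -/
def thetaInv (n : ℕ) (θ : ℝ) (μ ν : Idx n) : ℝ := (Theta n θ)⁻¹ μ ν

variable {n : ℕ}

/-- `y Θ⁻¹ z`. -/
def twist (θ : ℝ) (y z : Space n) : ℝ := ∑ μ, ∑ ν, y μ * thetaInv n θ μ ν * z ν

/-- `(a ⋆ b)(x) = (πθ)^{-D} ∫∫ a(x+y) b(x+z) exp(-2i yΘ⁻¹z) dy dz`. -/
def starFun (θ : ℝ) (a b : 𝓢(Space n, ℂ)) (x : Space n) : ℂ :=
  (((Real.pi * θ) ^ (2 * n) : ℝ) : ℂ)⁻¹ *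
    ∫ y : Space n, ∫ z : Space n,
      a (x + y) * b (x + z) * Complex.exp (-(2 * Complex.I * (twist θ y z : ℂ)))

/-- `B` is the Moyal product on Schwartz functions. -/
def IsStar (θ : ℝ) (B : 𝓢(Space n, ℂ) →ₗ[ℂ] 𝓢(Space n, ℂ) →ₗ[ℂ] 𝓢(Space n, ℂ)) : Prop :=
  ∀ a b x, B a b x = starFun θ a b x

open Classical in
/-- The Moyal product `𝓢 × 𝓢 → 𝓢`: the unique bilinear map given by the integral formula. -/
def starS (θ : ℝ) : 𝓢(Space n, ℂ) →ₗ[ℂ] 𝓢(Space n, ℂ) →ₗ[ℂ] 𝓢(Space n, ℂ) :=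
  if h : ∃ B, IsStar θ B then h.choose else 0

/-! ### The Moyal algebra -/

/-- `a ⋆ T`, given by `⟨a ⋆ T, b⟩ = ⟨T, b ⋆ a⟩`. -/
def starLeft (θ : ℝ) (a : 𝓢(Space n, ℂ)) (T : 𝓢'(Space n, ℂ)) : 𝓢(Space n, ℂ) →ₗ[ℂ] ℂ where
  toFun b := T (starS θ b a)
  map_add' b c := by simp
  map_smul' r b := by simp

/-- `T ⋆ a`, given by `⟨T ⋆ a, b⟩ = ⟨T, a ⋆ b⟩`. -/
def starRight (θ : ℝ) (T : 𝓢'(Space n, ℂ)) (a : 𝓢(Space n, ℂ)) : 𝓢(Space n, ℂ) →ₗ[ℂ] ℂ where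
  toFun b := T (starS θ a b)
  map_add' b c := by simp
  map_smul' r b := by simp

/-- The functional `L` on `𝓢` is integration against the Schwartz function `f`. -/
def Represents (f : 𝓢(Space n, ℂ)) (L : 𝓢(Space n, ℂ) →ₗ[ℂ] ℂ) : Prop :=
  ∀ b : 𝓢(Space n, ℂ), L b = (f : 𝓢'(Space n, ℂ)) b

/-- The Moyal algebra `ℳ = ℳ_L ∩ ℳ_R`, where `ℳ_L = {T | a ⋆ T ∈ 𝓢 for all a ∈ 𝓢}` and
`ℳ_R = {T | T ⋆ a ∈ 𝓢 for all a ∈ 𝓢}`. -/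
def Moyal (n : ℕ) (θ : ℝ) : Submodule ℂ 𝓢'(Space n, ℂ) where
  carrier := {T | (∀ a, ∃ f, Represents f (starLeft θ a T)) ∧
    ∀ a, ∃ f, Represents f (starRight θ T a)}
  zero_mem' := ⟨fun _ => ⟨0, fun b => by simp [starLeft]⟩,
    fun _ => ⟨0, fun b => by simp [starRight]⟩⟩
  add_mem' := by
    rintro S T ⟨hS, hS'⟩ ⟨hT, hT'⟩
    refine ⟨fun a => ?_, fun a => ?_⟩
    · obtain ⟨f, hf⟩ := hS a
      obtain ⟨g, hg⟩ := hT a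
      refine ⟨f + g, fun b => ?_⟩
      have h1 := hf b
      have h2 := hg b
      simp only [map_add]
      exact congrArg₂ (· + ·) h1 h2
    · obtain ⟨f, hf⟩ := hS' a
      obtain ⟨g, hg⟩ := hT' a
      refine ⟨f + g, fun b => ?_⟩
      have h1 := hf b
      have h2 := hg b
      simp only [map_add]
      exact congrArg₂ (· + ·) h1 h2
  smul_mem' := by
    rintro r T ⟨hT, hT'⟩
    refine ⟨fun a => ?_, fun a => ?_⟩
    · obtain ⟨f, hf⟩ := hT a
      refine ⟨r • f, fun b => ?_⟩
      have h1 := hf b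
      simp only [map_smul]
      exact congrArg (r • ·) h1
    · obtain ⟨f, hf⟩ := hT' a
      refine ⟨r • f, fun b => ?_⟩
      have h1 := hf b
      simp only [map_smul]
      exact congrArg (r • ·) h1

variable {θ : ℝ}

/-- `B` is the Moyal product on `ℳ`: `⟨S ⋆ T, b⟩ = ⟨S, T ⋆ b⟩`, where `T ⋆ b ∈ 𝓢`. -/
def IsStarM (B : Moyal n θ →ₗ[ℂ] Moyal n θ →ₗ[ℂ] Moyal n θ) : Prop :=
  ∀ (S T : Moyal n θ) (b f : 𝓢(Space n, ℂ)),
    Represents f (starRight θ (T : 𝓢'(Space n, ℂ)) b) →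
      (B S T : 𝓢'(Space n, ℂ)) b = (S : 𝓢'(Space n, ℂ)) f

open Classical in
/-- The Moyal product on `ℳ`: the unique bilinear map with `⟨S ⋆ T, b⟩ = ⟨S, T ⋆ b⟩`. -/
def starM : Moyal n θ →ₗ[ℂ] Moyal n θ →ₗ[ℂ] Moyal n θ :=
  if h : ∃ B : Moyal n θ →ₗ[ℂ] Moyal n θ →ₗ[ℂ] Moyal n θ, IsStarM B then h.choose else 0

/-- Complex conjugation `a ↦ a†` on Schwartz functions. -/
def conjS : 𝓢(Space n, ℂ) →L[ℝ] 𝓢(Space n, ℂ) :=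
  SchwartzMap.postcompCLM (𝕜 := ℝ) (Complex.conjCLE : ℂ →L[ℝ] ℂ)

/-- The involution on tempered distributions: `⟨T†, a⟩` is the conjugate of `⟨T, a†⟩`. -/
def conjDist (T : 𝓢'(Space n, ℂ)) : 𝓢'(Space n, ℂ) :=
  ContinuousLinearMap.toPointwiseConvergenceCLM ℂ (RingHom.id ℂ) 𝓢(Space n, ℂ) ℂ
    { toFun := fun a => (starRingEnd ℂ) (T (conjS a))
      map_add' := fun a b => by simp
      map_smul' := fun r a => by
        have h : conjS (r • a) = (starRingEnd ℂ) r • conjS a := by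
          ext x
          simp [conjS]
        simp [h]
      cont := Complex.continuous_conj.comp ((map_continuous T).comp conjS.continuous) }

open Classical in
/-- A distribution which lies in `ℳ`, as an element of `ℳ`. -/
def toM (n : ℕ) (θ : ℝ) (T : 𝓢'(Space n, ℂ)) : Moyal n θ :=
  if h : T ∈ Moyal n θ then ⟨T, h⟩ else 0

/-- `ξ_μ = -Θ⁻¹_{μν} x^ν`. -/
def xi (θ : ℝ) (μ : Idx n) (x : Space n) : ℝ := -∑ ν, thetaInv n θ μ ν * x ν

/-- The constant function `c`, as a distribution. -/
def constDist (n : ℕ) (c : ℂ) : 𝓢'(Space n, ℂ) :=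
  Function.HasTemperateGrowth.toTemperedDistribution
    (f := fun _ : Space n => c) (hf := by fun_prop)

theorem xi_hasTemperateGrowth (θ : ℝ) (μ : Idx n) :
    (fun x : Space n => (xi θ μ x : ℂ)).HasTemperateGrowth := by
  have h : (fun x : Space n => (xi θ μ x : ℂ)) =
      (Complex.ofRealCLM ∘L
        (-∑ ν, thetaInv n θ μ ν • (EuclideanSpace.proj ν : Space n →L[ℝ] ℝ))) := by
    ext x
    simp [xi]
  rw [h]
  exact ContinuousLinearMap.hasTemperateGrowth _

/-- `η_μ = i ξ_μ`, as a distribution. -/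
def etaDist (θ : ℝ) (μ : Idx n) : 𝓢'(Space n, ℂ) :=
  Function.HasTemperateGrowth.toTemperedDistribution
    (f := fun x : Space n => Complex.I * (xi θ μ x : ℂ))
    (hf := (Function.HasTemperateGrowth.const Complex.I).mul (xi_hasTemperateGrowth θ μ))

/-- `η_{μν} = i ξ_μ ξ_ν` (pointwise product of functions), as a distribution. -/
def eta2Dist (θ : ℝ) (μ ν : Idx n) : 𝓢'(Space n, ℂ) :=
  Function.HasTemperateGrowth.toTemperedDistribution
    (f := fun x : Space n => Complex.I * ((xi θ μ x : ℂ) * (xi θ ν x : ℂ)))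
    (hf := (Function.HasTemperateGrowth.const Complex.I).mul
      ((xi_hasTemperateGrowth θ μ).mul (xi_hasTemperateGrowth θ ν)))

/-- The ingredients of the Moyal algebra exist: the integral formula defines a product on `𝓢`,
`⟨S ⋆ T, b⟩ = ⟨S, T ⋆ b⟩` defines a product on `ℳ`, the involution preserves `ℳ`, and `ℳ` contains
the constants and the functions `η_μ`, `η_{μν}`. Thus no default value in the definitions of
`starS`, `starM`, `toM` is ever used below. -/
structure WellDefined (n : ℕ) (θ : ℝ) : Prop where
  isStar : IsStar (n := n) θ (starS θ)
  isStarM : IsStarM (n := n) (θ := θ) starM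
  conj_mem : ∀ T ∈ Moyal n θ, conjDist T ∈ Moyal n θ
  const_mem : ∀ c, constDist n c ∈ Moyal n θ
  eta_mem : ∀ μ : Idx n, etaDist θ μ ∈ Moyal n θ
  eta2_mem : ∀ μ ν : Idx n, eta2Dist θ μ ν ∈ Moyal n θ

/-! ### The graded Moyal algebra -/

/-- The vector space `A• = ℳ⁰ ⊕ ℳ¹`. -/
abbrev GAlg (n : ℕ) (θ : ℝ) := Moyal n θ × Moyal n θ

/-- `ab = (a₀ ⋆ b₀ + a₁ ⋆ b₁, a₀ ⋆ b₁ + a₁ ⋆ b₀)`. -/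
def mulA : GAlg n θ →ₗ[ℂ] GAlg n θ →ₗ[ℂ] GAlg n θ :=
  LinearMap.mk₂ ℂ
    (fun a b => (starM a.1 b.1 + starM a.2 b.2, starM a.1 b.2 + starM a.2 b.1))
    (fun a a' b => by ext1 <;> simp <;> abel)
    (fun c a b => by ext1 <;> simp)
    (fun a b b' => by ext1 <;> simp <;> abel)
    (fun c a b => by ext1 <;> simp)

/-- The unit `𝕀 = (1, 0)`. -/
def oneA (n : ℕ) (θ : ℝ) : GAlg n θ := (toM n θ (constDist n 1), 0)

/-- `a† = (a₀†, i a₁†)`. -/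
def daggerA (a : GAlg n θ) : GAlg n θ :=
  (toM n θ (conjDist a.1), Complex.I • toM n θ (conjDist a.2))

/-- The homogeneous component of degree `α`. -/
def comp (α : ZMod 2) : GAlg n θ →ₗ[ℂ] GAlg n θ :=
  if α = 0 then LinearMap.inl ℂ _ _ ∘ₗ LinearMap.fst ℂ _ _
  else LinearMap.inr ℂ _ _ ∘ₗ LinearMap.snd ℂ _ _

/-- The space `A^α` of homogeneous elements of degree `α`. -/
def homog (n : ℕ) (θ : ℝ) (α : ZMod 2) : Submodule ℂ (GAlg n θ) :=
  LinearMap.range (comp (n := n) (θ := θ) α)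

/-- The sign `(-1)^{αβ}`. -/
def sgn (α β : ZMod 2) : ℂ := (-1) ^ (α.val * β.val)

/-- The graded bracket: the bilinear map with `[a, b] = ab - (-1)^{|a||b|} ba` for homogeneous
`a`, `b`. -/
def bracket : GAlg n θ →ₗ[ℂ] GAlg n θ →ₗ[ℂ] GAlg n θ :=
  mulA - ∑ α : ZMod 2, ∑ β : ZMod 2, sgn α β • mulA.flip.compl₁₂ (comp α) (comp β)

/-- The graded center: `z` with `[z, b] = 0` for all `b`. -/
def center (n : ℕ) (θ : ℝ) : Submodule ℂ (GAlg n θ) := LinearMap.ker bracket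

/-! ### Graded derivations -/

/-- `Der^α(A•)`: linear maps `X` of degree `α` with `X(ab) = X(a)b + (-1)^{α|a|} a X(b)` for
homogeneous `a` and arbitrary `b`. -/
def Der (n : ℕ) (θ : ℝ) (α : ZMod 2) : Submodule ℂ (GAlg n θ →ₗ[ℂ] GAlg n θ) where
  carrier := {X | ∀ β, ∀ a ∈ homog n θ β, X a ∈ homog n θ (α + β) ∧
    ∀ b, X (mulA a b) = mulA (X a) b + sgn α β • mulA a (X b)}
  zero_mem' := fun β a _ => ⟨by simp, fun b => by simp⟩
  add_mem' := by
    intro X Y hX hY β a ha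
    refine ⟨add_mem (hX β a ha).1 (hY β a ha).1, fun b => ?_⟩
    simp only [LinearMap.add_apply, (hX β a ha).2 b, (hY β a ha).2 b, map_add, smul_add]
    abel
  smul_mem' := by
    intro r X hX β a ha
    refine ⟨Submodule.smul_mem _ r (hX β a ha).1, fun b => ?_⟩
    simp only [LinearMap.smul_apply, (hX β a ha).2 b, map_smul, smul_add]
    rw [smul_comm]

/-- `Der(A•) = Der⁰(A•) ⊕ Der¹(A•)`. -/
def DerAll (n : ℕ) (θ : ℝ) : Submodule ℂ (GAlg n θ →ₗ[ℂ] GAlg n θ) := ⨆ α, Der n θ α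

/-- `Ad_a : b ↦ [a, b]`. -/
def Ad (a : GAlg n θ) : GAlg n θ →ₗ[ℂ] GAlg n θ := bracket a

/-- `X` is real: `X(a)† = X(a†)`. -/
def IsReal (X : GAlg n θ →ₗ[ℂ] GAlg n θ) : Prop := ∀ a, daggerA (X a) = X (daggerA a)

/-- `[X, Y] = XY - (-1)^{αβ} YX` for `X` of degree `α` and `Y` of degree `β`. -/
def derBracket (α β : ZMod 2) (X Y : GAlg n θ →ₗ[ℂ] GAlg n θ) : GAlg n θ →ₗ[ℂ] GAlg n θ :=
  X ∘ₗ Y - sgn α β • (Y ∘ₗ X)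

/-- `G` is a `ℤ₂`-graded Lie subalgebra of `Der(A•)`: a subspace of `Der(A•)`, the sum of its
homogeneous parts, closed under the graded bracket. -/
structure IsGradedLieSubalgebra (G : Submodule ℂ (GAlg n θ →ₗ[ℂ] GAlg n θ)) : Prop where
  le_der : G ≤ DerAll n θ
  graded : G = ⨆ α, G ⊓ Der n θ α
  bracket_mem : ∀ α β, ∀ X ∈ G ⊓ Der n θ α, ∀ Y ∈ G ⊓ Der n θ β,
    derBracket α β X Y ∈ G ⊓ Der n θ (α + β)

/-- `(zX)(a) = z X(a)`. -/
def actL (z : GAlg n θ) (X : GAlg n θ →ₗ[ℂ] GAlg n θ) : GAlg n θ →ₗ[ℂ] GAlg n θ := mulA z ∘ₗ X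

/-- `Xz`: the linear map with `(Xz)(a) = (-1)^{|a||z|} X(a) z` for homogeneous `a`, where `z` has
degree `γ`. -/
def actR (γ : ZMod 2) (X : GAlg n θ →ₗ[ℂ] GAlg n θ) (z : GAlg n θ) : GAlg n θ →ₗ[ℂ] GAlg n θ :=
  ∑ β : ZMod 2, sgn β γ • (mulA.flip z ∘ₗ X ∘ₗ comp β)

/-- `G` is a graded module over the center for the products `zX` and `Xz`. The center is a
graded unital subalgebra, both products preserve `G` and add degrees, and they satisfy the laws of
a module action (additivity holds by construction). -/
structure IsCenterModule (G : Submodule ℂ (GAlg n θ →ₗ[ℂ] GAlg n θ)) : Prop where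
  one_mem : oneA n θ ∈ center n θ
  mul_mem : ∀ z ∈ center n θ, ∀ w ∈ center n θ, mulA z w ∈ center n θ
  center_graded : center n θ = ⨆ γ, center n θ ⊓ homog n θ γ
  actL_mem : ∀ z ∈ center n θ, ∀ X ∈ G, actL z X ∈ G
  actL_deg : ∀ γ α, ∀ z ∈ center n θ ⊓ homog n θ γ, ∀ X ∈ G ⊓ Der n θ α,
    actL z X ∈ Der n θ (γ + α)
  one_actL : ∀ X ∈ G, actL (oneA n θ) X = X
  mul_actL : ∀ z ∈ center n θ, ∀ w ∈ center n θ, ∀ X ∈ G,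
    actL (mulA z w) X = actL z (actL w X)
  actR_mem : ∀ γ, ∀ z ∈ center n θ ⊓ homog n θ γ, ∀ X ∈ G, actR γ X z ∈ G
  actR_deg : ∀ γ α, ∀ z ∈ center n θ ⊓ homog n θ γ, ∀ X ∈ G ⊓ Der n θ α,
    actR γ X z ∈ Der n θ (α + γ)
  actR_one : ∀ X ∈ G, actR 0 X (oneA n θ) = X
  actR_mul : ∀ γ δ, ∀ z ∈ center n θ ⊓ homog n θ γ, ∀ w ∈ center n θ ⊓ homog n θ δ, ∀ X ∈ G,
    actR (γ + δ) X (mulA z w) = actR δ (actR γ X z) w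

/-! ### The generators -/

/-- `T_μ = (η_μ, 0)`. -/
def gT (θ : ℝ) (μ : Idx n) : GAlg n θ := (toM n θ (etaDist θ μ), 0)

/-- `U_μ = (0, η_μ)`. -/
def gU (θ : ℝ) (μ : Idx n) : GAlg n θ := (0, toM n θ (etaDist θ μ))

/-- `M_{μν} = (η_{μν}, 0)`. -/
def gM (θ : ℝ) (μ ν : Idx n) : GAlg n θ := (toM n θ (eta2Dist θ μ ν), 0)

/-- `J = (0, i)`. -/
def gJ (n : ℕ) (θ : ℝ) : GAlg n θ := (0, toM n θ (constDist n Complex.I))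

/-- The complex span of the derivations `Ad_a`, `a = T_μ, U_μ, M_{μν}, J`. -/
def G2 (n : ℕ) (θ : ℝ) : Submodule ℂ (GAlg n θ →ₗ[ℂ] GAlg n θ) :=
  Submodule.span ℂ (Set.range (fun μ => Ad (gT θ μ)) ∪ Set.range (fun μ => Ad (gU θ μ)) ∪
    Set.range (fun p : Idx n × Idx n => Ad (gM θ p.1 p.2)) ∪ {Ad (gJ n θ)})

/-- The graded commutation relations among the generators. -/
structure CommRel (n : ℕ) (θ : ℝ) : Prop where
  TT : ∀ μ ν : Idx n, bracket (gT θ μ) (gT θ ν) = (Complex.I * (thetaInv n θ μ ν : ℂ)) • oneA n θ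
  MT : ∀ μ ν ρ : Idx n, bracket (gM θ μ ν) (gT θ ρ) =
    (thetaInv n θ ν ρ : ℂ) • gT θ μ + (thetaInv n θ μ ρ : ℂ) • gT θ ν
  MM : ∀ μ ν ρ σ : Idx n, bracket (gM θ μ ν) (gM θ ρ σ) =
    (thetaInv n θ ν σ : ℂ) • gM θ μ ρ + (thetaInv n θ ν ρ : ℂ) • gM θ μ σ +
      (thetaInv n θ μ σ : ℂ) • gM θ ν ρ + (thetaInv n θ μ ρ : ℂ) • gM θ ν σ
  UU : ∀ μ ν : Idx n, bracket (gU θ μ) (gU θ ν) = (2 * Complex.I) • gM θ μ ν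
  TU : ∀ μ ν : Idx n, bracket (gT θ μ) (gU θ ν) = (thetaInv n θ μ ν : ℂ) • gJ n θ
  MU : ∀ μ ν ρ : Idx n, bracket (gM θ μ ν) (gU θ ρ) =
    (thetaInv n θ ν ρ : ℂ) • gU θ μ + (thetaInv n θ μ ρ : ℂ) • gU θ ν
  JJ : bracket (gJ n θ) (gJ n θ) = (-2 : ℂ) • oneA n θ
  TJ : ∀ μ : Idx n, bracket (gT θ μ) (gJ n θ) = 0
  MJ : ∀ μ ν : Idx n, bracket (gM θ μ ν) (gJ n θ) = 0
  UJ : ∀ μ : Idx n, bracket (gU θ μ) (gJ n θ) = (2 * Complex.I) • gT θ μ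

end GradedMoyal

end

/-! Carrying out one of the two integrals gives (a ⋆ b)(x) = ∫ a(x+y) b̃(y) e^{2i yΘ⁻¹x} dy, where
b̃ is the Fourier transform of b for the symplectic phase. This is a partial integral of a Schwartz
function on the doubled space, so ⋆ maps into Schwartz functions (`star`). Fubini gives
associativity (`star_assoc`), and with Fourier inversion also ∫ a ⋆ b = ∫ ab (`integral_star`).

Each T in the Moyal algebra acts on 𝓢 from the left and from the right, and the two actions are
transposes of each other for ∫ fg. The functional b ↦ ⟨S, T ⋆ b⟩ is tempered only if the left action
of T is continuous. This follows from a Hellinger–Toeplitz argument (`IsTranspose.continuous`): 𝓢 is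
complete with countably many seminorms, hence barrelled, and an operator with a transpose has closed
seminorm balls. Approximate units (`exists_tendsto_star`) show that T is determined by its left
action (`moyal_ext_lmul`), so identities in ℳ can be checked as identities of operators on 𝓢.

In this picture η_μ acts from the left as iξ_μ + ½∂_μ and from the right as iξ_μ - ½∂_μ. Hence the
η_μ satisfy the Heisenberg relations (`etaM_commutator`), and η_{μν} is -i/2 times the
anticommutator of η_μ and η_ν (`eta2M_eq`). The remaining relations are algebra. They say that the
even span of T, M, 𝕀 and the odd span of U, J are closed under the graded bracket. Since Ad respects
brackets and kills 𝕀, its image is the graded Lie algebra 𝒢.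

The center consists of the constants (`mem_center_iff`). Testing with the odd unit removes the odd
part; the even part commutes with all η_μ, so its left action commutes with every ξ_μ and ∂_μ.
Schur's lemma makes it a scalar: modulated Gaussians are determined up to a factor by first-order
equations, their pairings do not vanish, and they separate Schwartz functions. The module statements
then reduce to multiplication by scalars. -/

open MeasureTheory Filter Topology

namespace SchwartzMap

/-! ### Tensor products of Schwartz functions -/

section Tensor

variable {E F : Type*} [NormedAddCommGroup E] [NormedSpace ℝ E] [NormedAddCommGroup F]
  [NormedSpace ℝ F]

theorem norm_iteratedFDeriv_comp_fst_le (a : 𝓢(E, ℂ)) (i : ℕ) (p : E × F) :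
    ‖iteratedFDeriv ℝ i (fun q : E × F => a q.1) p‖ ≤ ‖iteratedFDeriv ℝ i a p.1‖ := by
  have h := (ContinuousLinearMap.fst ℝ E F).iteratedFDeriv_comp_right (a.smooth ⊤) p
    (i := i) (by exact_mod_cast le_top)
  change ‖iteratedFDeriv ℝ i (a ∘ ContinuousLinearMap.fst ℝ E F) p‖ ≤ _
  rw [h]
  refine (ContinuousMultilinearMap.norm_compContinuousLinearMap_le _ _).trans ?_
  refine mul_le_of_le_one_right (norm_nonneg _) (Finset.prod_le_one (fun _ _ => norm_nonneg _) ?_)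
  exact fun _ _ => ContinuousLinearMap.norm_fst_le _ _ _

theorem norm_iteratedFDeriv_comp_snd_le (b : 𝓢(F, ℂ)) (i : ℕ) (p : E × F) :
    ‖iteratedFDeriv ℝ i (fun q : E × F => b q.2) p‖ ≤ ‖iteratedFDeriv ℝ i b p.2‖ := by
  have h := (ContinuousLinearMap.snd ℝ E F).iteratedFDeriv_comp_right (b.smooth ⊤) p
    (i := i) (by exact_mod_cast le_top)
  change ‖iteratedFDeriv ℝ i (b ∘ ContinuousLinearMap.snd ℝ E F) p‖ ≤ _
  rw [h]
  refine (ContinuousMultilinearMap.norm_compContinuousLinearMap_le _ _).trans ?_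
  refine mul_le_of_le_one_right (norm_nonneg _) (Finset.prod_le_one (fun _ _ => norm_nonneg _) ?_)
  exact fun _ _ => ContinuousLinearMap.norm_snd_le _ _ _

/-- The tensor product `(x, y) ↦ a x * b y` of Schwartz functions. -/
noncomputable def tensor (a : 𝓢(E, ℂ)) (b : 𝓢(F, ℂ)) : 𝓢(E × F, ℂ) where
  toFun p := a p.1 * b p.2
  smooth' := ((a.smooth ⊤).comp contDiff_fst).mul ((b.smooth ⊤).comp contDiff_snd)
  decay' k n := by
    refine ⟨∑ i ∈ Finset.range (n + 1), (n.choose i : ℝ) *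
      (SchwartzMap.seminorm ℝ k i a * SchwartzMap.seminorm ℝ 0 (n - i) b +
        SchwartzMap.seminorm ℝ 0 i a * SchwartzMap.seminorm ℝ k (n - i) b), fun p => ?_⟩
    have h := norm_iteratedFDeriv_mul_le (𝕜 := ℝ) (n := n) (N := ((⊤ : ℕ∞) : WithTop ℕ∞))
      ((a.smooth ⊤).comp (contDiff_fst (E := E) (F := F)))
      ((b.smooth ⊤).comp (contDiff_snd (E := E) (F := F))) p (by exact_mod_cast le_top)
    refine (mul_le_mul_of_nonneg_left h (by positivity)).trans ?_
    rw [Finset.mul_sum]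
    refine Finset.sum_le_sum fun i _ => ?_
    have ha := norm_iteratedFDeriv_comp_fst_le (F := F) a i p
    have hb := norm_iteratedFDeriv_comp_snd_le (E := E) b (n - i) p
    -- The product norm is a maximum, so the weight can be placed on one factor at a time.
    have hp : ‖p‖ ^ k ≤ ‖p.1‖ ^ k + ‖p.2‖ ^ k := by
      rcases max_choice ‖p.1‖ ‖p.2‖ with h | h
      · rw [Prod.norm_def, h]; exact le_add_of_nonneg_right (by positivity)
      · rw [Prod.norm_def, h]; exact le_add_of_nonneg_left (by positivity)
    have h1 := a.le_seminorm ℝ k i p.1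
    have h2 := b.le_seminorm ℝ k (n - i) p.2
    have h3 := a.norm_iteratedFDeriv_le_seminorm ℝ i p.1
    have h4 := b.norm_iteratedFDeriv_le_seminorm ℝ (n - i) p.2
    calc ‖p‖ ^ k * ((n.choose i : ℝ) * ‖iteratedFDeriv ℝ i (fun q : E × F => a q.1) p‖ *
          ‖iteratedFDeriv ℝ (n - i) (fun q : E × F => b q.2) p‖)
        ≤ (‖p.1‖ ^ k + ‖p.2‖ ^ k) * ((n.choose i : ℝ) * ‖iteratedFDeriv ℝ i a p.1‖ *
          ‖iteratedFDeriv ℝ (n - i) b p.2‖) := by gcongr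
      _ = (n.choose i : ℝ) * ((‖p.1‖ ^ k * ‖iteratedFDeriv ℝ i a p.1‖) *
            ‖iteratedFDeriv ℝ (n - i) b p.2‖ +
            ‖iteratedFDeriv ℝ i a p.1‖ * (‖p.2‖ ^ k * ‖iteratedFDeriv ℝ (n - i) b p.2‖)) := by
          ring
      _ ≤ _ := by gcongr

@[simp]
theorem tensor_apply (a : 𝓢(E, ℂ)) (b : 𝓢(F, ℂ)) (p : E × F) :
    tensor a b p = a p.1 * b p.2 := rfl

end Tensor

/-! ### Integration over one factor -/

section PartialIntegral

universe u v

variable {E : Type u} {F : Type v} [NormedAddCommGroup E] [NormedSpace ℝ E]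
  [NormedAddCommGroup F] [NormedSpace ℝ F]

/-- The derivative of a Schwartz function on a product in the direction of the first factor. -/
noncomputable def fderivFst {W : Type u} [NormedAddCommGroup W] [NormedSpace ℝ W]
    (G : 𝓢(E × F, W)) : 𝓢(E × F, E →L[ℝ] W) :=
  postcompCLM ((ContinuousLinearMap.compL ℝ E (E × F) W).flip (ContinuousLinearMap.inl ℝ E F))
    (fderivCLM ℝ (E × F) W G)

theorem hasFDerivAt_slice {W : Type u} [NormedAddCommGroup W] [NormedSpace ℝ W]
    (G : 𝓢(E × F, W)) (x : E) (y : F) :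
    HasFDerivAt (fun x => G (x, y)) (fderivFst G (x, y)) x := by
  exact HasFDerivAt.comp (g := G) x (G.hasFDerivAt (x, y)) (hasFDerivAt_prodMk_left x y)

variable [MeasurableSpace F] (μ : Measure F)

/-- A single seminorm of weight k + r controls ‖x‖^k and (1+‖y‖)^r together, where r makes
(1+‖y‖)^{-r} integrable. Uniformity in x serves both differentiation under the integral and decay.
-/
theorem exists_integrable_bound {W : Type u} [NormedAddCommGroup W] [NormedSpace ℝ W]
    [μ.HasTemperateGrowth] (G : 𝓢(E × F, W)) (k : ℕ) :
    ∃ g : F → ℝ, Integrable g μ ∧ ∀ x y, ‖x‖ ^ k * ‖G (x, y)‖ ≤ g y := by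
  set r := μ.integrablePower
  set C := 2 ^ (k + r) * (Finset.Iic (k + r, 0)).sup
    (fun m => SchwartzMap.seminorm ℝ m.1 m.2) G
  refine ⟨fun y => C * (1 + ‖y‖) ^ (-(r : ℝ)),
    (Measure.integrable_pow_neg_integrablePower μ).const_mul C, fun x y => ?_⟩
  have h := one_add_le_sup_seminorm_apply (𝕜 := ℝ) (m := (k + r, 0)) (le_refl (k + r))
    (le_refl 0) G (x, y)
  rw [norm_iteratedFDeriv_zero] at h
  have hx : ‖x‖ ≤ 1 + ‖(x, y)‖ := by
    have := norm_fst_le (x, y); simp only at this; linarith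
  have hy : 1 + ‖y‖ ≤ 1 + ‖(x, y)‖ := by
    have := norm_snd_le (x, y); simp only at this; linarith
  change _ ≤ C * (1 + ‖y‖) ^ (-(r : ℝ))
  rw [Real.rpow_neg (by positivity), Real.rpow_natCast, ← div_eq_mul_inv,
    le_div_iff₀ (by positivity)]
  calc ‖x‖ ^ k * ‖G (x, y)‖ * (1 + ‖y‖) ^ r
      = ‖x‖ ^ k * (1 + ‖y‖) ^ r * ‖G (x, y)‖ := by ring
    _ ≤ (1 + ‖(x, y)‖) ^ k * (1 + ‖(x, y)‖) ^ r * ‖G (x, y)‖ := by gcongr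
    _ ≤ C := by rw [← pow_add]; exact h

variable [BorelSpace F] [SecondCountableTopology F]

theorem aestronglyMeasurable_slice {W : Type u} [NormedAddCommGroup W] [NormedSpace ℝ W]
    (G : 𝓢(E × F, W)) (x : E) :
    AEStronglyMeasurable (fun y => G (x, y)) μ :=
  (G.continuous.comp (by fun_prop)).aestronglyMeasurable

variable [hμ : μ.HasTemperateGrowth]

theorem integrable_slice {W : Type u} [NormedAddCommGroup W] [NormedSpace ℝ W]
    (G : 𝓢(E × F, W)) (x : E) : Integrable (fun y => G (x, y)) μ := by
  obtain ⟨g, hg, h⟩ := exists_integrable_bound μ G 0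
  exact hg.mono' (aestronglyMeasurable_slice μ G x)
    (Eventually.of_forall fun y => by simpa using h x y)

theorem hasFDerivAt_integral_slice {W : Type u} [NormedAddCommGroup W] [NormedSpace ℝ W]
    (G : 𝓢(E × F, W)) (x : E) :
    HasFDerivAt (fun x => ∫ y, G (x, y) ∂μ) (∫ y, fderivFst G (x, y) ∂μ) x := by
  obtain ⟨g, hg, h⟩ := exists_integrable_bound μ (fderivFst G) 0
  exact hasFDerivAt_integral_of_dominated_of_fderiv_le (F := fun x y => G (x, y))
    (F' := fun x y => fderivFst G (x, y)) (s := Set.univ) (bound := g) Filter.univ_mem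
    (Eventually.of_forall fun x => aestronglyMeasurable_slice μ G x) (integrable_slice μ G x)
    (aestronglyMeasurable_slice μ _ x)
    (Eventually.of_forall fun y x _ => by simpa using h x y) hg
    (Eventually.of_forall fun y x _ => hasFDerivAt_slice G x y)

theorem fderiv_integral_slice {W : Type u} [NormedAddCommGroup W] [NormedSpace ℝ W]
    (G : 𝓢(E × F, W)) :
    fderiv ℝ (fun x => ∫ y, G (x, y) ∂μ) = fun x => ∫ y, fderivFst G (x, y) ∂μ :=
  funext fun x => (hasFDerivAt_integral_slice μ G x).fderiv

/-- The derivative of a slice integral is again one, with values in `E →L[ℝ] W`. Hence the induction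
runs over all target spaces, taken in the universe of `E` so that the new target is of the same
kind. -/
theorem contDiff_integral_slice (n : ℕ) : ∀ {W : Type u} [NormedAddCommGroup W] [NormedSpace ℝ W]
    (G : 𝓢(E × F, W)), ContDiff ℝ n (fun x => ∫ y, G (x, y) ∂μ) := by
  induction n with
  | zero =>
    intro W _ _ G
    have : Differentiable ℝ (fun x => ∫ y, G (x, y) ∂μ) :=
      fun x => (hasFDerivAt_integral_slice μ G x).differentiableAt
    exact contDiff_zero.2 this.continuous
  | succ n ih =>
    intro W _ _ G
    push_cast
    refine contDiff_succ_iff_fderiv.2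
      ⟨fun x => (hasFDerivAt_integral_slice μ G x).differentiableAt, by simp, ?_⟩
    rw [fderiv_integral_slice]
    exact ih _

theorem decay_integral_slice (k n : ℕ) : ∀ {W : Type u} [NormedAddCommGroup W] [NormedSpace ℝ W]
    (G : 𝓢(E × F, W)),
    ∃ C, ∀ x, ‖x‖ ^ k * ‖iteratedFDeriv ℝ n (fun x => ∫ y, G (x, y) ∂μ) x‖ ≤ C := by
  induction n with
  | zero =>
    intro W _ _ G
    obtain ⟨g, hg, h⟩ := exists_integrable_bound μ G k
    refine ⟨∫ y, g y ∂μ, fun x => ?_⟩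
    rw [norm_iteratedFDeriv_zero]
    calc ‖x‖ ^ k * ‖∫ y, G (x, y) ∂μ‖ ≤ ‖x‖ ^ k * ∫ y, ‖G (x, y)‖ ∂μ := by
          gcongr; exact norm_integral_le_integral_norm _
      _ = ∫ y, ‖x‖ ^ k * ‖G (x, y)‖ ∂μ := (integral_const_mul _ _).symm
      _ ≤ _ := integral_mono ((integrable_slice μ G x).norm.const_mul _) hg (h x)
  | succ n ih =>
    intro W _ _ G
    obtain ⟨C, hC⟩ := ih (fderivFst G)
    refine ⟨C, fun x => ?_⟩
    rw [← norm_iteratedFDeriv_fderiv, fderiv_integral_slice]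
    exact hC x

/-- Integration of a Schwartz function on a product over the second factor. -/
noncomputable def partialIntegral {W : Type u} [NormedAddCommGroup W] [NormedSpace ℝ W]
    (G : 𝓢(E × F, W)) : 𝓢(E, W) where
  toFun x := ∫ y, G (x, y) ∂μ
  smooth' := contDiff_infty.2 fun n => contDiff_integral_slice μ n G
  decay' k n := decay_integral_slice μ k n G

theorem partialIntegral_apply {W : Type u} [NormedAddCommGroup W] [NormedSpace ℝ W]
    (G : 𝓢(E × F, W)) (x : E) :
    partialIntegral μ G x = ∫ y, G (x, y) ∂μ := rfl

end PartialIntegral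

theorem integrable_prod {V : Type*} [NormedAddCommGroup V] [InnerProductSpace ℝ V]
    [FiniteDimensional ℝ V] [MeasurableSpace V] [BorelSpace V] (G : 𝓢(V × V, ℂ)) :
    Integrable (fun p => G p) ((volume : Measure V).prod volume) :=
  G.integrable

/-! ### Oscillating factors -/

section Phase

variable {E : Type*} [NormedAddCommGroup E] [NormedSpace ℝ E]

theorem hasTemperateGrowth_cexp_I :
    (fun t : ℝ => Complex.exp (Complex.I * t)).HasTemperateGrowth := by
  have hd : ∀ n : ℕ, iteratedDeriv n (fun t : ℝ => Complex.exp (Complex.I * t)) =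
      fun t : ℝ => Complex.I ^ n * Complex.exp (Complex.I * t) := by
    intro n
    induction n with
    | zero => simp
    | succ n ih =>
      rw [iteratedDeriv_succ, ih]
      funext t
      have h : HasDerivAt (fun t : ℝ => Complex.exp (Complex.I * t))
          (Complex.exp (Complex.I * t) * (Complex.I * 1)) t :=
        ((Complex.ofRealCLM.hasDerivAt (x := t)).const_mul Complex.I).cexp
      rw [(h.const_mul (Complex.I ^ n)).deriv]
      ring
  refine ⟨?_, fun n => ⟨0, 1, fun t => ?_⟩⟩
  · exact (contDiff_const.mul Complex.ofRealCLM.contDiff).cexp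
  · rw [norm_iteratedFDeriv_eq_norm_iteratedDeriv, hd]
    simp [mul_comm Complex.I, Complex.norm_exp_ofReal_mul_I]

theorem hasTemperateGrowth_phase {q : E → ℝ} (hq : q.HasTemperateGrowth) :
    (fun x => Complex.exp (Complex.I * q x)).HasTemperateGrowth :=
  hasTemperateGrowth_cexp_I.comp hq

end Phase

/-! ### Completeness and barrelledness of the Schwartz space -/

section Complete

variable {E F : Type*} [NormedAddCommGroup E] [NormedSpace ℝ E] [NormedAddCommGroup F]
  [NormedSpace ℝ F] [CompleteSpace F]

theorem norm_iteratedFDeriv_tsum_le {d : ℕ → 𝓢(E, F)}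
    (hd : ∀ k l, Summable fun j => SchwartzMap.seminorm ℝ k l (d j)) (k l : ℕ) (x : E) :
    ‖x‖ ^ k * ‖iteratedFDeriv ℝ l (fun x => ∑' j, d j x) x‖ ≤
      ∑' j, SchwartzMap.seminorm ℝ k l (d j) := by
  have h := iteratedFDeriv_tsum_apply (𝕜 := ℝ) (f := fun j x => d j x) (N := ⊤)
    (v := fun l j => SchwartzMap.seminorm ℝ 0 l (d j)) (fun j => (d j).smooth ⊤)
    (fun l _ => hd 0 l) (fun l j x _ => (d j).norm_iteratedFDeriv_le_seminorm ℝ l x)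
    (k := l) le_top x
  have hs : Summable fun j => ‖iteratedFDeriv ℝ l (d j) x‖ :=
    (hd 0 l).of_nonneg_of_le (fun j => norm_nonneg _)
      fun j => (d j).norm_iteratedFDeriv_le_seminorm ℝ l x
  rw [h]
  calc ‖x‖ ^ k * ‖∑' j, iteratedFDeriv ℝ l (d j) x‖
      ≤ ‖x‖ ^ k * ∑' j, ‖iteratedFDeriv ℝ l (d j) x‖ := by
        gcongr; exact norm_tsum_le_tsum_norm hs
    _ = ∑' j, ‖x‖ ^ k * ‖iteratedFDeriv ℝ l (d j) x‖ := tsum_mul_left.symm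
    _ ≤ _ := (hs.mul_left _).tsum_le_tsum (fun j => (d j).le_seminorm ℝ k l x) (hd k l)

/-- The sum of a series of Schwartz functions all of whose seminorms are summable. -/
noncomputable def seriesSum (d : ℕ → 𝓢(E, F))
    (hd : ∀ k l, Summable fun j => SchwartzMap.seminorm ℝ k l (d j)) : 𝓢(E, F) where
  toFun x := ∑' j, d j x
  smooth' := contDiff_tsum (𝕜 := ℝ) (f := fun j x => d j x)
    (v := fun l j => SchwartzMap.seminorm ℝ 0 l (d j)) (fun j => (d j).smooth ⊤)
    (fun l _ => hd 0 l) (fun l j x _ => (d j).norm_iteratedFDeriv_le_seminorm ℝ l x)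
  decay' k l := ⟨_, norm_iteratedFDeriv_tsum_le hd k l⟩

theorem seminorm_seriesSum_le (d : ℕ → 𝓢(E, F))
    (hd : ∀ k l, Summable fun j => SchwartzMap.seminorm ℝ k l (d j)) (k l : ℕ) :
    SchwartzMap.seminorm ℝ k l (seriesSum d hd) ≤ ∑' j, SchwartzMap.seminorm ℝ k l (d j) :=
  seminorm_le_bound ℝ k l _ (tsum_nonneg fun _ => apply_nonneg _ _)
    (norm_iteratedFDeriv_tsum_le hd k l)

theorem seriesSum_sub_sum (d : ℕ → 𝓢(E, F))
    (hd : ∀ k l, Summable fun j => SchwartzMap.seminorm ℝ k l (d j)) (m : ℕ) :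
    seriesSum d hd - ∑ j ∈ Finset.range m, d j = seriesSum (fun j => d (j + m))
      (fun k l => (summable_nat_add_iff m).2 (hd k l)) := by
  ext x
  have hs : Summable fun j => d j x := Summable.of_norm_bounded (hd 0 0)
    fun j => (d j).norm_le_seminorm ℝ x
  have h := hs.sum_add_tsum_nat_add m
  change ∑' j, d j x - (∑ j ∈ Finset.range m, d j) x = ∑' j, d (j + m) x
  rw [sum_apply, ← h]
  abel

theorem tendsto_sum_seriesSum (d : ℕ → 𝓢(E, F))
    (hd : ∀ k l, Summable fun j => SchwartzMap.seminorm ℝ k l (d j)) :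
    Tendsto (fun m => ∑ j ∈ Finset.range m, d j) atTop (𝓝 (seriesSum d hd)) := by
  rw [(schwartz_withSeminorms ℝ E F).tendsto_nhds]
  rintro ⟨k, l⟩ ε hε
  have h := (tendsto_order.1 (tendsto_sum_nat_add
    fun j => SchwartzMap.seminorm ℝ k l (d j))).2 ε hε
  filter_upwards [h] with m hm
  rw [map_sub_rev, seriesSum_sub_sum]
  exact (seminorm_seriesSum_le _ _ k l).trans_lt hm

instance instIsCountablyGeneratedUniformity : (uniformity 𝓢(E, F)).IsCountablyGenerated :=
  IsUniformAddGroup.uniformity_countably_generated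

/-- The uniformity is countably generated, so sequences that are Cauchy at a prescribed geometric
rate suffice. Their increments are summable in every seminorm, and the limit is the telescoping
series. -/
instance instCompleteSpace : CompleteSpace 𝓢(E, F) := by
  refine UniformSpace.complete_of_convergent_controlled_sequences
    (fun N => {p | ∀ i ∈ Finset.Iic (N, N),
      schwartzSeminormFamily ℝ E F i (p.2 - p.1) < (1 / 2) ^ N}) (fun N => ?_) fun u hu => ?_
  · rw [uniformity_eq_comap_nhds_zero]
    refine ⟨{f | ∀ i ∈ Finset.Iic (N, N), schwartzSeminormFamily ℝ E F i f < (1 / 2) ^ N}, ?_,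
      fun p hp => hp⟩
    refine (eventually_all_finset _).2 fun i _ => ?_
    have h := ((schwartz_withSeminorms ℝ E F).continuous_seminorm i).tendsto 0
    rw [map_zero] at h
    exact (tendsto_order.1 h).2 _ (by positivity)
  · have hd : ∀ k l, Summable fun j => SchwartzMap.seminorm ℝ k l (u (j + 1) - u j) := by
      intro k l
      -- The rate controls the seminorm (k, l) only from index max k l on.
      refine Summable.of_norm_bounded_eventually_nat summable_geometric_two ?_
      filter_upwards [eventually_ge_atTop (max k l)] with j hj
      rw [Real.norm_of_nonneg (apply_nonneg _ _)]
      exact (hu j j (j + 1) le_rfl (Nat.le_succ j) (k, l)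
        (Finset.mem_Iic.2 ⟨le_of_max_le_left hj, le_of_max_le_right hj⟩)).le
    refine ⟨u 0 + seriesSum _ hd, ?_⟩
    have h := (tendsto_sum_seriesSum _ hd).const_add (u 0)
    refine h.congr fun m => ?_
    rw [Finset.sum_range_sub]
    abel

/-- Baire category: completeness and a countably generated uniformity suffice. -/
instance instBarrelledSpace : BarrelledSpace ℝ 𝓢(E, F) := inferInstance

end Complete

/-- Evaluating on vectors writes a seminorm ball as an intersection of scalar conditions, each of
which can be shown closed separately. -/
theorem seminorm_le_iff {V : Type*} [NormedAddCommGroup V] [NormedSpace ℝ V] {f : 𝓢(V, ℂ)}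
    {k n : ℕ} {c : ℝ} (hc : 0 ≤ c) :
    SchwartzMap.seminorm ℝ k n f ≤ c ↔
      ∀ x (m : Fin n → V), ‖x‖ ^ k * ‖iteratedFDeriv ℝ n f x m‖ ≤ c * ∏ i, ‖m i‖ := by
  refine ⟨fun h x m => ?_, fun h => seminorm_le_bound ℝ k n f hc fun x => ?_⟩
  · calc ‖x‖ ^ k * ‖iteratedFDeriv ℝ n f x m‖
        ≤ ‖x‖ ^ k * (‖iteratedFDeriv ℝ n f x‖ * ∏ i, ‖m i‖) := by
          gcongr; exact ContinuousMultilinearMap.le_opNorm _ _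
      _ = (‖x‖ ^ k * ‖iteratedFDeriv ℝ n f x‖) * ∏ i, ‖m i‖ := by ring
      _ ≤ c * ∏ i, ‖m i‖ := by
          gcongr; exact (f.le_seminorm ℝ k n x).trans h
  · have h1 : ‖(‖x‖ ^ k) • iteratedFDeriv ℝ n f x‖ ≤ c := by
      refine ContinuousMultilinearMap.opNorm_le_bound hc fun m => ?_
      rw [smul_apply, norm_smul, norm_pow, norm_norm]
      exact h x m
    rwa [norm_smul, norm_pow, norm_norm] at h1

/-! ### Automatic continuity of operators with a transpose -/

section Transpose

open scoped LineDeriv Convolution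

variable {V : Type*} [NormedAddCommGroup V] [InnerProductSpace ℝ V] [FiniteDimensional ℝ V]
  [MeasurableSpace V] [BorelSpace V]

/-- `A'` is a formal transpose of `A` for the bilinear pairing `∫ f g`. -/
def IsTranspose (A A' : 𝓢(V, ℂ) → 𝓢(V, ℂ)) : Prop :=
  ∀ f g, ∫ x, A f x * g x = ∫ x, f x * A' g x

/-- Normalized bumps concentrating at x form a delta sequence, so point values are recovered from
pairings. -/
theorem exists_tendsto_integral_mul (x : V) :
    ∃ δ : ℕ → 𝓢(V, ℂ), ∀ g : 𝓢(V, ℂ), Tendsto (fun j => ∫ y, g y * δ j y) atTop (𝓝 (g x)) := by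
  let φ : ℕ → ContDiffBump (0 : V) := fun j =>
    ⟨1 / (2 * ((j : ℝ) + 1)), 1 / ((j : ℝ) + 1), by positivity, by
      apply one_div_lt_one_div_of_lt <;> linarith [(Nat.cast_nonneg j : (0 : ℝ) ≤ j)]⟩
  have hcs : ∀ j, HasCompactSupport fun y => (((φ j).normed volume (x - y) : ℝ) : ℂ) := fun j =>
    ((φ j).hasCompactSupport_normed.comp_homeomorph (Homeomorph.subLeft x)).comp_left
      (g := Complex.ofReal) Complex.ofReal_zero
  have hsm : ∀ j, ContDiff ℝ ((⊤ : ℕ∞) : WithTop ℕ∞)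
      fun y => (((φ j).normed volume (x - y) : ℝ) : ℂ) := fun j =>
    Complex.ofRealCLM.contDiff.comp ((φ j).contDiff_normed.comp (contDiff_const.sub contDiff_id))
  refine ⟨fun j => (hcs j).toSchwartzMap (hsm j), fun g => ?_⟩
  have h := ContDiffBump.convolution_tendsto_right_of_continuous (μ := (volume : Measure V))
    (φ := φ) (l := atTop) tendsto_one_div_add_atTop_nhds_zero_nat g.continuous x
  refine h.congr fun j => ?_
  rw [convolution_eq_swap]
  refine integral_congr_ae (Eventually.of_forall fun y => ?_)
  change (φ j).normed volume (x - y) • g y = g y * (((φ j).normed volume (x - y) : ℝ) : ℂ)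
  rw [Complex.real_smul, mul_comm]

theorem continuous_integral_mul (s : 𝓢(V, ℂ)) : Continuous fun f : 𝓢(V, ℂ) => ∫ x, f x * s x := by
  have h := ((integralCLM ℂ (volume : Measure V)).comp
    (smulLeftCLM ℂ (s : V → ℂ))).continuous
  refine h.congr fun f => ?_
  change ∫ x, smulLeftCLM ℂ (s : V → ℂ) f x = _
  simp [smulLeftCLM_apply_apply s.hasTemperateGrowth, mul_comm]

/-- Banach–Steinhaus: f ↦ A f x is the pointwise limit of f ↦ ∫ A f δ_j = ∫ f A'δ_j, and each of
these is continuous although A is not yet known to be. -/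
theorem IsTranspose.continuous_apply {A : 𝓢(V, ℂ) →ₗ[ℂ] 𝓢(V, ℂ)} {A' : 𝓢(V, ℂ) → 𝓢(V, ℂ)}
    (h : IsTranspose A A') (x : V) : Continuous fun f => A f x := by
  obtain ⟨δ, hδ⟩ := exists_tendsto_integral_mul x
  let g : ℕ → 𝓢(V, ℂ) →L[ℂ] ℂ := fun j =>
    { toFun := fun f => ∫ y, f y * A' (δ j) y
      map_add' := fun f₁ f₂ => by
        rw [← h, ← h, ← h, map_add, ← integral_add]
        · simp [add_mul]
        · exact (pairing (ContinuousLinearMap.mul ℂ ℂ) (A f₁) (δ j)).integrable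
        · exact (pairing (ContinuousLinearMap.mul ℂ ℂ) (A f₂) (δ j)).integrable
      map_smul' := fun c f => by
        rw [← h, ← h, map_smul, RingHom.id_apply, smul_eq_mul, ← integral_const_mul]
        simp [mul_assoc]
      cont := continuous_integral_mul _ }
  have hg : Tendsto (fun j f => g j f) atTop (𝓝 fun f => A f x) :=
    tendsto_pi_nhds.2 fun f => (hδ (A f)).congr fun j => h f (δ j)
  exact (continuousLinearMapOfTendsto g hg).continuous

theorem IsTranspose.lineDeriv {A A' : 𝓢(V, ℂ) → 𝓢(V, ℂ)} (h : IsTranspose A A') (m : V) :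
    IsTranspose (fun f => ∂_{m} (A f)) (fun g => -A' (∂_{m} g)) := by
  intro f g
  have h1 := integral_mul_lineDerivOp_right_eq_neg_left (μ := (volume : Measure V)) (A f) g m
  rw [h] at h1
  simp only [neg_apply, mul_neg, integral_neg, h1, neg_neg]

/-- Repeated integration by parts keeps a transpose available, so pointwise continuity extends to
all derivatives of A f. -/
theorem IsTranspose.iteratedLineDeriv {A A' : 𝓢(V, ℂ) → 𝓢(V, ℂ)} (h : IsTranspose A A')
    {n : ℕ} (m : Fin n → V) : ∃ A'', IsTranspose (fun f => ∂^{m} (A f)) A'' := by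
  induction n with
  | zero => exact ⟨A', by simpa using! h⟩
  | succ n ih =>
    obtain ⟨A'', hA⟩ := ih (Fin.tail m)
    exact ⟨_, by simpa only [LineDeriv.iteratedLineDerivOp_succ_left] using hA.lineDeriv (m 0)⟩

theorem IsTranspose.continuous_iteratedFDeriv_apply {A : 𝓢(V, ℂ) →ₗ[ℂ] 𝓢(V, ℂ)}
    {A' : 𝓢(V, ℂ) → 𝓢(V, ℂ)} (h : IsTranspose A A') {n : ℕ} (m : Fin n → V) (x : V) :
    Continuous fun f => iteratedFDeriv ℝ n (A f) x m := by
  obtain ⟨A'', hA⟩ := h.iteratedLineDeriv m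
  have h' : IsTranspose
      ((LineDeriv.iteratedLineDerivOpCLM ℂ 𝓢(V, ℂ) m).toLinearMap ∘ₗ A) A'' := hA
  refine (h'.continuous_apply x).congr fun f => ?_
  rw [← iteratedLineDerivOp_eq_iteratedFDeriv]
  rfl

theorem IsTranspose.isClosed_seminorm_le {A : 𝓢(V, ℂ) →ₗ[ℂ] 𝓢(V, ℂ)} {A' : 𝓢(V, ℂ) → 𝓢(V, ℂ)}
    (h : IsTranspose A A') (k n : ℕ) (c : ℝ) :
    IsClosed {f | SchwartzMap.seminorm ℝ k n (A f) ≤ c} := by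
  rcases lt_or_ge c 0 with hc | hc
  · have h0 : {f | SchwartzMap.seminorm ℝ k n (A f) ≤ c} = ∅ :=
      Set.eq_empty_of_forall_notMem fun f hf => (hc.trans_le (apply_nonneg _ (A f))).not_ge hf
    rw [h0]
    exact isClosed_empty
  · simp only [seminorm_le_iff hc, Set.ofPred_forall]
    refine isClosed_iInter fun x => isClosed_iInter fun m => ?_
    exact isClosed_le ((h.continuous_iteratedFDeriv_apply m x).norm.const_mul _) continuous_const

/-- The Hellinger–Toeplitz theorem for Schwartz functions: an operator with a formal transpose is
continuous. -/
theorem IsTranspose.continuous {A : 𝓢(V, ℂ) →ₗ[ℂ] 𝓢(V, ℂ)} {A' : 𝓢(V, ℂ) → 𝓢(V, ℂ)}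
    (h : IsTranspose A A') : Continuous A := by
  refine WithSeminorms.continuous_of_continuous_comp (schwartz_withSeminorms ℝ V ℂ)
    (A.restrictScalars ℝ) fun i => ?_
  -- The pulled-back seminorm has closed sublevel sets, and on a barrelled space a lower
  -- semicontinuous seminorm is continuous.
  exact Seminorm.continuous_of_lowerSemicontinuous _
    (lowerSemicontinuous_iff_isClosed_preimage.2 (h.isClosed_seminorm_le i.1 i.2))

end Transpose

/-! ### Modulated Gaussians as Schwartz functions -/

section Gaussian

variable {E : Type*} [NormedAddCommGroup E] [NormedSpace ℝ E]

theorem contDiff_of_fderiv_eq_smul {f : E → ℂ} {L : E → E →L[ℝ] ℂ} (hL : L.HasTemperateGrowth)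
    (hf : Differentiable ℝ f) (h : ∀ x, fderiv ℝ f x = f x • L x) (n : ℕ) : ContDiff ℝ n f := by
  induction n with
  | zero => exact contDiff_zero.2 hf.continuous
  | succ n ih =>
    push_cast
    refine contDiff_succ_iff_fderiv.2 ⟨hf, by simp, ?_⟩
    rw [funext h]
    exact ih.smul (hL.1.of_le (by exact_mod_cast le_top))

/-- By Leibniz, a derivative of order n + 1 combines derivatives of f of order at most n with
derivatives of L. The latter grow at most like (1+‖x‖)^l, so the induction hypothesis is used with
weight k + l. -/
theorem decay_of_fderiv_eq_smul {f : E → ℂ} {L : E → E →L[ℝ] ℂ} (hL : L.HasTemperateGrowth)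
    (hf : Differentiable ℝ f) (h : ∀ x, fderiv ℝ f x = f x • L x)
    (h0 : ∀ k : ℕ, ∃ C, ∀ x, (1 + ‖x‖) ^ k * ‖f x‖ ≤ C) (n : ℕ) :
    ∀ k : ℕ, ∃ C, ∀ x, (1 + ‖x‖) ^ k * ‖iteratedFDeriv ℝ n f x‖ ≤ C := by
  induction n using Nat.strong_induction_on with
  | _ n ih =>
  rcases n with _ | n
  · simpa only [norm_iteratedFDeriv_zero] using h0
  · intro k
    obtain ⟨l, C, hC, hCL⟩ := hL.norm_iteratedFDeriv_le_uniform n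
    have ih' : ∀ i : Fin (n + 1), ∃ K, ∀ x, (1 + ‖x‖) ^ (k + l) * ‖iteratedFDeriv ℝ i f x‖ ≤ K :=
      fun i => ih i i.2 (k + l)
    choose K hK using ih'
    refine ⟨∑ i : Fin (n + 1), (n.choose i : ℝ) * K i * C, fun x => ?_⟩
    rw [← norm_iteratedFDeriv_fderiv, funext h]
    have hb := norm_iteratedFDeriv_smul_le (𝕜 := ℝ) (N := (n : WithTop ℕ∞))
      (contDiff_of_fderiv_eq_smul hL hf h n) (hL.1.of_le (by exact_mod_cast le_top)) x le_rfl
    rw [← Fin.sum_univ_eq_sum_range (fun i => (n.choose i : ℝ) * ‖iteratedFDeriv ℝ i f x‖ *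
      ‖iteratedFDeriv ℝ (n - i) L x‖)] at hb
    refine (mul_le_mul_of_nonneg_left hb (by positivity)).trans ?_
    rw [Finset.mul_sum]
    refine Finset.sum_le_sum fun i _ => ?_
    have h1 := hCL (n - i) (Nat.sub_le _ _) x
    calc (1 + ‖x‖) ^ k * ((n.choose i : ℝ) * ‖iteratedFDeriv ℝ i f x‖ *
          ‖iteratedFDeriv ℝ (n - i) L x‖)
        ≤ (1 + ‖x‖) ^ k * ((n.choose i : ℝ) * ‖iteratedFDeriv ℝ i f x‖ *
          (C * (1 + ‖x‖) ^ l)) := by gcongr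
      _ = (n.choose i : ℝ) * ((1 + ‖x‖) ^ (k + l) * ‖iteratedFDeriv ℝ i f x‖) * C := by ring
      _ ≤ _ := by gcongr; exact hK i x

/-- A rapidly decreasing function with temperate logarithmic derivative is a Schwartz function. -/
noncomputable def ofLogDeriv {f : E → ℂ} {L : E → E →L[ℝ] ℂ} (hL : L.HasTemperateGrowth)
    (hf : Differentiable ℝ f) (h : ∀ x, fderiv ℝ f x = f x • L x)
    (h0 : ∀ k : ℕ, ∃ C, ∀ x, (1 + ‖x‖) ^ k * ‖f x‖ ≤ C) : 𝓢(E, ℂ) where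
  toFun := f
  smooth' := contDiff_infty.2 (contDiff_of_fderiv_eq_smul hL hf h)
  decay' k n := by
    obtain ⟨C, hC⟩ := decay_of_fderiv_eq_smul hL hf h h0 n k
    refine ⟨C, fun x => le_trans ?_ (hC x)⟩
    gcongr
    linarith

variable {V : Type*} [NormedAddCommGroup V] [InnerProductSpace ℝ V]

/-- The exponent `-‖x‖² / 2 - 2πi⟨x, k⟩` of a modulated Gaussian. -/
noncomputable def gaussExp (k x : V) : ℂ :=
  ((-(‖x‖ ^ 2 / 2) : ℝ) : ℂ) + ((-2 * Real.pi * inner ℝ x k : ℝ) : ℂ) * Complex.I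

/-- The derivative of `gaussExp`. -/
noncomputable def gaussExpDeriv (k x : V) : V →L[ℝ] ℂ :=
  -(Complex.ofRealCLM.comp (innerSL ℝ x)) -
    (2 * Real.pi * Complex.I) • Complex.ofRealCLM.comp (innerSL ℝ k)

theorem hasFDerivAt_gaussExp (k x : V) :
    HasFDerivAt (gaussExp k) (gaussExpDeriv k x) x := by
  have h1 : HasFDerivAt (fun x : V => -(‖x‖ ^ 2 / 2)) (-((1 / 2 : ℝ) • (2 • innerSL ℝ x))) x := by
    have h := ((hasStrictFDerivAt_norm_sq x).hasFDerivAt.mul_const (1 / 2 : ℝ)).neg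
    refine h.congr_of_eventuallyEq (Eventually.of_forall fun y => ?_)
    change -(‖y‖ ^ 2 / 2) = -(‖y‖ ^ 2 * (1 / 2))
    ring
  have h2 : HasFDerivAt (fun x : V => -2 * Real.pi * inner ℝ x k)
      ((-2 * Real.pi) • innerSL ℝ k) x := by
    have h := (innerSL ℝ k).hasFDerivAt (x := x) |>.const_mul (-2 * Real.pi)
    refine h.congr_of_eventuallyEq (Eventually.of_forall fun y => ?_)
    change -2 * Real.pi * inner ℝ y k = -2 * Real.pi * inner ℝ k y
    rw [real_inner_comm]
  have h1' := Complex.ofRealCLM.hasFDerivAt.comp x h1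
  have h2' := (Complex.ofRealCLM.hasFDerivAt.comp x h2).mul_const Complex.I
  refine (h1'.add h2').congr_fderiv ?_
  ext y
  simp [gaussExpDeriv]
  ring

theorem gaussExpDeriv_hasTemperateGrowth (k : V) : (gaussExpDeriv k).HasTemperateGrowth := by
  have h := (((ContinuousLinearMap.compL ℝ V ℝ ℂ) Complex.ofRealCLM).comp
    (innerSL ℝ : V →L[ℝ] V →L[ℝ] ℝ)).hasTemperateGrowth
  exact h.neg.sub (Function.HasTemperateGrowth.const _)

theorem norm_cexp_gaussExp (k x : V) :
    ‖Complex.exp (gaussExp k x)‖ = Real.exp (-(‖x‖ ^ 2 / 2)) := by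
  rw [Complex.norm_exp, gaussExp, Complex.add_re, Complex.ofReal_re, Complex.re_ofReal_mul,
    Complex.I_re, mul_zero, add_zero]

theorem hasFDerivAt_cexp_gaussExp (k x : V) :
    HasFDerivAt (fun x => Complex.exp (gaussExp k x))
      (Complex.exp (gaussExp k x) • gaussExpDeriv k x) x :=
  (hasFDerivAt_gaussExp k x).cexp

theorem decay_cexp_gaussExp (k : V) (j : ℕ) :
    ∃ C, ∀ x, (1 + ‖x‖) ^ j * ‖Complex.exp (gaussExp k x)‖ ≤ C := by
  -- From (1+r)^j ≤ j! e^{1+r} and 1 + r - r²/2 ≤ 3/2, the latter because (r - 1)² ≥ 0.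
  refine ⟨j.factorial * Real.exp (3 / 2), fun x => ?_⟩
  rw [norm_cexp_gaussExp]
  have h := Real.pow_div_factorial_le_exp (1 + ‖x‖) (by positivity) j
  rw [div_le_iff₀ (by positivity)] at h
  calc (1 + ‖x‖) ^ j * Real.exp (-(‖x‖ ^ 2 / 2))
      ≤ (Real.exp (1 + ‖x‖) * j.factorial) * Real.exp (-(‖x‖ ^ 2 / 2)) := by gcongr
    _ = j.factorial * Real.exp (1 + ‖x‖ + -(‖x‖ ^ 2 / 2)) := by rw [Real.exp_add (1 + ‖x‖)]; ring
    _ ≤ _ := by gcongr; nlinarith [sq_nonneg (‖x‖ - 1)]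

/-- The modulated Gaussian `x ↦ exp (-‖x‖² / 2 - 2πi⟨x, k⟩)`. -/
noncomputable def gauss (k : V) : 𝓢(V, ℂ) :=
  ofLogDeriv (gaussExpDeriv_hasTemperateGrowth k)
    (fun x => (hasFDerivAt_cexp_gaussExp k x).differentiableAt)
    (fun x => (hasFDerivAt_cexp_gaussExp k x).fderiv) (decay_cexp_gaussExp k)

theorem gauss_apply (k x : V) : gauss k x = Complex.exp (gaussExp k x) := rfl

theorem fderiv_gauss (k x : V) : fderiv ℝ (gauss k) x = gauss k x • gaussExpDeriv k x :=
  (hasFDerivAt_cexp_gaussExp k x).fderiv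

end Gaussian

end SchwartzMap

noncomputable section

namespace GradedMoyal

open scoped FourierTransform LineDeriv

variable {n : ℕ}

/-! ### The symplectic form -/

theorem thetaInv_eq (n : ℕ) (θ : ℝ) (hθ : θ ≠ 0) (μ ν : Idx n) :
    thetaInv n θ μ ν =
      θ⁻¹ * Matrix.blockDiagonal (fun _ : Fin n => (!![0, 1; -1, 0] : Matrix _ _ ℝ)) μ ν := by
  have h : (Theta n θ)⁻¹ =
      θ⁻¹ • Matrix.blockDiagonal (fun _ : Fin n => (!![0, 1; -1, 0] : Matrix _ _ ℝ)) := by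
    apply Matrix.inv_eq_right_inv
    rw [Theta, smul_mul_smul_comm, mul_inv_cancel₀ hθ, one_smul, ← Matrix.blockDiagonal_mul]
    have h1 : (!![0, -1; 1, 0] : Matrix (Fin 2) (Fin 2) ℝ) * !![0, 1; -1, 0] = 1 := by
      ext i j; fin_cases i <;> fin_cases j <;> simp
    simp only [h1]
    exact Matrix.blockDiagonal_one
  rw [thetaInv, h]
  rfl

/-- The standard complex structure of `ℝ^D`, the linear isometry with matrix `θ Θ⁻¹`. -/
def cplx (n : ℕ) : Space n →ₗ[ℝ] Space n where
  toFun x := WithLp.toLp 2 fun μ => if μ.1 = 0 then x (1, μ.2) else -x (0, μ.2)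
  map_add' x y := by
    ext μ
    by_cases h : μ.1 = 0 <;> simp [h, add_comm]
  map_smul' r x := by
    ext μ
    by_cases h : μ.1 = 0 <;> simp [h]

theorem cplx_apply (x : Space n) (μ : Idx n) :
    cplx n x μ = if μ.1 = 0 then x (1, μ.2) else -x (0, μ.2) := rfl

theorem cplx_cplx (x : Space n) : cplx n (cplx n x) = -x := by
  ext ⟨i, k⟩
  fin_cases i <;> simp [cplx_apply]

theorem inner_cplx (x y : Space n) :
    inner ℝ x (cplx n y) = ∑ k, (x (0, k) * y (1, k) - x (1, k) * y (0, k)) := by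
  rw [PiLp.inner_apply, Fintype.sum_prod_type_right]
  refine Finset.sum_congr rfl fun k _ => ?_
  simp [cplx_apply]
  ring

theorem inner_cplx_left (x y : Space n) : inner ℝ (cplx n x) y = -inner ℝ x (cplx n y) := by
  rw [real_inner_comm, inner_cplx, inner_cplx, ← Finset.sum_neg_distrib]
  exact Finset.sum_congr rfl fun k _ => by ring

theorem norm_cplx (x : Space n) : ‖cplx n x‖ = ‖x‖ := by
  rw [← sq_eq_sq₀ (norm_nonneg _) (norm_nonneg _), ← real_inner_self_eq_norm_sq,
    ← real_inner_self_eq_norm_sq, inner_cplx_left, cplx_cplx, inner_neg_right, neg_neg]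

/-- `cplx` as a linear isometric equivalence. -/
def cplxEquiv (n : ℕ) : Space n ≃ₗᵢ[ℝ] Space n :=
  LinearIsometry.toLinearIsometryEquiv ⟨cplx n, norm_cplx⟩ rfl

theorem sum_thetaInv_mul {θ : ℝ} (hθ : θ ≠ 0) (x : Space n) (μ : Idx n) :
    ∑ ν, thetaInv n θ μ ν * x ν = θ⁻¹ * cplx n x μ := by
  obtain ⟨i, k⟩ := μ
  simp only [thetaInv_eq n θ hθ, mul_assoc, ← Finset.mul_sum, Matrix.blockDiagonal_apply]
  congr 1
  rw [Fintype.sum_prod_type_right, Finset.sum_eq_single k]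
  · fin_cases i <;> simp [cplx_apply]
  · intro l _ hl
    simp [hl.symm]
  · simp

theorem twist_eq {θ : ℝ} (hθ : θ ≠ 0) (y z : Space n) :
    twist θ y z = θ⁻¹ * inner ℝ y (cplx n z) := by
  simp only [twist, mul_assoc, ← Finset.mul_sum, sum_thetaInv_mul hθ]
  rw [PiLp.inner_apply, Finset.mul_sum]
  refine Finset.sum_congr rfl fun μ _ => ?_
  simp
  ring

theorem xi_eq {θ : ℝ} (hθ : θ ≠ 0) (μ : Idx n) (x : Space n) :
    xi θ μ x = -(θ⁻¹ * cplx n x μ) := by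
  rw [xi, sum_thetaInv_mul hθ]

theorem thetaInv_neg {θ : ℝ} (hθ : θ ≠ 0) (μ ν : Idx n) :
    thetaInv n θ ν μ = -thetaInv n θ μ ν := by
  obtain ⟨i, k⟩ := μ
  obtain ⟨j, l⟩ := ν
  simp only [thetaInv_eq n θ hθ, Matrix.blockDiagonal_apply, eq_comm (a := l)]
  by_cases h : k = l
  · fin_cases i <;> fin_cases j <;> simp [h]
  · simp [h]

theorem finrank_space (n : ℕ) : Module.finrank ℝ (Space n) = 2 * n := by
  simp

/-! ### The phase -/

/-- The phase `exp (2i yΘ⁻¹z)`. -/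
def phase (θ : ℝ) (y z : Space n) : ℂ := Complex.exp (2 * Complex.I * (twist θ y z : ℂ))

variable {θ : ℝ}

theorem twist_add_left (θ : ℝ) (y y' z : Space n) :
    twist θ (y + y') z = twist θ y z + twist θ y' z := by
  simp [twist, add_mul, Finset.sum_add_distrib]

theorem twist_add_right (θ : ℝ) (y z z' : Space n) :
    twist θ y (z + z') = twist θ y z + twist θ y z' := by
  simp [twist, mul_add, Finset.sum_add_distrib]

theorem twist_neg_left (θ : ℝ) (y z : Space n) : twist θ (-y) z = -twist θ y z := by
  simp [twist]

theorem twist_neg_right (θ : ℝ) (y z : Space n) : twist θ y (-z) = -twist θ y z := by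
  simp [twist]

theorem twist_swap (hθ : θ ≠ 0) (y z : Space n) : twist θ z y = -twist θ y z := by
  rw [twist_eq hθ, twist_eq hθ, real_inner_comm, inner_cplx_left]
  ring

theorem twist_self (hθ : θ ≠ 0) (y : Space n) : twist θ y y = 0 := by
  linarith [twist_swap hθ y y]

theorem norm_phase (θ : ℝ) (y z : Space n) : ‖phase θ y z‖ = 1 := by
  rw [phase, show (2 * Complex.I * (twist θ y z : ℂ)) = ((2 * twist θ y z : ℝ) : ℂ) * Complex.I by
    push_cast; ring]
  exact Complex.norm_exp_ofReal_mul_I _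

theorem phase_add_left (θ : ℝ) (y y' z : Space n) :
    phase θ (y + y') z = phase θ y z * phase θ y' z := by
  rw [phase, phase, phase, ← Complex.exp_add, twist_add_left]
  push_cast
  ring_nf

theorem phase_add_right (θ : ℝ) (y z z' : Space n) :
    phase θ y (z + z') = phase θ y z * phase θ y z' := by
  rw [phase, phase, phase, ← Complex.exp_add, twist_add_right]
  push_cast
  ring_nf

theorem phase_neg_right (θ : ℝ) (y z : Space n) : phase θ y (-z) = phase θ (-y) z := by
  rw [phase, phase, twist_neg_left, twist_neg_right]

theorem phase_swap (hθ : θ ≠ 0) (y z : Space n) : phase θ z y = phase θ (-y) z := by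
  rw [phase, phase, twist_neg_left, twist_swap hθ]

theorem phase_self (hθ : θ ≠ 0) (y : Space n) : phase θ y y = 1 := by
  simp [phase, twist_self hθ]

theorem exp_neg_twist (θ : ℝ) (y z : Space n) :
    Complex.exp (-(2 * Complex.I * (twist θ y z : ℂ))) = phase θ (-y) z := by
  rw [phase, twist_neg_left]
  push_cast
  ring_nf

theorem conj_phase (θ : ℝ) (y z : Space n) :
    (starRingEnd ℂ) (phase θ y z) = phase θ (-y) z := by
  rw [phase, phase, twist_neg_left, ← Complex.exp_conj]
  simp [Complex.conj_ofNat]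

theorem twist_hasTemperateGrowth (θ : ℝ) :
    (fun p : Space n × Space n => twist θ p.2 p.1).HasTemperateGrowth := by
  simp only [twist]
  have h1 : ∀ μ : Idx n, (fun p : Space n × Space n => p.1 μ).HasTemperateGrowth := fun μ =>
    ((EuclideanSpace.proj μ : Space n →L[ℝ] ℝ) ∘L
      ContinuousLinearMap.fst ℝ (Space n) (Space n)).hasTemperateGrowth
  have h2 : ∀ μ : Idx n, (fun p : Space n × Space n => p.2 μ).HasTemperateGrowth := fun μ =>
    ((EuclideanSpace.proj μ : Space n →L[ℝ] ℝ) ∘L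
      ContinuousLinearMap.snd ℝ (Space n) (Space n)).hasTemperateGrowth
  exact Function.HasTemperateGrowth.sum fun μ _ => Function.HasTemperateGrowth.sum fun ν _ =>
    ((h2 μ).mul (Function.HasTemperateGrowth.const _)).mul (h1 ν)

theorem phase_hasTemperateGrowth (θ : ℝ) :
    (fun p : Space n × Space n => phase θ p.2 p.1).HasTemperateGrowth := by
  have h := SchwartzMap.hasTemperateGrowth_phase
    ((Function.HasTemperateGrowth.const (2 : ℝ)).mul (twist_hasTemperateGrowth (n := n) θ))
  convert h using 2 with p
  rw [phase, Pi.mul_apply]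
  push_cast
  ring_nf

theorem continuous_phase (θ : ℝ) : Continuous fun p : Space n × Space n => phase θ p.1 p.2 := by
  unfold phase twist
  fun_prop

/-! ### The symplectic Fourier transform -/

/-- The linear automorphism `y ↦ -(πθ)⁻¹ cplx y` relating the symplectic and the ordinary Fourier
transforms. -/
def freq (n : ℕ) (hθ : θ ≠ 0) : Space n ≃L[ℝ] Space n :=
  (cplxEquiv n).toContinuousLinearEquiv.trans
    (ContinuousLinearEquiv.smulLeft (Units.mk0 (-(Real.pi * θ)⁻¹)
      (neg_ne_zero.2 (inv_ne_zero (mul_ne_zero Real.pi_ne_zero hθ)))))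

theorem freq_apply (hθ : θ ≠ 0) (y : Space n) :
    freq n hθ y = (-(Real.pi * θ)⁻¹) • cplx n y := rfl

/-- This fixes the scalar in `freq`: the ordinary Fourier transform read at `freq y` carries the
phase of the Moyal product. -/
theorem two_pi_inner_freq (hθ : θ ≠ 0) (y z : Space n) :
    2 * Real.pi * inner ℝ z (freq n hθ y) = 2 * twist θ y z := by
  have h := inner_cplx_left y z
  rw [freq_apply, inner_smul_right, twist_eq hθ, real_inner_comm, h]
  field_simp [Real.pi_ne_zero, hθ]

/-- The normalising constant of the Moyal product. -/
def normConst (n : ℕ) (θ : ℝ) : ℂ := (((Real.pi * θ) ^ (2 * n) : ℝ) : ℂ)⁻¹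

/-- The symplectic Fourier transform. -/
def sft (hθ : θ ≠ 0) (a : 𝓢(Space n, ℂ)) : 𝓢(Space n, ℂ) :=
  normConst n θ • SchwartzMap.compCLMOfContinuousLinearEquiv ℂ (freq n hθ) (𝓕 a)

theorem sft_eq_fourier (hθ : θ ≠ 0) (a : 𝓢(Space n, ℂ)) (y : Space n) :
    sft hθ a y = normConst n θ * 𝓕 a (freq n hθ y) := rfl

theorem sft_apply (hθ : θ ≠ 0) (a : 𝓢(Space n, ℂ)) (y : Space n) :
    sft hθ a y = normConst n θ * ∫ z, a z * phase θ (-y) z := by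
  rw [sft_eq_fourier, SchwartzMap.fourier_coe, Real.fourier_eq']
  congr 1
  refine integral_congr_ae (Eventually.of_forall fun z => ?_)
  have h : -2 * Real.pi * inner ℝ z (freq n hθ y) = 2 * twist θ (-y) z := by
    rw [twist_neg_left]
    linarith [two_pi_inner_freq hθ y z]
  simp only [h, smul_eq_mul, phase]
  push_cast
  ring_nf

theorem sft_add (hθ : θ ≠ 0) (a b : 𝓢(Space n, ℂ)) : sft hθ (a + b) = sft hθ a + sft hθ b := by
  simp [sft, FourierTransform.fourier_add]

theorem sft_smul (hθ : θ ≠ 0) (c : ℂ) (a : 𝓢(Space n, ℂ)) : sft hθ (c • a) = c • sft hθ a := by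
  simp [sft, FourierTransform.fourier_smul, smul_comm c]

/-- `cplx` is an isometry, so the Jacobian of `freq` is |πθ|^{-D}. Since D is even the absolute
value can be dropped, and `normConst` is exactly this Jacobian. -/
theorem integral_comp_freq (hθ : θ ≠ 0) (f : Space n → ℂ) :
    normConst n θ * ∫ u, f (freq n hθ u) = ∫ u, f u := by
  have h1 := (cplxEquiv n).measurePreserving.integral_comp'
    (f := (cplxEquiv n).toHomeomorph.toMeasurableEquiv)
    (fun y => f ((-(Real.pi * θ)⁻¹) • y))
  have h2 := Measure.integral_comp_smul (volume : Measure (Space n)) f (-(Real.pi * θ)⁻¹)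
  rw [h2, finrank_space] at h1
  change ∫ u, f (freq n hθ u) = _ at h1
  have hpi : (Real.pi * θ) ^ (2 * n) ≠ 0 := pow_ne_zero _ (mul_ne_zero Real.pi_ne_zero hθ)
  rw [h1, Even.neg_pow ⟨n, two_mul n⟩, inv_pow, inv_inv,
    abs_of_nonneg (Even.pow_nonneg ⟨n, two_mul n⟩ _), normConst, Complex.real_smul, ← mul_assoc,
    inv_mul_cancel₀ (by exact_mod_cast hpi), one_mul]

/-- Fourier inversion after the substitution by `freq`; the Jacobian absorbs the normalising
constant. -/
theorem integral_sft_mul_phase (hθ : θ ≠ 0) (a : 𝓢(Space n, ℂ)) (x : Space n) :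
    ∫ u, sft hθ a u * phase θ u x = a x := by
  have h := integral_comp_freq hθ
    (fun w => Complex.exp (↑(2 * Real.pi * inner ℝ w x) * Complex.I) • 𝓕 a w)
  have h2 : ∫ w, Complex.exp (↑(2 * Real.pi * inner ℝ w x) * Complex.I) • 𝓕 a w = a x := by
    rw [← Real.fourierInv_eq', ← SchwartzMap.fourierInv_coe, FourierTransform.fourierInv_fourier_eq]
  rw [h2, ← integral_const_mul] at h
  rw [← h]
  refine integral_congr_ae (Eventually.of_forall fun u => ?_)
  simp only [sft_eq_fourier, smul_eq_mul, phase]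
  rw [real_inner_comm, two_pi_inner_freq]
  push_cast
  ring_nf

/-! ### The Moyal product of Schwartz functions -/

/-- The shear `(x, y) ↦ (x + y, y)`. -/
def shear (n : ℕ) : (Space n × Space n) ≃L[ℝ] (Space n × Space n) :=
  LinearEquiv.toContinuousLinearEquiv
    { toFun := fun p => (p.1 + p.2, p.2)
      map_add' := fun p q => by ext1 <;> simp; abel
      map_smul' := fun c p => by ext1 <;> simp
      invFun := fun p => (p.1 - p.2, p.2)
      left_inv := fun p => by simp
      right_inv := fun p => by simp }

theorem shear_apply (p : Space n × Space n) : shear n p = (p.1 + p.2, p.2) := rfl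

/-- The integrand `(x, y) ↦ a (x + y) b~(y) exp (2i yΘ⁻¹x)` of the Moyal product. -/
def starIntegrand (hθ : θ ≠ 0) (a b : 𝓢(Space n, ℂ)) : 𝓢(Space n × Space n, ℂ) :=
  SchwartzMap.smulLeftCLM ℂ (fun p : Space n × Space n => phase θ p.2 p.1)
    (SchwartzMap.compCLMOfContinuousLinearEquiv ℂ (shear n) (SchwartzMap.tensor a (sft hθ b)))

theorem starIntegrand_apply (hθ : θ ≠ 0) (a b : 𝓢(Space n, ℂ)) (x y : Space n) :
    starIntegrand hθ a b (x, y) = a (x + y) * sft hθ b y * phase θ y x := by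
  rw [starIntegrand, SchwartzMap.smulLeftCLM_apply_apply (phase_hasTemperateGrowth θ)]
  simp [shear_apply, mul_comm]

/-- The Moyal product of two Schwartz functions. -/
def star (hθ : θ ≠ 0) (a b : 𝓢(Space n, ℂ)) : 𝓢(Space n, ℂ) :=
  SchwartzMap.partialIntegral volume (starIntegrand hθ a b)

theorem star_apply (hθ : θ ≠ 0) (a b : 𝓢(Space n, ℂ)) (x : Space n) :
    star hθ a b x = ∫ y, a (x + y) * sft hθ b y * phase θ y x := by
  simp only [star, SchwartzMap.partialIntegral_apply, starIntegrand_apply]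

theorem integrable_starIntegrand (hθ : θ ≠ 0) (a b : 𝓢(Space n, ℂ)) (x : Space n) :
    Integrable fun y => a (x + y) * sft hθ b y * phase θ y x := by
  simpa only [starIntegrand_apply] using
    SchwartzMap.integrable_slice volume (starIntegrand hθ a b) x

theorem integral_translate_phase (b : 𝓢(Space n, ℂ)) (x y : Space n) :
    ∫ z, b (x + z) * phase θ y z = phase θ (-y) x * ∫ z, b z * phase θ y z := by
  rw [← integral_add_left_eq_self (fun z => b z * phase θ y z) x, ← integral_const_mul]
  refine integral_congr_ae (Eventually.of_forall fun z => ?_)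
  simp only [phase_add_right]
  have h : phase θ (-y) x * phase θ y x = 1 := by
    rw [← phase_add_left, neg_add_cancel, phase, twist]
    simp
  linear_combination (-(b (x + z) * phase θ y z)) * h

/-- The inner integral over z, translated by x, is the symplectic transform of b at y times a phase
in x. -/
theorem starFun_eq_star (hθ : θ ≠ 0) (a b : 𝓢(Space n, ℂ)) (x : Space n) :
    starFun θ a b x = star hθ a b x := by
  rw [star_apply, starFun, ← integral_const_mul]
  refine integral_congr_ae (Eventually.of_forall fun y => ?_)
  simp only [exp_neg_twist]
  simp only [mul_assoc, integral_const_mul]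
  rw [integral_translate_phase, neg_neg, sft_apply, normConst]
  ring

/-- The integrand of the double integral defining the Moyal product is integrable. -/
theorem integrable_starFun (a b : 𝓢(Space n, ℂ)) (x : Space n) :
    Integrable (Function.uncurry fun y z => a (x + y) * b (x + z) *
      Complex.exp (-(2 * Complex.I * (twist θ y z : ℂ)))) (volume.prod volume) := by
  refine Integrable.mul_bdd (c := 1)
    ((a.integrable.comp_add_left x).mul_prod (b.integrable.comp_add_left x)) ?_
    (Eventually.of_forall fun p => ?_)
  · simp only [exp_neg_twist]
    exact ((continuous_phase θ).comp (by fun_prop :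
      Continuous fun p : Space n × Space n => (-p.1, p.2))).aestronglyMeasurable
  · rw [exp_neg_twist, norm_phase]

/-- Fubini in the other order transforms a instead of b. Having both forms is what makes
associativity a direct comparison. -/
theorem star_apply_left (hθ : θ ≠ 0) (a b : 𝓢(Space n, ℂ)) (x : Space n) :
    star hθ a b x = ∫ u, sft hθ a u * b (x - u) * phase θ u x := by
  rw [← starFun_eq_star, starFun, integral_integral_swap (integrable_starFun a b x),
    ← integral_const_mul, ← integral_neg_eq_self]
  refine integral_congr_ae (Eventually.of_forall fun u => ?_)
  have h : ∀ y : Space n, a (x + y) * b (x + -u) *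
      Complex.exp (-(2 * Complex.I * (twist θ y (-u) : ℂ))) =
      b (x - u) * (a (x + y) * phase θ (-u) y) := fun y => by
    rw [exp_neg_twist, phase_neg_right, neg_neg, phase_swap hθ, sub_eq_add_neg]
    ring
  simp only [h, integral_const_mul]
  rw [integral_translate_phase, neg_neg, sft_apply, normConst]
  ring

theorem star_add_left (hθ : θ ≠ 0) (a a' b : 𝓢(Space n, ℂ)) :
    star hθ (a + a') b = star hθ a b + star hθ a' b := by
  ext x
  rw [add_apply, star_apply, star_apply, star_apply,
    ← integral_add (integrable_starIntegrand hθ a b x) (integrable_starIntegrand hθ a' b x)]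
  simp [add_mul]

theorem star_add_right (hθ : θ ≠ 0) (a b b' : 𝓢(Space n, ℂ)) :
    star hθ a (b + b') = star hθ a b + star hθ a b' := by
  ext x
  rw [add_apply, star_apply, star_apply, star_apply,
    ← integral_add (integrable_starIntegrand hθ a b x) (integrable_starIntegrand hθ a b' x)]
  simp [add_mul, mul_add, sft_add]

theorem star_smul_left (hθ : θ ≠ 0) (c : ℂ) (a b : 𝓢(Space n, ℂ)) :
    star hθ (c • a) b = c • star hθ a b := by
  ext x
  rw [smul_apply, star_apply, star_apply, smul_eq_mul, ← integral_const_mul]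
  simp [mul_assoc]

theorem star_smul_right (hθ : θ ≠ 0) (c : ℂ) (a b : 𝓢(Space n, ℂ)) :
    star hθ a (c • b) = c • star hθ a b := by
  ext x
  rw [smul_apply, star_apply, star_apply, smul_eq_mul, ← integral_const_mul]
  simp [sft_smul, mul_assoc, mul_left_comm]

theorem exists_isStar (hθ : θ ≠ 0) :
    ∃ B : 𝓢(Space n, ℂ) →ₗ[ℂ] 𝓢(Space n, ℂ) →ₗ[ℂ] 𝓢(Space n, ℂ), IsStar θ B :=
  ⟨LinearMap.mk₂ ℂ (star hθ) (star_add_left hθ) (star_smul_left hθ) (star_add_right hθ)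
    (star_smul_right hθ), fun a b x => (starFun_eq_star hθ a b x).symm⟩

theorem isStar_starS (hθ : θ ≠ 0) : IsStar (n := n) θ (starS θ) := by
  rw [starS, dif_pos (exists_isStar hθ)]
  exact (exists_isStar hθ).choose_spec

theorem starS_eq_star (hθ : θ ≠ 0) (a b : 𝓢(Space n, ℂ)) : starS θ a b = star hθ a b := by
  ext x
  rw [isStar_starS hθ, starFun_eq_star hθ]

theorem integrable_mul_prod (f g : 𝓢(Space n, ℂ)) {h : Space n × Space n → ℂ} (hh : Continuous h)
    {C : ℝ} (hC : ∀ p, ‖h p‖ ≤ C) :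
    Integrable (fun p : Space n × Space n => f p.1 * g p.2 * h p) (volume.prod volume) :=
  (f.integrable.mul_prod g.integrable).mul_bdd hh.aestronglyMeasurable (Eventually.of_forall hC)

/-- Transforming the two outer factors and leaving b in the middle turns both sides into the same
double integral over u and v, up to order. Fubini applies because the transforms are integrable, b
is bounded and the phases have modulus one. -/
theorem star_assoc (hθ : θ ≠ 0) (a b d : 𝓢(Space n, ℂ)) :
    star hθ (star hθ a b) d = star hθ a (star hθ b d) := by
  ext x
  rw [star_apply, star_apply_left]
  simp only [star_apply_left hθ a b, star_apply hθ b d, ← integral_mul_const, ← integral_const_mul]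
  rw [integral_integral_swap]
  · refine integral_congr_ae (Eventually.of_forall fun u =>
      integral_congr_ae (Eventually.of_forall fun v => ?_))
    simp only [phase_add_right, sub_eq_add_neg, phase_neg_right]
    have h1 : phase θ u v = phase θ (-v) u := phase_swap hθ v u
    rw [h1, add_right_comm]
    ring
  · have h1 : Continuous fun p : Space n × Space n => b (x + p.1 - p.2) := by fun_prop
    have h2 := (continuous_phase (n := n) θ).comp (by fun_prop :
      Continuous fun p : Space n × Space n => (p.2, x + p.1))
    have h3 := (continuous_phase (n := n) θ).comp (by fun_prop :
      Continuous fun p : Space n × Space n => (p.1, x))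
    refine (integrable_mul_prod (sft hθ d) (sft hθ a) ((h1.mul h2).mul h3)
      (C := SchwartzMap.seminorm ℝ 0 0 b) fun p => ?_).congr (Eventually.of_forall fun p => ?_)
    · simp only [Function.comp_apply, Pi.mul_apply, norm_mul, norm_phase, mul_one]
      exact b.norm_le_seminorm ℝ _
    · simp only [Function.uncurry, Function.comp_apply, Pi.mul_apply]
      ring

/-- After Fubini, translating x by y costs no phase because the twist vanishes on the diagonal; the
integral over y is then Fourier inversion and returns b. -/
theorem integral_star (hθ : θ ≠ 0) (a b : 𝓢(Space n, ℂ)) :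
    ∫ x, star hθ a b x = ∫ x, a x * b x := by
  have hi : Integrable (Function.uncurry fun x y => a (x + y) * sft hθ b y * phase θ y x)
      (volume.prod volume) := by
    refine (SchwartzMap.integrable_prod (starIntegrand hθ a b)).congr
      (Eventually.of_forall fun p => starIntegrand_apply hθ a b p.1 p.2)
  simp only [star_apply]
  rw [integral_integral_swap hi]
  have h1 : ∀ y : Space n, ∫ x, a (x + y) * sft hθ b y * phase θ y x =
      ∫ w, a w * (sft hθ b y * phase θ y w) := fun y => by
    rw [← integral_add_right_eq_self (fun w => a w * (sft hθ b y * phase θ y w)) y]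
    refine integral_congr_ae (Eventually.of_forall fun x => ?_)
    simp only [phase_add_right, phase_self hθ]
    ring
  simp only [h1]
  rw [integral_integral_swap]
  · refine integral_congr_ae (Eventually.of_forall fun w => ?_)
    simp only [integral_const_mul, integral_sft_mul_phase]
  · refine (integrable_mul_prod (sft hθ b) a (continuous_phase θ) (C := 1)
      fun p => (norm_phase θ p.1 p.2).le).congr (Eventually.of_forall fun p => ?_)
    simp only [Function.uncurry]
    ring

theorem conjS_apply (a : 𝓢(Space n, ℂ)) (x : Space n) :
    conjS a x = (starRingEnd ℂ) (a x) := rfl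

/-- Conjugation changes the sign of the exponent, and by antisymmetry of Θ⁻¹ so does exchanging y
and z. -/
theorem conjS_star (hθ : θ ≠ 0) (a b : 𝓢(Space n, ℂ)) :
    conjS (star hθ a b) = star hθ (conjS b) (conjS a) := by
  ext x
  rw [conjS_apply, ← starFun_eq_star, ← starFun_eq_star, starFun, starFun,
    integral_integral_swap (integrable_starFun (conjS b) (conjS a) x), map_mul, ← integral_conj]
  simp only [← integral_conj]
  congr 1
  · simp
  · refine integral_congr_ae (Eventually.of_forall fun y =>
      integral_congr_ae (Eventually.of_forall fun z => ?_))
    simp only [exp_neg_twist, map_mul, conj_phase, conjS_apply, neg_neg]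
    rw [phase_swap hθ y, phase_neg_right, neg_neg]
    ring

/-! ### Multiplication by linear functions and derivatives -/

/-- Multiplication by `ξ_μ`. -/
def mulXi (θ : ℝ) (μ : Idx n) : 𝓢(Space n, ℂ) →L[ℂ] 𝓢(Space n, ℂ) :=
  SchwartzMap.smulLeftCLM ℂ fun x => (xi θ μ x : ℂ)

theorem mulXi_apply (θ : ℝ) (μ : Idx n) (a : 𝓢(Space n, ℂ)) (x : Space n) :
    mulXi θ μ a x = xi θ μ x * a x := by
  rw [mulXi, SchwartzMap.smulLeftCLM_apply_apply (xi_hasTemperateGrowth θ μ), smul_eq_mul]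

/-- The partial derivative `∂_μ`. -/
def partialDeriv (μ : Idx n) : 𝓢(Space n, ℂ) →L[ℂ] 𝓢(Space n, ℂ) :=
  LineDeriv.lineDerivOpCLM ℂ 𝓢(Space n, ℂ) (EuclideanSpace.single μ (1 : ℝ))

theorem partialDeriv_apply (μ : Idx n) (a : 𝓢(Space n, ℂ)) (x : Space n) :
    partialDeriv μ a x = fderiv ℝ a x (EuclideanSpace.single μ (1 : ℝ)) := rfl

theorem sft_partialDeriv (hθ : θ ≠ 0) (μ : Idx n) (a : 𝓢(Space n, ℂ)) :
    sft hθ (partialDeriv μ a) = (2 * Complex.I) • mulXi θ μ (sft hθ a) := by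
  ext y
  have h := SchwartzMap.fourier_lineDerivOp_eq a (EuclideanSpace.single μ (1 : ℝ))
  rw [smul_apply, mulXi_apply, sft_eq_fourier, sft_eq_fourier]
  have h' : 𝓕 (partialDeriv μ a) = _ := h
  rw [h', smul_apply, SchwartzMap.smulLeftCLM_apply_apply (by fun_prop), freq_apply,
    xi_eq hθ]
  simp [EuclideanSpace.inner_single_right]
  field_simp [Real.pi_ne_zero, hθ]

/-- Under the integral, ξ_μ(x) = ξ_μ(x+y) - ξ_μ(y). The first term multiplies a; the second
multiplies the transform of b, which amounts to differentiating b. -/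
theorem mulXi_star (hθ : θ ≠ 0) (μ : Idx n) (a b : 𝓢(Space n, ℂ)) :
    mulXi θ μ (star hθ a b) =
      star hθ (mulXi θ μ a) b + (Complex.I / 2) • star hθ a (partialDeriv μ b) := by
  ext x
  rw [← star_smul_right, add_apply, mulXi_apply, star_apply, star_apply, star_apply,
    ← integral_add (integrable_starIntegrand hθ _ b x) (integrable_starIntegrand hθ a _ x),
    ← integral_const_mul]
  refine integral_congr_ae (Eventually.of_forall fun y => ?_)
  have h : xi θ μ (x + y) = xi θ μ x + xi θ μ y := by
    simp [xi_eq hθ]; ring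
  simp only [sft_smul, sft_partialDeriv, smul_apply, mulXi_apply, smul_eq_mul, h]
  push_cast
  linear_combination (-a (x + y) * sft hθ b y * phase θ y x * xi θ μ y) * Complex.I_mul_I

end GradedMoyal

namespace SchwartzMap

/-! ### Averages of slices over shrinking balls -/

section SliceLimit

variable {V : Type} [NormedAddCommGroup V] [InnerProductSpace ℝ V]

/-- Multiplication of a function on a product by a function of the second factor. -/
def mulSnd {W : Type} [NormedAddCommGroup W] [NormedSpace ℝ W] (s : V → ℝ)
    (G : 𝓢(V × V, W)) : 𝓢(V × V, W) :=
  smulLeftCLM W (fun p : V × V => s p.2) G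

theorem mulSnd_apply {W : Type} [NormedAddCommGroup W] [NormedSpace ℝ W] {s : V → ℝ}
    (hs : s.HasTemperateGrowth) (G : 𝓢(V × V, W)) (x v : V) :
    mulSnd s G (x, v) = s v • G (x, v) := by
  have h : (fun p : V × V => s p.2).HasTemperateGrowth :=
    hs.comp (ContinuousLinearMap.snd ℝ V V).hasTemperateGrowth
  rw [mulSnd, smulLeftCLM_apply_apply h]

theorem norm_slice_sub_le {W : Type} [NormedAddCommGroup W] [NormedSpace ℝ W]
    (G : 𝓢(V × V, W)) (k : ℕ) (x v : V) :
    ‖x‖ ^ k * ‖G (x, v) - G (x, 0)‖ ≤ SchwartzMap.seminorm ℝ k 1 G * ‖v‖ := by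
  have hd : ∀ w, HasFDerivAt (fun w => ‖x‖ ^ k • G (x, w))
      (‖x‖ ^ k • (fderiv ℝ G (x, w)).comp (ContinuousLinearMap.inr ℝ V V)) w := fun w =>
    (HasFDerivAt.comp (g := G) w (G.hasFDerivAt (x, w)) (hasFDerivAt_prodMk_right x w)).const_smul _
  have hb : ∀ w, ‖‖x‖ ^ k • (fderiv ℝ G (x, w)).comp (ContinuousLinearMap.inr ℝ V V)‖ ≤
      SchwartzMap.seminorm ℝ k 1 G := fun w => by
    rw [norm_smul, norm_pow, norm_norm]
    have h1 : ‖(fderiv ℝ G (x, w)).comp (ContinuousLinearMap.inr ℝ V V)‖ ≤ ‖fderiv ℝ G (x, w)‖ :=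
      (ContinuousLinearMap.opNorm_comp_le _ _).trans (mul_le_of_le_one_right (norm_nonneg _)
        (ContinuousLinearMap.norm_inr_le_one ℝ V V))
    have h2 : ‖x‖ ≤ ‖(x, w)‖ := norm_fst_le (x, w)
    have h3 := G.le_seminorm ℝ k 1 (x, w)
    rw [← norm_iteratedFDeriv_fderiv, norm_iteratedFDeriv_zero] at h3
    refine le_trans ?_ h3
    gcongr
  have h := convex_univ.norm_image_sub_le_of_norm_hasFDerivWithin_le (x := (0 : V)) (y := v)
    (fun w _ => (hd w).hasFDerivWithinAt) (fun w _ => hb w) trivial trivial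
  rwa [← smul_sub, norm_smul, norm_pow, norm_norm, sub_zero] at h

/-- A bump function supported in the ball of radius `1 / (j + 1)`. -/
def bump (V : Type) [NormedAddCommGroup V] [InnerProductSpace ℝ V] (j : ℕ) :
    ContDiffBump (0 : V) :=
  ⟨1 / (2 * ((j : ℝ) + 1)), 1 / ((j : ℝ) + 1), by positivity, by
    apply one_div_lt_one_div_of_lt <;> linarith [(Nat.cast_nonneg j : (0 : ℝ) ≤ j)]⟩

theorem fderivFst_mulSnd {W : Type} [NormedAddCommGroup W] [NormedSpace ℝ W] {s : V → ℝ}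
    (hs : s.HasTemperateGrowth) (G : 𝓢(V × V, W)) :
    fderivFst (mulSnd s G) = mulSnd s (fderivFst G) := by
  ext1 p
  obtain ⟨x, v⟩ := p
  have h1 := hasFDerivAt_slice (mulSnd s G) x v
  have h2 := (hasFDerivAt_slice G x v).const_smul (s v)
  simp only [mulSnd_apply hs] at h1 ⊢
  exact h1.unique h2

variable [FiniteDimensional ℝ V] [MeasurableSpace V] [BorelSpace V]

theorem bump_hasTemperateGrowth (j : ℕ) :
    ((bump V j).normed volume).HasTemperateGrowth :=
  (bump V j).hasCompactSupport_normed.hasTemperateGrowth (bump V j).contDiff_normed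

theorem bump_smul_le (j : ℕ) (v : V) :
    (bump V j).normed volume v * ‖v‖ ≤ (bump V j).normed volume v * (1 / ((j : ℝ) + 1)) := by
  by_cases hv : (bump V j).normed volume v = 0
  · simp [hv]
  · have h : v ∈ Metric.ball (0 : V) (bump V j).rOut := by
      rw [← (bump V j).support_normed_eq (μ := volume)]
      exact hv
    rw [mem_ball_zero_iff] at h
    exact mul_le_mul_of_nonneg_left h.le ((bump V j).nonneg_normed v)

/-- The average of `G (x, v) - G (x, 0)` over small `v`. -/
def averageError {W : Type} [NormedAddCommGroup W] [NormedSpace ℝ W] (G : 𝓢(V × V, W)) (j : ℕ)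
    (x : V) : W :=
  ∫ v, (bump V j).normed volume v • (G (x, v) - G (x, 0))

theorem integrable_bump (j : ℕ) : Integrable ((bump V j).normed (volume : Measure V)) :=
  (bump V j).integrable_normed

theorem averageError_eq {W : Type} [NormedAddCommGroup W] [NormedSpace ℝ W] [CompleteSpace W]
    (G : 𝓢(V × V, W)) (j : ℕ) :
    averageError G j =
      fun x => (∫ v, mulSnd ((bump V j).normed volume) G (x, v)) - G (x, 0) := by
  funext x
  have h1 : ∫ v, (bump V j).normed volume v • G (x, 0) = G (x, 0) := by
    rw [integral_smul_const, (bump V j).integral_normed, one_smul]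
  have h2 := integrable_slice volume (mulSnd ((bump V j).normed volume) G) x
  simp only [mulSnd_apply (bump_hasTemperateGrowth j)] at h2 ⊢
  calc averageError G j x
      = ∫ v, ((bump V j).normed volume v • G (x, v) - (bump V j).normed volume v • G (x, 0)) := by
        simp only [averageError, smul_sub]
    _ = _ := by rw [integral_sub h2 ((integrable_bump j).smul_const _), h1]

theorem hasFDerivAt_averageError {W : Type} [NormedAddCommGroup W] [NormedSpace ℝ W]
    [CompleteSpace W] (G : 𝓢(V × V, W)) (j : ℕ) (x : V) :
    HasFDerivAt (averageError G j) (averageError (fderivFst G) j x) x := by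
  rw [averageError_eq, averageError_eq, ← fderivFst_mulSnd (bump_hasTemperateGrowth j)]
  exact (hasFDerivAt_integral_slice volume _ x).sub (hasFDerivAt_slice G x 0)

theorem norm_averageError_le {W : Type} [NormedAddCommGroup W] [NormedSpace ℝ W]
    (G : 𝓢(V × V, W)) (k j : ℕ) (x : V) :
    ‖x‖ ^ k * ‖averageError G j x‖ ≤ SchwartzMap.seminorm ℝ k 1 G * (1 / ((j : ℝ) + 1)) := by
  have hb : ∀ v, ‖‖x‖ ^ k • ((bump V j).normed volume v • (G (x, v) - G (x, 0)))‖ ≤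
      (bump V j).normed volume v * (SchwartzMap.seminorm ℝ k 1 G * (1 / ((j : ℝ) + 1))) := by
    intro v
    have h0 := (bump V j).nonneg_normed (μ := volume) v
    rw [norm_smul, norm_smul, norm_pow, norm_norm, Real.norm_of_nonneg h0]
    calc ‖x‖ ^ k * ((bump V j).normed volume v * ‖G (x, v) - G (x, 0)‖)
        = (bump V j).normed volume v * (‖x‖ ^ k * ‖G (x, v) - G (x, 0)‖) := by ring
      _ ≤ (bump V j).normed volume v * (SchwartzMap.seminorm ℝ k 1 G * ‖v‖) := by
          exact mul_le_mul_of_nonneg_left (norm_slice_sub_le G k x v) h0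
      _ = SchwartzMap.seminorm ℝ k 1 G * ((bump V j).normed volume v * ‖v‖) := by ring
      _ ≤ SchwartzMap.seminorm ℝ k 1 G * ((bump V j).normed volume v * (1 / ((j : ℝ) + 1))) :=
          mul_le_mul_of_nonneg_left (bump_smul_le j v) (apply_nonneg _ _)
      _ = _ := by ring
  have h := norm_integral_le_of_norm_le ((integrable_bump j).mul_const _)
    (Eventually.of_forall hb)
  rwa [integral_smul, norm_smul, norm_pow, norm_norm, integral_mul_const,
    (bump V j).integral_normed, one_mul] at h

/-- Differentiating in x replaces G by `fderivFst G` in the averaging error, so induction over all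
complete targets reduces to the mean value bound without derivatives. -/
theorem norm_iteratedFDeriv_averageError_le (k l : ℕ) : ∀ {W : Type} [NormedAddCommGroup W]
    [NormedSpace ℝ W] [CompleteSpace W] (G : 𝓢(V × V, W)), ∃ C, ∀ (j : ℕ) (x : V),
    ‖x‖ ^ k * ‖iteratedFDeriv ℝ l (averageError G j) x‖ ≤ C * (1 / ((j : ℝ) + 1)) := by
  induction l with
  | zero =>
    intro W _ _ _ G
    refine ⟨SchwartzMap.seminorm ℝ k 1 G, fun j x => ?_⟩
    rw [norm_iteratedFDeriv_zero]
    exact norm_averageError_le G k j x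
  | succ l ih =>
    intro W _ _ _ G
    obtain ⟨C, hC⟩ := ih (fderivFst G)
    refine ⟨C, fun j x => ?_⟩
    rw [← norm_iteratedFDeriv_fderiv, funext fun x => (hasFDerivAt_averageError G j x).fderiv]
    exact hC j x

/-- Averages of the slices of a Schwartz function over small balls converge in `𝓢`. -/
theorem tendsto_partialIntegral_mulSnd {a : 𝓢(V, ℂ)} (G : 𝓢(V × V, ℂ)) (ha : ∀ x, G (x, 0) = a x) :
    Tendsto (fun j => partialIntegral volume (mulSnd ((bump V j).normed volume) G)) atTop
      (𝓝 a) := by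
  rw [(schwartz_withSeminorms ℝ V ℂ).tendsto_nhds]
  rintro ⟨k, l⟩ ε hε
  obtain ⟨C, hC⟩ := norm_iteratedFDeriv_averageError_le k l G
  have hf : ∀ j, (partialIntegral volume (mulSnd ((bump V j).normed volume) G) - a : V → ℂ) =
      averageError G j := fun j => by
    rw [averageError_eq]
    funext x
    simp [partialIntegral_apply, ha]
  have h0 : Tendsto (fun j : ℕ => C * (1 / ((j : ℝ) + 1))) atTop (𝓝 0) := by
    simpa using (tendsto_one_div_add_atTop_nhds_zero_nat (𝕜 := ℝ)).const_mul C
  filter_upwards [(tendsto_order.1 h0).2 ε hε] with j hj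
  have h1 : 0 ≤ C * (1 / ((j : ℝ) + 1)) := le_trans (by positivity) (hC j 0)
  refine (seminorm_le_bound ℝ k l _ h1 fun x => ?_).trans_lt hj
  have h2 := hC j x
  rw [← hf] at h2
  exact h2

end SliceLimit

end SchwartzMap

namespace GradedMoyal

open scoped FourierTransform LineDeriv

variable {n : ℕ} {θ : ℝ}

/-! ### Approximate units for the Moyal product -/

/-- Antisymmetry of the twist makes the phase of the second transform that of the inversion formula,
so only the constant remains. -/
theorem sft_sft (hθ : θ ≠ 0) (a : 𝓢(Space n, ℂ)) : sft hθ (sft hθ a) = normConst n θ • a := by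
  ext x
  rw [sft_apply, smul_apply, smul_eq_mul, ← integral_sft_mul_phase hθ a x]
  simp only [phase_swap hθ x]

theorem normConst_ne_zero (hθ : θ ≠ 0) : normConst n θ ≠ 0 := by
  have h : (Real.pi * θ) ^ (2 * n) ≠ 0 := pow_ne_zero _ (mul_ne_zero Real.pi_ne_zero hθ)
  exact inv_ne_zero (by exact_mod_cast h)

theorem sft_surjective (hθ : θ ≠ 0) : Function.Surjective (sft (n := n) hθ) := fun a =>
  ⟨(normConst n θ)⁻¹ • sft hθ a, by
    rw [sft_smul, sft_sft, smul_smul, inv_mul_cancel₀ (normConst_ne_zero hθ), one_smul]⟩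

/-- The Moyal product admits approximate units. -/
theorem exists_tendsto_star (hθ : θ ≠ 0) (a : 𝓢(Space n, ℂ)) :
    ∃ b : ℕ → 𝓢(Space n, ℂ), Tendsto (fun j => star hθ a (b j)) atTop (𝓝 a) := by
  -- The transform of b₀ equals 1 at the origin, so the integrand of a ⋆ b₀ at y = 0 is a(x).
  -- Multiplying this transform by normalized bumps averages the integrand over small y.
  obtain ⟨b₀, hb₀⟩ := sft_surjective hθ (SchwartzMap.gauss (0 : Space n))
  have h : ∀ j, ∃ b, sft hθ b = SchwartzMap.smulLeftCLM ℂ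
      ((SchwartzMap.bump (Space n) j).normed volume) (sft hθ b₀) :=
    fun j => sft_surjective hθ _
  choose b hb using h
  refine ⟨b, ?_⟩
  have hlim := SchwartzMap.tendsto_partialIntegral_mulSnd (a := a) (starIntegrand hθ a b₀)
    fun x => by
      rw [starIntegrand_apply, hb₀, SchwartzMap.gauss_apply, add_zero]
      simp [SchwartzMap.gaussExp, phase, twist]
  refine hlim.congr fun j => ?_
  rw [star]
  congr 1
  ext1 p
  obtain ⟨x, y⟩ := p
  have hg := SchwartzMap.bump_hasTemperateGrowth (V := Space n) j
  rw [SchwartzMap.mulSnd_apply hg, starIntegrand_apply, starIntegrand_apply, hb,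
    SchwartzMap.smulLeftCLM_apply_apply hg, Complex.real_smul, Complex.real_smul]
  ring

/-! ### The Moyal algebra -/

theorem schwartz_ext_of_integral {f g : 𝓢(Space n, ℂ)}
    (h : ∀ b : 𝓢(Space n, ℂ), ∫ x, f x * b x = ∫ x, g x * b x) : f = g := by
  ext x
  obtain ⟨δ, hδ⟩ := SchwartzMap.exists_tendsto_integral_mul x
  exact tendsto_nhds_unique (hδ f) (by simpa only [h] using hδ g)

theorem represents_iff (f : 𝓢(Space n, ℂ)) (L : 𝓢(Space n, ℂ) →ₗ[ℂ] ℂ) :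
    Represents f L ↔ ∀ b, ∫ x, f x * b x = L b := by
  refine forall_congr' fun b => ?_
  rw [SchwartzMap.coe_apply, eq_comm]
  simp only [smul_eq_mul, mul_comm]

theorem integral_mul_comm (f g : 𝓢(Space n, ℂ)) : ∫ x, f x * g x = ∫ x, g x * f x := by
  simp only [mul_comm]

/-- Associativity and ∫ f ⋆ g = ∫ fg; with commutativity of the pairing this yields cyclicity of the
integral. -/
theorem integral_star_mul (hθ : θ ≠ 0) (a b d : 𝓢(Space n, ℂ)) :
    ∫ x, star hθ a b x * d x = ∫ x, a x * star hθ b d x := by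
  rw [← integral_star, star_assoc, integral_star]

theorem integral_star_mul' (hθ : θ ≠ 0) (a b d : 𝓢(Space n, ℂ)) :
    ∫ x, star hθ a b x * d x = ∫ x, b x * star hθ d a x := by
  rw [integral_mul_comm, ← integral_star_mul, integral_mul_comm]

/-- `a ↦ T ⋆ a` for `T ∈ ℳ`. -/
def lmulFun (T : Moyal n θ) (a : 𝓢(Space n, ℂ)) : 𝓢(Space n, ℂ) := (T.2.2 a).choose

/-- `a ↦ a ⋆ T` for `T ∈ ℳ`. -/
def rmul (T : Moyal n θ) (a : 𝓢(Space n, ℂ)) : 𝓢(Space n, ℂ) := (T.2.1 a).choose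

theorem integral_lmulFun (hθ : θ ≠ 0) (T : Moyal n θ) (a b : 𝓢(Space n, ℂ)) :
    ∫ x, lmulFun T a x * b x = (T : 𝓢'(Space n, ℂ)) (star hθ a b) := by
  rw [← starS_eq_star hθ]
  exact (represents_iff _ _).1 (T.2.2 a).choose_spec b

theorem integral_rmul (hθ : θ ≠ 0) (T : Moyal n θ) (a b : 𝓢(Space n, ℂ)) :
    ∫ x, rmul T a x * b x = (T : 𝓢'(Space n, ℂ)) (star hθ b a) := by
  rw [← starS_eq_star hθ]
  exact (represents_iff _ _).1 (T.2.1 a).choose_spec b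

theorem lmulFun_eq_iff (hθ : θ ≠ 0) (T : Moyal n θ) (a f : 𝓢(Space n, ℂ)) :
    lmulFun T a = f ↔ ∀ b, ∫ x, f x * b x = (T : 𝓢'(Space n, ℂ)) (star hθ a b) :=
  ⟨fun h b => by rw [← h, integral_lmulFun], fun h =>
    schwartz_ext_of_integral fun b => by rw [integral_lmulFun hθ, h]⟩

theorem rmul_eq_iff (hθ : θ ≠ 0) (T : Moyal n θ) (a f : 𝓢(Space n, ℂ)) :
    rmul T a = f ↔ ∀ b, ∫ x, f x * b x = (T : 𝓢'(Space n, ℂ)) (star hθ b a) :=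
  ⟨fun h b => by rw [← h, integral_rmul], fun h =>
    schwartz_ext_of_integral fun b => by rw [integral_rmul hθ, h]⟩

theorem integrable_mul (f g : 𝓢(Space n, ℂ)) : Integrable fun x => f x * g x :=
  (SchwartzMap.pairing (ContinuousLinearMap.mul ℂ ℂ) f g).integrable

/-- `a ↦ T ⋆ a` for `T ∈ ℳ`, as a linear map. -/
def lmul (hθ : θ ≠ 0) (T : Moyal n θ) : 𝓢(Space n, ℂ) →ₗ[ℂ] 𝓢(Space n, ℂ) where
  toFun := lmulFun T
  map_add' a a' := by
    rw [lmulFun_eq_iff hθ]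
    intro b
    simp only [add_apply, add_mul]
    rw [integral_add (integrable_mul _ _) (integrable_mul _ _), integral_lmulFun hθ,
      integral_lmulFun hθ, star_add_left, map_add]
  map_smul' c a := by
    rw [lmulFun_eq_iff hθ]
    intro b
    simp only [smul_apply, smul_eq_mul, mul_assoc, RingHom.id_apply]
    rw [integral_const_mul, integral_lmulFun hθ, star_smul_left, map_smul, smul_eq_mul]

theorem integral_lmul (hθ : θ ≠ 0) (T : Moyal n θ) (a b : 𝓢(Space n, ℂ)) :
    ∫ x, lmul hθ T a x * b x = (T : 𝓢'(Space n, ℂ)) (star hθ a b) := integral_lmulFun hθ T a b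

theorem lmul_eq_iff (hθ : θ ≠ 0) (T : Moyal n θ) (a f : 𝓢(Space n, ℂ)) :
    lmul hθ T a = f ↔ ∀ b, ∫ x, f x * b x = (T : 𝓢'(Space n, ℂ)) (star hθ a b) :=
  lmulFun_eq_iff hθ T a f

/-- Both pairings equal ⟨T, f ⋆ g⟩. This supplies the continuity of left multiplication, which the
definition of ℳ does not demand. -/
theorem isTranspose_lmul (hθ : θ ≠ 0) (T : Moyal n θ) :
    SchwartzMap.IsTranspose (lmul hθ T) (rmul T) := fun f g => by
  rw [integral_lmul, integral_mul_comm, integral_rmul hθ]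

theorem continuous_lmul (hθ : θ ≠ 0) (T : Moyal n θ) : Continuous (lmul hθ T) :=
  (isTranspose_lmul hθ T).continuous

theorem lmul_star (hθ : θ ≠ 0) (T : Moyal n θ) (a b : 𝓢(Space n, ℂ)) :
    lmul hθ T (star hθ a b) = star hθ (lmul hθ T a) b := by
  rw [lmul_eq_iff]
  intro d
  rw [integral_star_mul, integral_lmul, star_assoc]

theorem star_rmul_lmul (hθ : θ ≠ 0) (T : Moyal n θ) (a b : 𝓢(Space n, ℂ)) :
    star hθ (rmul T a) b = star hθ a (lmul hθ T b) := by
  refine schwartz_ext_of_integral fun d => ?_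
  rw [integral_star_mul, integral_rmul hθ, integral_star_mul', integral_lmul, star_assoc]

/-- The functional `b ↦ ⟨S, T ⋆ b⟩`. -/
def mulDist (hθ : θ ≠ 0) (S T : Moyal n θ) : 𝓢'(Space n, ℂ) :=
  ContinuousLinearMap.toPointwiseConvergenceCLM ℂ (RingHom.id ℂ) 𝓢(Space n, ℂ) ℂ
    { toFun := fun b => (S : 𝓢'(Space n, ℂ)) (lmul hθ T b)
      map_add' := fun a b => by simp
      map_smul' := fun r a => by simp
      cont := (map_continuous (S : 𝓢'(Space n, ℂ))).comp (continuous_lmul hθ T) }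

theorem mulDist_apply (hθ : θ ≠ 0) (S T : Moyal n θ) (b : 𝓢(Space n, ℂ)) :
    mulDist hθ S T b = (S : 𝓢'(Space n, ℂ)) (lmul hθ T b) := rfl

theorem mulDist_mem (hθ : θ ≠ 0) (S T : Moyal n θ) : mulDist hθ S T ∈ Moyal n θ := by
  -- The witnesses are (a ⋆ S) ⋆ T and S ⋆ (T ⋆ a).
  refine ⟨fun a => ⟨rmul T (rmul S a), ?_⟩, fun a => ⟨lmul hθ S (lmul hθ T a), ?_⟩⟩
  · rw [represents_iff]
    intro b
    rw [integral_rmul hθ, ← integral_lmul, integral_mul_comm, integral_rmul hθ, ← lmul_star,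
      ← mulDist_apply, ← starS_eq_star hθ]
    rfl
  · rw [represents_iff]
    intro b
    rw [integral_lmul, ← lmul_star, ← mulDist_apply, ← starS_eq_star hθ]
    rfl

theorem moyal_ext {S T : Moyal n θ}
    (h : ∀ b, (S : 𝓢'(Space n, ℂ)) b = (T : 𝓢'(Space n, ℂ)) b) : S = T :=
  Subtype.ext (DFunLike.ext _ _ h)

theorem lmul_add_left (hθ : θ ≠ 0) (S T : Moyal n θ) (b : 𝓢(Space n, ℂ)) :
    lmul hθ (S + T) b = lmul hθ S b + lmul hθ T b := by
  rw [lmul_eq_iff]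
  intro d
  simp only [add_apply, add_mul]
  rw [integral_add (integrable_mul _ _) (integrable_mul _ _), integral_lmul, integral_lmul]
  rfl

theorem lmul_smul_left (hθ : θ ≠ 0) (c : ℂ) (T : Moyal n θ) (b : 𝓢(Space n, ℂ)) :
    lmul hθ (c • T) b = c • lmul hθ T b := by
  rw [lmul_eq_iff]
  intro d
  simp only [smul_apply, smul_eq_mul, mul_assoc]
  rw [integral_const_mul, integral_lmul]
  rfl

theorem exists_isStarM (hθ : θ ≠ 0) :
    ∃ B : Moyal n θ →ₗ[ℂ] Moyal n θ →ₗ[ℂ] Moyal n θ, IsStarM B := by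
  refine ⟨LinearMap.mk₂ ℂ (fun S T => ⟨mulDist hθ S T, mulDist_mem hθ S T⟩)
    (fun S S' T => moyal_ext fun b => rfl) (fun c S T => moyal_ext fun b => rfl)
    (fun S T T' => moyal_ext fun b => ?_) (fun c S T => moyal_ext fun b => ?_), ?_⟩
  · change (S : 𝓢'(Space n, ℂ)) (lmul hθ (T + T') b) = (S : 𝓢'(Space n, ℂ)) (lmul hθ T b) +
      (S : 𝓢'(Space n, ℂ)) (lmul hθ T' b)
    rw [lmul_add_left, map_add]
  · change (S : 𝓢'(Space n, ℂ)) (lmul hθ (c • T) b) = c • (S : 𝓢'(Space n, ℂ)) (lmul hθ T b)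
    rw [lmul_smul_left, map_smul]
  · intro S T b f hf
    have h : lmul hθ T b = f := by
      rw [lmul_eq_iff]
      intro d
      rw [(represents_iff _ _).1 hf d, ← starS_eq_star]
      rfl
    rw [← h]
    rfl

theorem isStarM_starM (hθ : θ ≠ 0) : IsStarM (n := n) (θ := θ) starM := by
  rw [starM, dif_pos (exists_isStarM hθ)]
  exact (exists_isStarM hθ).choose_spec

theorem starM_apply (hθ : θ ≠ 0) (S T : Moyal n θ) (b : 𝓢(Space n, ℂ)) :
    (starM S T : 𝓢'(Space n, ℂ)) b = (S : 𝓢'(Space n, ℂ)) (lmul hθ T b) := by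
  refine isStarM_starM hθ S T b _ ?_
  rw [represents_iff]
  intro d
  rw [integral_lmul, ← starS_eq_star]
  rfl

theorem lmul_starM (hθ : θ ≠ 0) (S T : Moyal n θ) (b : 𝓢(Space n, ℂ)) :
    lmul hθ (starM S T) b = lmul hθ S (lmul hθ T b) := by
  rw [lmul_eq_iff]
  intro d
  rw [integral_lmul, starM_apply hθ, lmul_star]

theorem starM_assoc (hθ : θ ≠ 0) (R S T : Moyal n θ) :
    starM (starM R S) T = starM R (starM S T) :=
  moyal_ext fun b => by
    rw [starM_apply hθ, starM_apply hθ, starM_apply hθ, lmul_starM]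

/-- An element of `ℳ` is determined by its left action on `𝓢`. -/
theorem moyal_ext_lmul (hθ : θ ≠ 0) {S T : Moyal n θ} (h : ∀ b, lmul hθ S b = lmul hθ T b) :
    S = T := by
  refine moyal_ext fun a => ?_
  -- ⟨S, a⟩ is the limit of ⟨S, a ⋆ b_j⟩ = ∫ (S ⋆ a) b_j, which sees only the left action of S.
  obtain ⟨b, hb⟩ := exists_tendsto_star hθ a
  have h1 := ((map_continuous (S : 𝓢'(Space n, ℂ))).tendsto a).comp hb
  have h2 := ((map_continuous (T : 𝓢'(Space n, ℂ))).tendsto a).comp hb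
  refine tendsto_nhds_unique h1 (h2.congr fun j => ?_)
  change (T : 𝓢'(Space n, ℂ)) (star hθ a (b j)) = (S : 𝓢'(Space n, ℂ)) (star hθ a (b j))
  rw [← integral_lmul, ← integral_lmul, h]

/-! ### The involution -/

theorem conjS_conjS (a : 𝓢(Space n, ℂ)) : conjS (conjS a) = a := by
  ext x
  simp [conjS_apply]

theorem conjDist_apply (T : 𝓢'(Space n, ℂ)) (a : 𝓢(Space n, ℂ)) :
    conjDist T a = (starRingEnd ℂ) (T (conjS a)) := rfl

theorem integral_conjS_mul (f b : 𝓢(Space n, ℂ)) :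
    ∫ x, conjS f x * b x = (starRingEnd ℂ) (∫ x, f x * conjS b x) := by
  rw [← integral_conj]
  simp [conjS_apply]

theorem conjDist_mem (hθ : θ ≠ 0) {T : 𝓢'(Space n, ℂ)} (hT : T ∈ Moyal n θ) :
    conjDist T ∈ Moyal n θ := by
  refine ⟨fun a => ⟨conjS (lmul hθ ⟨T, hT⟩ (conjS a)), ?_⟩,
    fun a => ⟨conjS (rmul ⟨T, hT⟩ (conjS a)), ?_⟩⟩
  · rw [represents_iff]
    intro b
    rw [integral_conjS_mul, integral_lmul, ← conjS_star, ← conjDist_apply, ← starS_eq_star hθ]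
    rfl
  · rw [represents_iff]
    intro b
    rw [integral_conjS_mul, integral_rmul hθ, ← conjS_star, ← conjDist_apply, ← starS_eq_star hθ]
    rfl

/-- The involution of `ℳ`. -/
def conjM (T : Moyal n θ) : Moyal n θ := toM n θ (conjDist T)

theorem conjM_coe (hθ : θ ≠ 0) (T : Moyal n θ) :
    (conjM T : 𝓢'(Space n, ℂ)) = conjDist (T : 𝓢'(Space n, ℂ)) := by
  rw [conjM, toM, dif_pos (conjDist_mem hθ T.2)]

theorem lmul_conjM (hθ : θ ≠ 0) (T : Moyal n θ) (a : 𝓢(Space n, ℂ)) :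
    lmul hθ (conjM T) a = conjS (rmul T (conjS a)) := by
  rw [lmul_eq_iff]
  intro b
  rw [integral_conjS_mul, integral_rmul hθ, ← conjS_star, ← conjDist_apply, conjM_coe hθ]

theorem rmul_starM (hθ : θ ≠ 0) (S T : Moyal n θ) (b : 𝓢(Space n, ℂ)) :
    rmul (starM S T) b = rmul T (rmul S b) := by
  rw [rmul_eq_iff hθ]
  intro d
  rw [integral_rmul hθ, ← integral_lmul, integral_mul_comm, integral_rmul hθ, ← lmul_star,
    starM_apply hθ]

theorem conjM_starM (hθ : θ ≠ 0) (S T : Moyal n θ) :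
    conjM (starM S T) = starM (conjM T) (conjM S) :=
  moyal_ext_lmul hθ fun b => by
    rw [lmul_starM, lmul_conjM, lmul_conjM, lmul_conjM, conjS_conjS, rmul_starM hθ]

theorem conjM_add (hθ : θ ≠ 0) (S T : Moyal n θ) : conjM (S + T) = conjM S + conjM T :=
  moyal_ext fun b => by
    rw [conjM_coe hθ]
    change conjDist _ b = (conjM S : 𝓢'(Space n, ℂ)) b + (conjM T : 𝓢'(Space n, ℂ)) b
    rw [conjM_coe hθ, conjM_coe hθ]
    exact map_add (starRingEnd ℂ) _ _

theorem conjM_smul (hθ : θ ≠ 0) (c : ℂ) (T : Moyal n θ) :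
    conjM (c • T) = (starRingEnd ℂ) c • conjM T :=
  moyal_ext fun b => by
    rw [conjM_coe hθ]
    change conjDist _ b = (starRingEnd ℂ) c * (conjM T : 𝓢'(Space n, ℂ)) b
    rw [conjM_coe hθ]
    exact map_mul (starRingEnd ℂ) _ _

/-! ### Constants -/

theorem constDist_apply (c : ℂ) (b : 𝓢(Space n, ℂ)) : constDist n c b = c * ∫ x, b x := by
  have h : constDist n c b = ∫ x, b x • c := rfl
  rw [h, ← integral_const_mul]
  simp only [smul_eq_mul, mul_comm]

theorem constDist_mem (hθ : θ ≠ 0) (c : ℂ) : constDist n c ∈ Moyal n θ := by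
  refine ⟨fun a => ⟨c • a, (represents_iff _ _).2 fun b => ?_⟩,
    fun a => ⟨c • a, (represents_iff _ _).2 fun b => ?_⟩⟩
  · change _ = constDist n c (starS θ b a)
    rw [constDist_apply, starS_eq_star hθ, integral_star, ← integral_const_mul]
    exact integral_congr_ae (Eventually.of_forall fun x => by
      simp only [smul_apply, smul_eq_mul]; ring)
  · change _ = constDist n c (starS θ a b)
    rw [constDist_apply, starS_eq_star hθ, integral_star, ← integral_const_mul]
    simp only [smul_apply, smul_eq_mul, mul_assoc]

/-- The unit of `ℳ`. -/
def oneM (n : ℕ) (θ : ℝ) : Moyal n θ := toM n θ (constDist n 1)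

theorem toM_constDist (hθ : θ ≠ 0) (c : ℂ) : toM n θ (constDist n c) = c • oneM n θ :=
  moyal_ext fun b => by
    change _ = c • (oneM n θ : 𝓢'(Space n, ℂ)) b
    rw [oneM, toM, toM, dif_pos (constDist_mem hθ c), dif_pos (constDist_mem hθ 1),
      constDist_apply, constDist_apply, one_mul, smul_eq_mul]

theorem oneM_apply (hθ : θ ≠ 0) (b : 𝓢(Space n, ℂ)) :
    (oneM n θ : 𝓢'(Space n, ℂ)) b = ∫ x, b x := by
  rw [oneM, toM, dif_pos (constDist_mem hθ 1), constDist_apply, one_mul]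

theorem lmul_oneM (hθ : θ ≠ 0) (a : 𝓢(Space n, ℂ)) : lmul hθ (oneM n θ) a = a := by
  rw [lmul_eq_iff]
  intro b
  rw [oneM_apply hθ, integral_star]

theorem rmul_oneM (hθ : θ ≠ 0) (a : 𝓢(Space n, ℂ)) : rmul (oneM n θ) a = a := by
  rw [rmul_eq_iff hθ]
  intro b
  rw [oneM_apply hθ, integral_star, integral_mul_comm]

theorem starM_oneM (hθ : θ ≠ 0) (T : Moyal n θ) : starM T (oneM n θ) = T :=
  moyal_ext fun b => by rw [starM_apply hθ, lmul_oneM]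

theorem oneM_starM (hθ : θ ≠ 0) (T : Moyal n θ) : starM (oneM n θ) T = T :=
  moyal_ext_lmul hθ fun b => by rw [lmul_starM, lmul_oneM]

theorem conjM_oneM (hθ : θ ≠ 0) : conjM (oneM n θ) = oneM n θ :=
  moyal_ext_lmul hθ fun b => by
    rw [lmul_conjM, rmul_oneM hθ, conjS_conjS, lmul_oneM]

/-! ### Linear functions -/

theorem integral_partialDeriv (μ : Idx n) (f : 𝓢(Space n, ℂ)) :
    ∫ x, partialDeriv μ f x = 0 := by
  have h0 : Integrable fun x => fderiv ℝ f x (EuclideanSpace.single μ (1 : ℝ)) :=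
    (partialDeriv μ f).integrable
  have h := integral_mul_fderiv_eq_neg_fderiv_mul_of_integrable (μ := (volume : Measure (Space n)))
    (f := fun _ : Space n => (1 : ℂ)) (g := f) (v := EuclideanSpace.single μ (1 : ℝ))
    (by simp) (by simpa only [one_mul] using h0) (by simpa using f.integrable)
    (by fun_prop) (fun x _ => f.differentiableAt)
  simpa [partialDeriv_apply] using h

theorem integral_mul_partialDeriv (μ : Idx n) (f g : 𝓢(Space n, ℂ)) :
    ∫ x, f x * partialDeriv μ g x = -∫ x, partialDeriv μ f x * g x :=
  SchwartzMap.integral_mul_lineDerivOp_right_eq_neg_left f g _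

theorem hasFDerivAt_xi (ν : Idx n) (x : Space n) :
    HasFDerivAt (fun x : Space n => (xi θ ν x : ℂ))
      (Complex.ofRealCLM ∘L
        (-∑ ρ, thetaInv n θ ν ρ • (EuclideanSpace.proj ρ : Space n →L[ℝ] ℝ))) x := by
  have h : (fun x : Space n => (xi θ ν x : ℂ)) =
      (Complex.ofRealCLM ∘L
        (-∑ ρ, thetaInv n θ ν ρ • (EuclideanSpace.proj ρ : Space n →L[ℝ] ℝ))) := by
    ext x
    simp [xi]
  rw [h]
  exact ContinuousLinearMap.hasFDerivAt _

theorem partialDeriv_mulXi (hθ : θ ≠ 0) (μ ν : Idx n) (a : 𝓢(Space n, ℂ)) :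
    partialDeriv μ (mulXi θ ν a) =
      mulXi θ ν (partialDeriv μ a) + (thetaInv n θ μ ν : ℂ) • a := by
  ext x
  rw [add_apply, mulXi_apply, partialDeriv_apply, partialDeriv_apply, smul_apply]
  have h : (mulXi θ ν a : Space n → ℂ) = fun x => (xi θ ν x : ℂ) * a x := by
    ext x
    exact mulXi_apply θ ν a x
  rw [h, ((hasFDerivAt_xi (θ := θ) ν x).fun_mul a.differentiableAt.hasFDerivAt).fderiv,
    thetaInv_neg hθ ν μ]
  simp [mul_comm]

theorem mulXi_comm (μ ν : Idx n) (a : 𝓢(Space n, ℂ)) :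
    mulXi θ μ (mulXi θ ν a) = mulXi θ ν (mulXi θ μ a) := by
  ext x
  simp only [mulXi_apply]
  ring

theorem partialDeriv_comm (μ ν : Idx n) (a : 𝓢(Space n, ℂ)) :
    partialDeriv μ (partialDeriv ν a) = partialDeriv ν (partialDeriv μ a) := by
  ext x
  have h : ∀ μ ν : Idx n, partialDeriv μ (partialDeriv ν a) x =
      fderiv ℝ (fderiv ℝ a) x (EuclideanSpace.single μ 1) (EuclideanSpace.single ν 1) := by
    intro μ ν
    rw [partialDeriv_apply]
    change fderiv ℝ (fun y => fderiv ℝ a y (EuclideanSpace.single ν (1 : ℝ))) x _ = _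
    have h1 : DifferentiableAt ℝ (fderiv ℝ a) x :=
      ((a.smooth 2).fderiv_right (m := 1) (by norm_num)).differentiable (by norm_num) x
    rw [fderiv_clm_apply h1 (by fun_prop)]
    simp
  rw [h, h]
  exact ((a.smooth 2).contDiffAt.isSymmSndFDerivAt (by simp)).eq _ _

theorem etaDist_apply (μ : Idx n) (b : 𝓢(Space n, ℂ)) :
    etaDist θ μ b = Complex.I * ∫ x, mulXi θ μ b x := by
  have h : etaDist θ μ b = ∫ x, b x • (Complex.I * (xi θ μ x : ℂ)) := rfl
  rw [h, ← integral_const_mul]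
  simp only [smul_eq_mul, mulXi_apply]
  exact integral_congr_ae (Eventually.of_forall fun x => by ring)

/-- Moving ξ_μ into the product leaves iξ_μ on a and -½∂_μ on b; the integral removes the star, and
integration by parts turns the latter into +½∂_μ on a. -/
theorem etaDist_star (hθ : θ ≠ 0) (μ : Idx n) (a b : 𝓢(Space n, ℂ)) :
    etaDist θ μ (star hθ a b) =
      ∫ x, (Complex.I • mulXi θ μ a + (1 / 2 : ℂ) • partialDeriv μ a) x * b x := by
  have h1 : ∀ x, (Complex.I • mulXi θ μ a + (1 / 2 : ℂ) • partialDeriv μ a) x * b x =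
      Complex.I * (mulXi θ μ a x * b x) + (1 / 2) * (partialDeriv μ a x * b x) := fun x => by
    simp only [add_apply, smul_apply, smul_eq_mul]
    ring
  simp only [h1]
  rw [etaDist_apply, mulXi_star, integral_add ((integrable_mul _ _).const_mul _)
    ((integrable_mul _ _).const_mul _), integral_const_mul, integral_const_mul]
  simp only [add_apply, smul_apply, smul_eq_mul]
  rw [integral_add (SchwartzMap.integrable _) ((SchwartzMap.integrable _).const_mul _),
    integral_const_mul, integral_star, integral_star, integral_mul_partialDeriv]
  linear_combination (-(1 / 2) * ∫ x, partialDeriv μ a x * b x) * Complex.I_mul_I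

theorem etaDist_star' (hθ : θ ≠ 0) (μ : Idx n) (a b : 𝓢(Space n, ℂ)) :
    etaDist θ μ (star hθ b a) =
      ∫ x, (Complex.I • mulXi θ μ a - (1 / 2 : ℂ) • partialDeriv μ a) x * b x := by
  have h1 : ∀ x, (Complex.I • mulXi θ μ a - (1 / 2 : ℂ) • partialDeriv μ a) x * b x =
      Complex.I * (mulXi θ μ b x * a x) - (1 / 2) * (b x * partialDeriv μ a x) := fun x => by
    simp only [sub_apply, smul_apply, smul_eq_mul, mulXi_apply]
    ring
  simp only [h1]
  rw [etaDist_apply, mulXi_star, integral_sub ((integrable_mul _ _).const_mul _)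
    ((integrable_mul _ _).const_mul _), integral_const_mul, integral_const_mul]
  simp only [add_apply, smul_apply, smul_eq_mul]
  rw [integral_add (SchwartzMap.integrable _) ((SchwartzMap.integrable _).const_mul _),
    integral_const_mul, integral_star, integral_star]
  linear_combination ((1 / 2) * ∫ x, b x * partialDeriv μ a x) * Complex.I_mul_I

theorem etaDist_mem (hθ : θ ≠ 0) (μ : Idx n) : etaDist θ μ ∈ Moyal n θ := by
  refine ⟨fun a => ⟨_, (represents_iff _ _).2 fun b => (etaDist_star' hθ μ a b).symm.trans ?_⟩,
    fun a => ⟨_, (represents_iff _ _).2 fun b => (etaDist_star hθ μ a b).symm.trans ?_⟩⟩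
  · rw [← starS_eq_star]
    rfl
  · rw [← starS_eq_star]
    rfl

/-- `η_μ` as an element of `ℳ`. -/
def etaM (n : ℕ) (θ : ℝ) (μ : Idx n) : Moyal n θ := toM n θ (etaDist θ μ)

theorem etaM_coe (hθ : θ ≠ 0) (μ : Idx n) : (etaM n θ μ : 𝓢'(Space n, ℂ)) = etaDist θ μ := by
  rw [etaM, toM, dif_pos (etaDist_mem hθ μ)]

theorem lmul_etaM (hθ : θ ≠ 0) (μ : Idx n) (a : 𝓢(Space n, ℂ)) :
    lmul hθ (etaM n θ μ) a = Complex.I • mulXi θ μ a + (1 / 2 : ℂ) • partialDeriv μ a := by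
  rw [lmul_eq_iff]
  intro b
  rw [etaM_coe hθ, etaDist_star]

theorem rmul_etaM (hθ : θ ≠ 0) (μ : Idx n) (a : 𝓢(Space n, ℂ)) :
    rmul (etaM n θ μ) a = Complex.I • mulXi θ μ a - (1 / 2 : ℂ) • partialDeriv μ a := by
  rw [rmul_eq_iff hθ]
  intro b
  rw [etaM_coe hθ, etaDist_star']

/-- Only the mixed terms of [iξ_μ + ½∂_μ, iξ_ν + ½∂_ν] survive. They give (i/2)(Θ⁻¹_{μν} -
Θ⁻¹_{νμ}). -/
theorem etaM_commutator (hθ : θ ≠ 0) (μ ν : Idx n) :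
    starM (etaM n θ μ) (etaM n θ ν) - starM (etaM n θ ν) (etaM n θ μ) =
      (Complex.I * (thetaInv n θ μ ν : ℂ)) • oneM n θ := by
  rw [sub_eq_iff_eq_add]
  refine moyal_ext_lmul hθ fun b => ?_
  rw [lmul_add_left, lmul_smul_left, lmul_oneM, lmul_starM, lmul_starM]
  simp only [lmul_etaM, map_add, map_smul, partialDeriv_mulXi hθ, smul_add, smul_smul]
  rw [mulXi_comm μ ν, partialDeriv_comm μ ν, thetaInv_neg hθ μ ν]
  push_cast
  module

theorem conjS_mulXi (μ : Idx n) (a : 𝓢(Space n, ℂ)) :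
    conjS (mulXi θ μ a) = mulXi θ μ (conjS a) := by
  ext x
  simp [conjS_apply, mulXi_apply]

theorem conjM_etaM (hθ : θ ≠ 0) (μ : Idx n) : conjM (etaM n θ μ) = -etaM n θ μ :=
  moyal_ext fun b => by
    change _ = -(etaM n θ μ : 𝓢'(Space n, ℂ)) b
    rw [conjM_coe hθ, etaM_coe hθ, conjDist_apply, etaDist_apply, etaDist_apply, ← conjS_mulXi,
      map_mul, ← integral_conj, Complex.conj_I, neg_mul]
    simp only [conjS_apply, Complex.conj_conj]

/-! ### Quadratic functions -/

theorem eta2Dist_apply (μ ν : Idx n) (b : 𝓢(Space n, ℂ)) :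
    eta2Dist θ μ ν b = Complex.I * ∫ x, mulXi θ μ (mulXi θ ν b) x := by
  have h : eta2Dist θ μ ν b =
    ∫ x, b x • (Complex.I * ((xi θ μ x : ℂ) * (xi θ ν x : ℂ))) := rfl
  rw [h, ← integral_const_mul]
  simp only [smul_eq_mul, mulXi_apply]
  exact integral_congr_ae (Eventually.of_forall fun x => by ring)

/-- The term ξ_μ ∂_ν b is a total derivative minus a multiple of b; that multiple is the whole
correction to the pointwise product. -/
theorem starM_etaM_apply (hθ : θ ≠ 0) (μ ν : Idx n) (b : 𝓢(Space n, ℂ)) :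
    (starM (etaM n θ μ) (etaM n θ ν) : 𝓢'(Space n, ℂ)) b =
      Complex.I * (eta2Dist θ μ ν b + (1 / 2) * (thetaInv n θ μ ν : ℂ) * ∫ x, b x) := by
  have h1 : mulXi θ μ (partialDeriv ν b) =
      partialDeriv ν (mulXi θ μ b) - (thetaInv n θ ν μ : ℂ) • b := by
    rw [partialDeriv_mulXi hθ, add_sub_cancel_right]
  rw [starM_apply hθ, etaM_coe hθ, lmul_etaM, map_add, map_smul, map_smul, etaDist_apply,
    etaDist_apply, h1, eta2Dist_apply]
  simp only [sub_apply, smul_apply, smul_eq_mul]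
  rw [integral_sub (SchwartzMap.integrable _) ((SchwartzMap.integrable _).const_mul _),
    integral_partialDeriv, integral_const_mul, thetaInv_neg hθ μ ν]
  push_cast
  ring

theorem eta2Dist_comm (μ ν : Idx n) : eta2Dist θ μ ν = eta2Dist θ ν μ := by
  ext b
  rw [eta2Dist_apply, eta2Dist_apply, mulXi_comm]

/-- Symmetrising cancels the antisymmetric correction. Membership in ℳ and all relations for η_{μν}
thereby reduce to the algebra of the η_μ. -/
theorem eta2Dist_eq (hθ : θ ≠ 0) (μ ν : Idx n) :
    eta2Dist θ μ ν = (((-(Complex.I / 2)) • (starM (etaM n θ μ) (etaM n θ ν) +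
      starM (etaM n θ ν) (etaM n θ μ)) : Moyal n θ) : 𝓢'(Space n, ℂ)) := by
  ext b
  change _ = (-(Complex.I / 2)) * ((starM (etaM n θ μ) (etaM n θ ν) : 𝓢'(Space n, ℂ)) b +
      (starM (etaM n θ ν) (etaM n θ μ) : 𝓢'(Space n, ℂ)) b)
  rw [starM_etaM_apply hθ, starM_etaM_apply hθ, eta2Dist_comm ν μ, thetaInv_neg hθ μ ν]
  push_cast
  linear_combination (eta2Dist θ μ ν b) * Complex.I_mul_I

theorem eta2Dist_mem (hθ : θ ≠ 0) (μ ν : Idx n) : eta2Dist θ μ ν ∈ Moyal n θ := by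
  rw [eta2Dist_eq hθ]
  exact Subtype.property _

/-- `η_{μν}` as an element of `ℳ`. -/
def eta2M (n : ℕ) (θ : ℝ) (μ ν : Idx n) : Moyal n θ := toM n θ (eta2Dist θ μ ν)

theorem eta2M_eq (hθ : θ ≠ 0) (μ ν : Idx n) :
    eta2M n θ μ ν = (-(Complex.I / 2)) • (starM (etaM n θ μ) (etaM n θ ν) +
      starM (etaM n θ ν) (etaM n θ μ)) := by
  refine Subtype.ext ?_
  rw [eta2M, toM, dif_pos (eta2Dist_mem hθ μ ν)]
  exact eta2Dist_eq hθ μ ν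

theorem wellDefined (hθ : θ ≠ 0) : WellDefined n θ where
  isStar := isStar_starS hθ
  isStarM := isStarM_starM hθ
  conj_mem _ hT := conjDist_mem hθ hT
  const_mem := constDist_mem hθ
  eta_mem := etaDist_mem hθ
  eta2_mem := eta2Dist_mem hθ

/-! ### Operators on Schwartz functions commuting with multiplications and derivatives -/

/-- `A` commutes with multiplication by linear functions and with partial derivatives. -/
structure CommutesWithHeisenberg (θ : ℝ) (A : 𝓢(Space n, ℂ) → 𝓢(Space n, ℂ)) : Prop where
  mulXi : ∀ μ a, A (mulXi θ μ a) = mulXi θ μ (A a)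
  partialDeriv : ∀ μ a, A (partialDeriv μ a) = partialDeriv μ (A a)

theorem integral_mulXi_mul (μ : Idx n) (f g : 𝓢(Space n, ℂ)) :
    ∫ x, mulXi θ μ f x * g x = ∫ x, f x * mulXi θ μ g x := by
  simp only [mulXi_apply]
  exact integral_congr_ae (Eventually.of_forall fun x => by ring)

theorem integral_partialDeriv_mul (μ : Idx n) (f g : 𝓢(Space n, ℂ)) :
    ∫ x, partialDeriv μ f x * g x = -∫ x, f x * partialDeriv μ g x := by
  rw [integral_mul_partialDeriv, neg_neg]

theorem CommutesWithHeisenberg.transpose {A A' : 𝓢(Space n, ℂ) → 𝓢(Space n, ℂ)}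
    (hA : CommutesWithHeisenberg θ A) (h : SchwartzMap.IsTranspose A A') :
    CommutesWithHeisenberg θ A' where
  mulXi μ a := schwartz_ext_of_integral fun b => by
    rw [integral_mul_comm, ← h, integral_mulXi_mul, integral_mul_comm (A' a), ← h, hA.mulXi,
      integral_mulXi_mul]
  partialDeriv μ a := schwartz_ext_of_integral fun b => by
    rw [integral_mul_comm, ← h, integral_partialDeriv_mul, integral_mul_comm (A' a), ← h,
      hA.partialDeriv, integral_partialDeriv_mul, neg_neg]

/-- Θ⁻¹ pairs the two coordinates of a block, so each coordinate is ±θ times the ξ of its partner.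
-/
theorem exists_coord_eq (hθ : θ ≠ 0) (μ : Idx n) :
    ∃ (s : ℝ) (ν : Idx n), ∀ x : Space n, x μ = s * xi θ ν x := by
  obtain ⟨i, k⟩ := μ
  fin_cases i
  · refine ⟨θ, (1, k), fun x => ?_⟩
    rw [xi_eq hθ, cplx_apply]
    simp [hθ]
  · refine ⟨-θ, (0, k), fun x => ?_⟩
    rw [xi_eq hθ, cplx_apply]
    simp [hθ]

theorem gaussExpDeriv_single (k x : Space n) (μ : Idx n) :
    SchwartzMap.gaussExpDeriv k x (EuclideanSpace.single μ 1) =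
      -(x μ : ℂ) - 2 * Real.pi * Complex.I * (k μ : ℂ) := by
  simp [SchwartzMap.gaussExpDeriv, EuclideanSpace.inner_single_right]

theorem partialDeriv_gauss (k : Space n) (μ ν : Idx n) {s : ℝ}
    (hs : ∀ x : Space n, x μ = s * xi θ ν x) :
    partialDeriv μ (SchwartzMap.gauss k) = (-(s : ℂ)) • mulXi θ ν (SchwartzMap.gauss k) +
      (-(2 * Real.pi * Complex.I * (k μ : ℂ))) • SchwartzMap.gauss k := by
  ext x
  rw [partialDeriv_apply, SchwartzMap.fderiv_gauss]
  simp only [add_apply, smul_apply, mulXi_apply, smul_eq_mul, gaussExpDeriv_single, hs x]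
  push_cast
  ring

/-- The equations ∂_μ g = (-x_μ - 2πi k_μ) g pass to A g because A commutes with their ingredients.
Dividing A g by the Gaussian then gives a function with zero derivative. -/
theorem CommutesWithHeisenberg.exists_eq_smul_gauss (hθ : θ ≠ 0)
    {A : 𝓢(Space n, ℂ) →ₗ[ℂ] 𝓢(Space n, ℂ)} (hA : CommutesWithHeisenberg θ A) (k : Space n) :
    ∃ c : ℂ, A (SchwartzMap.gauss k) = c • SchwartzMap.gauss k := by
  set f := A (SchwartzMap.gauss k) with hf
  have h1 : ∀ x, HasFDerivAt (fun x => f x * Complex.exp (-SchwartzMap.gaussExp k x))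
      (f x • (Complex.exp (-SchwartzMap.gaussExp k x) • -SchwartzMap.gaussExpDeriv k x) +
        Complex.exp (-SchwartzMap.gaussExp k x) • fderiv ℝ f x) x := fun x =>
    f.differentiableAt.hasFDerivAt.fun_mul (SchwartzMap.hasFDerivAt_gaussExp k x).neg.cexp
  have h2 : ∀ μ, ∀ x, fderiv ℝ f x (EuclideanSpace.single μ 1) =
      f x * SchwartzMap.gaussExpDeriv k x (EuclideanSpace.single μ 1) := by
    intro μ x
    obtain ⟨s, ν, hs⟩ := exists_coord_eq hθ μ
    have h := congrArg A (partialDeriv_gauss k μ ν hs)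
    rw [map_add, map_smul, map_smul, hA.mulXi, hA.partialDeriv, ← hf] at h
    have h' := congrArg (fun g : 𝓢(Space n, ℂ) => g x) h
    simp only [add_apply, smul_apply, mulXi_apply, smul_eq_mul, partialDeriv_apply] at h'
    rw [h', gaussExpDeriv_single, hs x]
    push_cast
    ring
  have h3 : ∀ x, fderiv ℝ f x = f x • SchwartzMap.gaussExpDeriv k x := fun x => by
    have hb := (EuclideanSpace.basisFun (Idx n) ℝ).toBasis.ext
      (f₁ := (fderiv ℝ f x).toLinearMap)
      (f₂ := (f x • SchwartzMap.gaussExpDeriv k x).toLinearMap) fun μ => by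
        simpa using h2 μ x
    exact ContinuousLinearMap.coe_injective hb
  have h4 : ∀ x, fderiv ℝ (fun x => f x * Complex.exp (-SchwartzMap.gaussExp k x)) x = 0 :=
    fun x => by
      rw [(h1 x).fderiv, h3]
      ext y
      simp
      ring
  refine ⟨f 0 * Complex.exp (-SchwartzMap.gaussExp k 0), ?_⟩
  ext x
  have h5 := is_const_of_fderiv_eq_zero (fun x => (h1 x).differentiableAt) h4 0 x
  rw [smul_apply, SchwartzMap.gauss_apply, smul_eq_mul]
  rw [h5, mul_assoc, ← Complex.exp_add, neg_add_cancel, Complex.exp_zero, mul_one]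

theorem integral_gauss_mul_gauss_ne_zero (k l : Space n) :
    ∫ x, SchwartzMap.gauss k x * SchwartzMap.gauss l x ≠ 0 := by
  have h : ∀ x : Space n, SchwartzMap.gauss k x * SchwartzMap.gauss l x =
      Complex.exp (-1 * (‖x‖ : ℂ) ^ 2 +
        (-2 * Real.pi * Complex.I) * (inner ℝ (k + l) x : ℝ)) := fun x => by
    rw [SchwartzMap.gauss_apply, SchwartzMap.gauss_apply, ← Complex.exp_add,
      SchwartzMap.gaussExp, SchwartzMap.gaussExp, inner_add_left, real_inner_comm x k,
      real_inner_comm x l]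
    push_cast
    ring_nf
  simp only [h]
  rw [GaussianFourier.integral_cexp_neg_mul_sq_norm_add (by simp)]
  refine mul_ne_zero ?_ (Complex.exp_ne_zero _)
  rw [div_one, Complex.cpow_def_of_ne_zero (by exact_mod_cast Real.pi_ne_zero)]
  exact Complex.exp_ne_zero _

/-- These pairings are the values of the Fourier transform of f times the unmodulated Gaussian,
which has no zeros. -/
theorem eq_zero_of_integral_mul_gauss {f : 𝓢(Space n, ℂ)}
    (h : ∀ k, ∫ x, f x * SchwartzMap.gauss k x = 0) : f = 0 := by
  set w : 𝓢(Space n, ℂ) :=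
    SchwartzMap.pairing (ContinuousLinearMap.mul ℂ ℂ) f (SchwartzMap.gauss 0) with hw
  have hwx : ∀ x, w x = f x * SchwartzMap.gauss 0 x := fun x => rfl
  have h1 : 𝓕 w = 0 := by
    ext k
    rw [SchwartzMap.fourier_coe, Real.fourier_eq']
    refine (integral_congr_ae (Eventually.of_forall fun x => ?_)).trans (h k)
    simp only [hwx, SchwartzMap.gauss_apply, SchwartzMap.gaussExp, smul_eq_mul, Complex.exp_add]
    simp
    ring
  have h2 : w = 0 := by
    rw [← FourierTransform.fourierInv_fourier_eq (F := 𝓢(Space n, ℂ)) w, h1]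
    exact map_zero (FourierTransform.fourierCLE ℂ 𝓢(Space n, ℂ)).symm
  ext x
  have h3 : f x * SchwartzMap.gauss 0 x = 0 := by rw [← hwx, h2]; rfl
  rw [SchwartzMap.gauss_apply] at h3
  exact (mul_eq_zero.1 h3).resolve_right (Complex.exp_ne_zero _)

/-- Schur's lemma for the Heisenberg action on Schwartz functions. -/
theorem CommutesWithHeisenberg.exists_eq_smul (hθ : θ ≠ 0)
    {A A' : 𝓢(Space n, ℂ) →ₗ[ℂ] 𝓢(Space n, ℂ)} (hA : CommutesWithHeisenberg θ A)
    (h : SchwartzMap.IsTranspose A A') : ∃ c : ℂ, ∀ f, A f = c • f := by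
  choose c hc using fun k => hA.exists_eq_smul_gauss hθ k
  choose c' hc' using fun k => (hA.transpose h).exists_eq_smul_gauss hθ k
  -- Comparing eigenvalues of A and its transpose across a nonzero pairing makes each independent of
  -- its index.
  have hcc : ∀ k l, c k = c' l := fun k l => by
    have h1 := h (SchwartzMap.gauss k) (SchwartzMap.gauss l)
    simp only [hc, hc', smul_apply, smul_eq_mul, mul_assoc, mul_left_comm _ (c' l)] at h1
    rw [integral_const_mul, integral_const_mul] at h1
    exact mul_right_cancel₀ (integral_gauss_mul_gauss_ne_zero k l) h1
  refine ⟨c 0, fun f => sub_eq_zero.1 (eq_zero_of_integral_mul_gauss fun k => ?_)⟩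
  have h1 := h f (SchwartzMap.gauss k)
  simp only [hc', ← hcc 0 k, smul_apply, smul_eq_mul, mul_left_comm _ (c 0)] at h1
  simp only [sub_apply, smul_apply, sub_mul, smul_eq_mul, mul_assoc]
  rw [integral_sub (integrable_mul _ _) ((integrable_mul _ _).const_mul _), h1, sub_self]

/-! ### The center of the Moyal algebra -/

/-- `a ↦ a ⋆ T` for `T ∈ ℳ`, as a linear map. -/
def rmulLin (hθ : θ ≠ 0) (T : Moyal n θ) : 𝓢(Space n, ℂ) →ₗ[ℂ] 𝓢(Space n, ℂ) where
  toFun := rmul T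
  map_add' a a' := by
    rw [rmul_eq_iff hθ]
    intro b
    simp only [add_apply, add_mul]
    rw [integral_add (integrable_mul _ _) (integrable_mul _ _), integral_rmul hθ,
      integral_rmul hθ, star_add_right, map_add]
  map_smul' c a := by
    rw [rmul_eq_iff hθ]
    intro b
    simp only [smul_apply, smul_eq_mul, mul_assoc, RingHom.id_apply]
    rw [integral_const_mul, integral_rmul hθ, star_smul_right, map_smul, smul_eq_mul]

theorem lmul_rmul (hθ : θ ≠ 0) (S T : Moyal n θ) (a : 𝓢(Space n, ℂ)) :
    lmul hθ S (rmul T a) = rmul T (lmul hθ S a) := by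
  rw [lmul_eq_iff]
  intro b
  rw [star_rmul_lmul, ← integral_lmul, integral_mul_comm,
    ← isTranspose_lmul hθ T, integral_mul_comm]

theorem mulXi_eq (hθ : θ ≠ 0) (μ : Idx n) (a : 𝓢(Space n, ℂ)) :
    mulXi θ μ a = (-(Complex.I / 2)) • (lmul hθ (etaM n θ μ) a + rmul (etaM n θ μ) a) := by
  rw [lmul_etaM, rmul_etaM hθ, add_add_sub_cancel, ← two_smul ℂ, smul_smul, smul_smul]
  have h : -(Complex.I / 2) * 2 * Complex.I = 1 := by
    linear_combination -Complex.I_mul_I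
  rw [h, one_smul]

theorem partialDeriv_eq (hθ : θ ≠ 0) (μ : Idx n) (a : 𝓢(Space n, ℂ)) :
    partialDeriv μ a = lmul hθ (etaM n θ μ) a - rmul (etaM n θ μ) a := by
  rw [lmul_etaM, rmul_etaM hθ]
  module

/-- ξ_μ and ∂_μ are combinations of left and right multiplication by η_μ. Left multiplication by T
commutes with the former by hypothesis, with the latter by associativity. -/
theorem commutesWithHeisenberg_lmul (hθ : θ ≠ 0) {T : Moyal n θ}
    (h : ∀ μ, starM T (etaM n θ μ) = starM (etaM n θ μ) T) :
    CommutesWithHeisenberg θ (lmul hθ T) := by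
  have h1 : ∀ μ a, lmul hθ T (lmul hθ (etaM n θ μ) a) = lmul hθ (etaM n θ μ) (lmul hθ T a) :=
    fun μ a => by rw [← lmul_starM, h, lmul_starM]
  exact ⟨fun μ a => by simp only [mulXi_eq hθ, map_smul, map_add, h1, lmul_rmul],
    fun μ a => by simp only [partialDeriv_eq hθ, map_sub, h1, lmul_rmul]⟩

/-- An element of `ℳ` which commutes with all `η_μ` is a constant. -/
theorem exists_eq_smul_oneM (hθ : θ ≠ 0) {T : Moyal n θ}
    (h : ∀ μ, starM T (etaM n θ μ) = starM (etaM n θ μ) T) : ∃ c : ℂ, T = c • oneM n θ := by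
  obtain ⟨c, hc⟩ := (commutesWithHeisenberg_lmul hθ h).exists_eq_smul hθ (A' := rmulLin hθ T)
    (isTranspose_lmul hθ T)
  exact ⟨c, moyal_ext_lmul hθ fun b => by rw [lmul_smul_left, lmul_oneM, hc]⟩

/-! ### The graded Moyal algebra -/

theorem forall_zmod_two {p : ZMod 2 → Prop} : (∀ α, p α) ↔ p 0 ∧ p 1 := Fin.forall_fin_two

theorem sum_zmod_two {M : Type*} [AddCommMonoid M] (f : ZMod 2 → M) : ∑ α, f α = f 0 + f 1 :=
  Fin.sum_univ_two f

theorem iSup_zmod_two {M : Type*} [CompleteLattice M] (f : ZMod 2 → M) : ⨆ α, f α = f 0 ⊔ f 1 :=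
  le_antisymm (iSup_le (forall_zmod_two.2 ⟨le_sup_left, le_sup_right⟩))
    (sup_le (le_iSup f 0) (le_iSup f 1))

theorem sgn_zero_left (β : ZMod 2) : sgn 0 β = 1 := by simp [sgn]

theorem sgn_zero_right (α : ZMod 2) : sgn α 0 = 1 := by simp [sgn]

theorem sgn_one_one : sgn 1 1 = -1 := by
  rw [sgn, ZMod.val_one]
  norm_num

theorem one_add_one_zmod_two : (1 + 1 : ZMod 2) = 0 := rfl

theorem comp_zero (a : GAlg n θ) : comp 0 a = (a.1, 0) := rfl

theorem comp_one (a : GAlg n θ) : comp 1 a = (0, a.2) := rfl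

theorem mem_homog_zero {a : GAlg n θ} : a ∈ homog n θ 0 ↔ a.2 = 0 :=
  ⟨by rintro ⟨b, rfl⟩; rfl, fun h => ⟨a, by rw [comp_zero, ← h]⟩⟩

theorem mem_homog_one {a : GAlg n θ} : a ∈ homog n θ 1 ↔ a.1 = 0 :=
  ⟨by rintro ⟨b, rfl⟩; rfl, fun h => ⟨a, by rw [comp_one, ← h]⟩⟩

theorem mulA_apply (a b : GAlg n θ) :
    mulA a b = (starM a.1 b.1 + starM a.2 b.2, starM a.1 b.2 + starM a.2 b.1) := rfl

theorem bracket_apply (a b : GAlg n θ) :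
    bracket a b = (starM a.1 b.1 - starM b.1 a.1 + (starM a.2 b.2 + starM b.2 a.2),
      starM a.1 b.2 - starM b.2 a.1 + (starM a.2 b.1 - starM b.1 a.2)) := by
  simp only [bracket, sum_zmod_two, sgn_zero_left, sgn_zero_right, sgn_one_one, LinearMap.sub_apply,
    LinearMap.add_apply, LinearMap.smul_apply, LinearMap.compl₁₂_apply, LinearMap.flip_apply,
    mulA_apply, comp_zero, comp_one, map_zero, LinearMap.zero_apply]
  ext1
  · simp
    abel
  · simp
    abel

theorem bracket_even (h : Moyal n θ) (b : GAlg n θ) :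
    bracket (h, 0) b = (starM h b.1 - starM b.1 h, starM h b.2 - starM b.2 h) := by
  simp [bracket_apply]

theorem bracket_odd (h : Moyal n θ) (b : GAlg n θ) :
    bracket (0, h) b = (starM h b.2 + starM b.2 h, starM h b.1 - starM b.1 h) := by
  simp [bracket_apply]

/-- The graded Leibniz rule is associativity plus cancellation, checked in the four parity cases. -/
theorem Ad_mem_der (hθ : θ ≠ 0) (α : ZMod 2) {x : GAlg n θ} (hx : x ∈ homog n θ α) :
    Ad x ∈ Der n θ α := by
  obtain ⟨x0, x1⟩ := x
  rintro β ⟨a0, a1⟩ ha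
  revert α β
  simp only [forall_zmod_two, sgn_zero_left, sgn_zero_right, sgn_one_one, one_add_one_zmod_two,
    add_zero, zero_add, mem_homog_zero, mem_homog_one, Ad]
  refine ⟨?_, ?_⟩ <;> rintro rfl <;> refine ⟨?_, ?_⟩
  all_goals
    rintro rfl
    refine ⟨by simp [bracket_apply], fun b => ?_⟩
    simp only [bracket_even, bracket_odd, mulA_apply, map_add, map_sub, map_zero,
      LinearMap.add_apply, LinearMap.sub_apply, LinearMap.zero_apply,
      starM_assoc hθ]
    ext1 <;> simp <;> abel

theorem homog_zero_inf_homog_one {a : GAlg n θ} (h0 : a ∈ homog n θ 0) (h1 : a ∈ homog n θ 1) :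
    a = 0 :=
  Prod.ext (mem_homog_one.1 h1) (mem_homog_zero.1 h0)

/-- Degrees alone suffice: on each summand the values lie in both homogeneous parts. -/
theorem der_zero_inf_der_one {X : GAlg n θ →ₗ[ℂ] GAlg n θ} (h0 : X ∈ Der n θ 0)
    (h1 : X ∈ Der n θ 1) : X = 0 := by
  refine LinearMap.prod_ext (LinearMap.ext fun a => ?_) (LinearMap.ext fun a => ?_)
  · exact homog_zero_inf_homog_one (h0 0 _ (mem_homog_zero.2 rfl)).1
        (h1 0 _ (mem_homog_zero.2 rfl)).1
  · exact homog_zero_inf_homog_one (h1 1 _ (mem_homog_one.2 rfl)).1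
        (h0 1 _ (mem_homog_one.2 rfl)).1

/-- The graded Jacobi identity. -/
theorem derBracket_Ad (hθ : θ ≠ 0) (α β : ZMod 2) {x y : GAlg n θ} (hx : x ∈ homog n θ α)
    (hy : y ∈ homog n θ β) : derBracket α β (Ad x) (Ad y) = Ad (bracket x y) := by
  refine LinearMap.ext fun b => ?_
  obtain ⟨x0, x1⟩ := x
  obtain ⟨y0, y1⟩ := y
  revert α β
  simp only [forall_zmod_two, mem_homog_zero, mem_homog_one, derBracket, LinearMap.sub_apply,
    LinearMap.comp_apply, LinearMap.smul_apply, sgn_zero_left, sgn_zero_right, sgn_one_one, Ad]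
  refine ⟨⟨?_, ?_⟩, ⟨?_, ?_⟩⟩
  all_goals
    rintro rfl rfl
    simp only [bracket_apply, map_add, map_sub, map_zero,
      LinearMap.add_apply, LinearMap.sub_apply, LinearMap.zero_apply,
      starM_assoc hθ]
    ext1 <;> simp <;> abel

theorem bracket_oneA (hθ : θ ≠ 0) : bracket (oneA n θ) = 0 := by
  refine LinearMap.ext fun b => ?_
  have h : oneA n θ = (oneM n θ, 0) := rfl
  rw [h, bracket_even]
  simp [starM_oneM hθ, oneM_starM hθ]

/-! ### Reality -/

/-- Conjugation reverses the product, so for h† = -h the two signs in [h, b]† cancel. -/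
theorem isReal_even (hθ : θ ≠ 0) {h : Moyal n θ} (hh : conjM h = -h) : IsReal (Ad (h, 0)) := by
  intro a
  have hd : ∀ b : GAlg n θ, daggerA b = (conjM b.1, Complex.I • conjM b.2) := fun b => rfl
  have hs : ∀ S T : Moyal n θ, conjM (S - T) = conjM S - conjM T := fun S T => by
    have h1 := conjM_smul hθ (-1) T
    simp only [map_neg, map_one, neg_smul, one_smul] at h1
    rw [sub_eq_add_neg, conjM_add hθ, h1, sub_eq_add_neg]
  simp only [hd, Ad, bracket_even, hs, conjM_starM hθ, hh, map_neg, map_smul, LinearMap.neg_apply,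
    LinearMap.smul_apply]
  ext1
  · simp
    abel
  · simp
    module

/-- An odd map moves values between the summand where † carries the factor i and the one where it
does not. In both components reality comes down to e = i ē, which the phase e^{iπ/4} satisfies. -/
theorem isReal_odd (hθ : θ ≠ 0) {h : Moyal n θ} (hh : conjM h = -h) :
    IsReal (Complex.exp (Complex.I * Real.pi / 4) • Ad (0, h)) := by
  intro a
  have hd : ∀ b : GAlg n θ, daggerA b = (conjM b.1, Complex.I • conjM b.2) := fun b => rfl
  have hs : ∀ S T : Moyal n θ, conjM (S - T) = conjM S - conjM T := fun S T => by
    have h1 := conjM_smul hθ (-1) T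
    simp only [map_neg, map_one, neg_smul, one_smul] at h1
    rw [sub_eq_add_neg, conjM_add hθ, h1, sub_eq_add_neg]
  have he : Complex.exp (Complex.I * Real.pi / 4) =
      Complex.I * (starRingEnd ℂ) (Complex.exp (Complex.I * Real.pi / 4)) := by
    rw [← Complex.exp_conj]
    nth_rewrite 2 [← Complex.exp_pi_div_two_mul_I]
    rw [← Complex.exp_add]
    congr 1
    simp only [map_div₀, map_mul, Complex.conj_I, Complex.conj_ofReal, map_ofNat]
    ring
  set e := Complex.exp (Complex.I * Real.pi / 4)
  set e' := (starRingEnd ℂ) e with he'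
  simp only [hd, Ad, LinearMap.smul_apply, bracket_odd, Prod.smul_fst, Prod.smul_snd,
    conjM_smul hθ, hs, conjM_add hθ, conjM_starM hθ, hh, map_neg, map_smul, LinearMap.neg_apply]
  rw [← he', he]
  ext1
  · simp only [Prod.smul_mk, smul_add, smul_smul]
    have h1 : Complex.I * e' * Complex.I = -e' := by linear_combination e' * Complex.I_mul_I
    rw [h1]
    module
  · simp only [Prod.smul_mk, smul_smul]
    module

/-! ### Commutation relations -/

theorem etaM_mul_etaM (hθ : θ ≠ 0) (μ ν : Idx n) :
    starM (etaM n θ μ) (etaM n θ ν) = starM (etaM n θ ν) (etaM n θ μ) +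
      (Complex.I * (thetaInv n θ μ ν : ℂ)) • oneM n θ := by
  rw [← etaM_commutator hθ]
  abel

/-- Moving η_ρ through η_μ ⋆ η_ν produces one scalar per crossing, times the factor that was not
crossed. -/
theorem eta2M_etaM_commutator (hθ : θ ≠ 0) (μ ν ρ : Idx n) :
    starM (eta2M n θ μ ν) (etaM n θ ρ) - starM (etaM n θ ρ) (eta2M n θ μ ν) =
      (thetaInv n θ ν ρ : ℂ) • etaM n θ μ + (thetaInv n θ μ ρ : ℂ) • etaM n θ ν := by
  have h : ∀ μ ν : Idx n, starM (starM (etaM n θ μ) (etaM n θ ν)) (etaM n θ ρ) =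
      starM (etaM n θ ρ) (starM (etaM n θ μ) (etaM n θ ν)) +
        (Complex.I * (thetaInv n θ ν ρ : ℂ)) • etaM n θ μ +
        (Complex.I * (thetaInv n θ μ ρ : ℂ)) • etaM n θ ν := fun μ ν => by
    rw [starM_assoc hθ, etaM_mul_etaM hθ ν ρ, map_add, map_smul, starM_oneM hθ, ← starM_assoc hθ,
      etaM_mul_etaM hθ μ ρ, map_add, map_smul, LinearMap.add_apply, LinearMap.smul_apply,
      oneM_starM hθ, starM_assoc hθ]
    abel
  have hI : -(Complex.I / 2) * Complex.I = 1 / 2 := by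
    linear_combination (-(1 / 2 : ℂ)) * Complex.I_mul_I
  simp only [eta2M_eq hθ, map_smul, map_add, LinearMap.smul_apply, LinearMap.add_apply, h μ ν,
    h ν μ, smul_add, smul_smul, ← mul_assoc, hI]
  module

/-- The commutator with η_{μν} is a derivation: it is applied to both factors of η_ρ ⋆ η_σ, and the
result symmetrised. -/
theorem eta2M_eta2M_commutator (hθ : θ ≠ 0) (μ ν ρ σ : Idx n) :
    starM (eta2M n θ μ ν) (eta2M n θ ρ σ) - starM (eta2M n θ ρ σ) (eta2M n θ μ ν) =
      (thetaInv n θ ν σ : ℂ) • eta2M n θ μ ρ + (thetaInv n θ ν ρ : ℂ) • eta2M n θ μ σ +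
        (thetaInv n θ μ σ : ℂ) • eta2M n θ ν ρ + (thetaInv n θ μ ρ : ℂ) • eta2M n θ ν σ := by
  have h0 : ∀ ρ : Idx n, starM (eta2M n θ μ ν) (etaM n θ ρ) =
      starM (etaM n θ ρ) (eta2M n θ μ ν) +
        ((thetaInv n θ ν ρ : ℂ) • etaM n θ μ + (thetaInv n θ μ ρ : ℂ) • etaM n θ ν) := fun ρ => by
    rw [← eta2M_etaM_commutator hθ]
    abel
  have h : ∀ ρ σ : Idx n, starM (eta2M n θ μ ν) (starM (etaM n θ ρ) (etaM n θ σ)) =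
      starM (starM (etaM n θ ρ) (etaM n θ σ)) (eta2M n θ μ ν) +
        ((thetaInv n θ ν σ : ℂ) • starM (etaM n θ ρ) (etaM n θ μ) +
          (thetaInv n θ μ σ : ℂ) • starM (etaM n θ ρ) (etaM n θ ν)) +
        ((thetaInv n θ ν ρ : ℂ) • starM (etaM n θ μ) (etaM n θ σ) +
          (thetaInv n θ μ ρ : ℂ) • starM (etaM n θ ν) (etaM n θ σ)) := fun ρ σ => by
    rw [← starM_assoc hθ, h0, map_add, LinearMap.add_apply, starM_assoc hθ, h0]
    simp only [map_add, map_smul, LinearMap.add_apply, LinearMap.smul_apply, starM_assoc hθ]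
  rw [eta2M_eq hθ ρ σ]
  simp only [map_smul, map_add, LinearMap.smul_apply, LinearMap.add_apply, h ρ σ, h σ ρ]
  simp only [eta2M_eq hθ]
  module

theorem commRel (hθ : θ ≠ 0) : CommRel n θ := by
  have hone : oneA n θ = (oneM n θ, 0) := rfl
  have hT : ∀ μ : Idx n, gT θ μ = (etaM n θ μ, 0) := fun _ => rfl
  have hU : ∀ μ : Idx n, gU θ μ = (0, etaM n θ μ) := fun _ => rfl
  have hM : ∀ μ ν : Idx n, gM θ μ ν = (eta2M n θ μ ν, 0) := fun _ _ => rfl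
  have hJ : gJ n θ = (0, Complex.I • oneM n θ) := by rw [gJ, toM_constDist hθ]
  have hUU : ∀ μ ν : Idx n, starM (etaM n θ μ) (etaM n θ ν) + starM (etaM n θ ν) (etaM n θ μ) =
      (2 * Complex.I) • eta2M n θ μ ν := fun μ ν => by
    have h : 2 * Complex.I * -(Complex.I / 2) = 1 := by linear_combination -Complex.I_mul_I
    rw [eta2M_eq hθ, smul_smul, h, one_smul]
  constructor
  · intro μ ν
    simp [hT, hone, bracket_even, etaM_commutator hθ]
  · intro μ ν ρ
    simp [hT, hM, bracket_even, eta2M_etaM_commutator hθ]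
  · intro μ ν ρ σ
    simp [hM, bracket_even, eta2M_eta2M_commutator hθ]
  · intro μ ν
    simp [hU, hM, bracket_odd, hUU]
  · intro μ ν
    simp [hT, hU, hJ, bracket_even, etaM_commutator hθ, smul_smul, mul_comm]
  · intro μ ν ρ
    simp [hU, hM, bracket_even, eta2M_etaM_commutator hθ]
  · simp [hJ, hone, bracket_odd, oneM_starM hθ, smul_smul]
    rw [← two_smul ℂ, smul_neg]
  · intro μ
    simp [hT, hJ, bracket_even, oneM_starM hθ, starM_oneM hθ]
  · intro μ ν
    simp [hM, hJ, bracket_even, oneM_starM hθ, starM_oneM hθ]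
  · intro μ
    simp [hT, hU, hJ, bracket_odd, oneM_starM hθ, starM_oneM hθ]
    rw [← two_smul ℂ, smul_smul]

/-! ### The graded Lie algebra spanned by the generators -/

/-- The generators of degree `0`, with the unit, and those of degree `1`. -/
def generators (n : ℕ) (θ : ℝ) (α : ZMod 2) : Set (GAlg n θ) :=
  if α = 0 then Set.range (gT θ) ∪ Set.range (fun p : Idx n × Idx n => gM θ p.1 p.2) ∪ {oneA n θ}
  else Set.range (gU θ) ∪ {gJ n θ}

theorem generators_zero : generators n θ 0 =
    Set.range (gT θ) ∪ Set.range (fun p : Idx n × Idx n => gM θ p.1 p.2) ∪ {oneA n θ} :=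
  if_pos rfl

theorem generators_one : generators n θ 1 = Set.range (gU θ) ∪ {gJ n θ} := if_neg one_ne_zero

theorem generators_subset (α : ZMod 2) : generators n θ α ⊆ homog n θ α := by
  revert α
  rw [forall_zmod_two, generators_zero, generators_one]
  constructor
  · rintro _ ((⟨μ, rfl⟩ | ⟨p, rfl⟩) | rfl)
    all_goals exact mem_homog_zero.2 rfl
  · rintro _ (⟨μ, rfl⟩ | rfl)
    all_goals exact mem_homog_one.2 rfl

theorem span_generators_le (α : ZMod 2) :
    Submodule.span ℂ (generators n θ α) ≤ homog n θ α :=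
  Submodule.span_le.2 (generators_subset α)

theorem map_span_generators_le_der (hθ : θ ≠ 0) (α : ZMod 2) :
    (Submodule.span ℂ (generators n θ α)).map bracket ≤ Der n θ α := by
  rintro _ ⟨x, hx, rfl⟩
  exact Ad_mem_der hθ α (span_generators_le α hx)

/-- The unit is needed for the even span to be closed, since [T, T] and [J, J] are multiples of it;
Ad kills it, so no derivation is added. -/
theorem G2_eq (hθ : θ ≠ 0) :
    G2 n θ = ⨆ α, (Submodule.span ℂ (generators n θ α)).map bracket := by
  rw [iSup_zmod_two, ← Submodule.map_sup, ← Submodule.span_union, Submodule.map_span, G2,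
    generators_zero, generators_one]
  simp only [Set.image_union, Set.image_singleton, ← Set.range_comp, bracket_oneA hθ]
  refine le_antisymm (Submodule.span_mono ?_) (Submodule.span_le.2 ?_)
  · rintro _ (((⟨μ, rfl⟩ | ⟨μ, rfl⟩) | ⟨p, rfl⟩) | rfl)
    · exact Or.inl (Or.inl (Or.inl ⟨μ, rfl⟩))
    · exact Or.inr (Or.inl ⟨μ, rfl⟩)
    · exact Or.inl (Or.inl (Or.inr ⟨p, rfl⟩))
    · exact Or.inr (Or.inr rfl)
  · rintro _ (((⟨μ, rfl⟩ | ⟨p, rfl⟩) | rfl) | (⟨μ, rfl⟩ | rfl))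
    · exact Submodule.subset_span (Or.inl (Or.inl (Or.inl ⟨μ, rfl⟩)))
    · exact Submodule.subset_span (Or.inl (Or.inr ⟨p, rfl⟩))
    · exact zero_mem _
    · exact Submodule.subset_span (Or.inl (Or.inl (Or.inr ⟨μ, rfl⟩)))
    · exact Submodule.subset_span (Or.inr rfl)

/-- In a homogeneous sum of an even and an odd derivation, the component of the wrong parity belongs
to both degrees and hence vanishes. -/
theorem G2_inf_der (hθ : θ ≠ 0) (α : ZMod 2) :
    G2 n θ ⊓ Der n θ α = (Submodule.span ℂ (generators n θ α)).map bracket := by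
  refine le_antisymm ?_ (le_inf ?_ (map_span_generators_le_der hθ α))
  · rintro X ⟨hG, hX⟩
    have hG' : X ∈ G2 n θ := hG
    rw [G2_eq hθ, iSup_zmod_two, Submodule.mem_sup] at hG'
    obtain ⟨Y, hY, Z, hZ, rfl⟩ := hG'
    have hY' := map_span_generators_le_der hθ 0 hY
    have hZ' := map_span_generators_le_der hθ 1 hZ
    revert α
    rw [forall_zmod_two]
    refine ⟨fun hX => ?_, fun hX => ?_⟩
    · have h := (Submodule.add_mem_iff_right _ hY').1 hX
      rwa [der_zero_inf_der_one h hZ', add_zero]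
    · have h := (Submodule.add_mem_iff_left _ hZ').1 hX
      rwa [der_zero_inf_der_one hY' h, zero_add]
  · rw [G2_eq hθ]
    exact le_iSup (fun α => (Submodule.span ℂ (generators n θ α)).map bracket) α

theorem bracket_even_swap (h : Moyal n θ) (b : GAlg n θ) :
    bracket b (h, 0) = -bracket (h, 0) b := by
  rw [bracket_even, bracket_apply]
  simp

theorem bracket_odd_swap (h k : Moyal n θ) :
    bracket ((0, k) : GAlg n θ) (0, h) = bracket ((0, h) : GAlg n θ) (0, k) := by
  simp [bracket_odd, add_comm]

theorem bracket_generators_mem (hθ : θ ≠ 0) (α β : ZMod 2) {x y : GAlg n θ}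
    (hx : x ∈ generators n θ α) (hy : y ∈ generators n θ β) :
    bracket x y ∈ Submodule.span ℂ (generators n θ (α + β)) := by
  have C := commRel (n := n) hθ
  have hT : ∀ μ, gT θ μ ∈ Submodule.span ℂ (generators n θ 0) := fun μ =>
    Submodule.subset_span (by rw [generators_zero]; exact Or.inl (Or.inl ⟨μ, rfl⟩))
  have hM : ∀ μ ν, gM θ μ ν ∈ Submodule.span ℂ (generators n θ 0) := fun μ ν =>
    Submodule.subset_span (by rw [generators_zero]; exact Or.inl (Or.inr ⟨(μ, ν), rfl⟩))
  have h1 : oneA n θ ∈ Submodule.span ℂ (generators n θ 0) :=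
    Submodule.subset_span (by rw [generators_zero]; exact Or.inr rfl)
  have hU : ∀ μ, gU θ μ ∈ Submodule.span ℂ (generators n θ 1) := fun μ =>
    Submodule.subset_span (by rw [generators_one]; exact Or.inl ⟨μ, rfl⟩)
  have hJ : gJ n θ ∈ Submodule.span ℂ (generators n θ 1) :=
    Submodule.subset_span (by rw [generators_one]; exact Or.inr rfl)
  have hMT : ∀ μ ν ρ, bracket (gM θ μ ν) (gT θ ρ) ∈ Submodule.span ℂ (generators n θ 0) :=
    fun μ ν ρ => by
      rw [C.MT]
      exact add_mem (Submodule.smul_mem _ _ (hT _)) (Submodule.smul_mem _ _ (hT _))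
  have h01 : ∀ x ∈ generators n θ 0, ∀ y ∈ generators n θ 1,
      bracket x y ∈ Submodule.span ℂ (generators n θ 1) := by
    rw [generators_zero]
    intro x hx y hy
    rw [generators_one] at hy
    rcases hx with (⟨μ, rfl⟩ | ⟨p, rfl⟩) | rfl <;> rcases hy with ⟨ν, rfl⟩ | rfl
    · rw [C.TU]
      exact Submodule.smul_mem _ _ hJ
    · rw [C.TJ]
      exact zero_mem _
    · rw [C.MU]
      exact add_mem (Submodule.smul_mem _ _ (hU _)) (Submodule.smul_mem _ _ (hU _))
    · rw [C.MJ]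
      exact zero_mem _
    · rw [bracket_oneA hθ]
      exact zero_mem _
    · rw [bracket_oneA hθ]
      exact zero_mem _
  -- The relations list one order of each pair; a bracket with an even element is antisymmetric.
  have hswap : ∀ x ∈ generators n θ 0, ∀ y : GAlg n θ, bracket y x = -bracket x y :=
    fun x hx y => by
      have h : x = (x.1, 0) := Prod.ext rfl (mem_homog_zero.1 (generators_subset 0 hx))
      rw [h, bracket_even_swap]
  revert α β
  simp only [forall_zmod_two, add_zero, zero_add, one_add_one_zmod_two]
  refine ⟨⟨fun hx hy => ?_, fun hx hy => h01 _ hx _ hy⟩, ⟨fun hx hy => ?_, fun hx hy => ?_⟩⟩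
  · have hx' := hx
    have hy' := hy
    rw [generators_zero] at hx' hy'
    rcases hx' with (⟨μ, rfl⟩ | ⟨p, rfl⟩) | rfl <;> rcases hy' with (⟨ν, rfl⟩ | ⟨q, rfl⟩) | rfl
    · rw [C.TT]
      exact Submodule.smul_mem _ _ h1
    · rw [hswap _ hy]
      exact neg_mem (hMT _ _ _)
    · rw [hswap _ hy, bracket_oneA hθ]
      exact neg_mem (zero_mem _)
    · exact hMT _ _ _
    · rw [C.MM]
      exact add_mem (add_mem (add_mem (Submodule.smul_mem _ _ (hM _ _))
        (Submodule.smul_mem _ _ (hM _ _))) (Submodule.smul_mem _ _ (hM _ _)))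
        (Submodule.smul_mem _ _ (hM _ _))
    all_goals
      first
        | rw [bracket_oneA hθ]
          exact zero_mem _
        | rw [hswap _ hy, bracket_oneA hθ]
          exact neg_mem (zero_mem _)
  · rw [hswap _ hy]
    exact neg_mem (h01 _ hy _ hx)
  · rw [generators_one] at hx hy
    rcases hx with ⟨μ, rfl⟩ | rfl <;> rcases hy with ⟨ν, rfl⟩ | rfl
    · rw [C.UU]
      exact Submodule.smul_mem _ _ (hM _ _)
    · rw [C.UJ]
      exact Submodule.smul_mem _ _ (hT _)
    · have h := C.UJ ν
      rw [gU, gJ, bracket_odd_swap] at h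
      rw [gU, gJ, h]
      exact Submodule.smul_mem _ _ (hT _)
    · rw [C.JJ]
      exact Submodule.smul_mem _ _ h1

theorem bracket_span_generators_mem (hθ : θ ≠ 0) (α β : ZMod 2) {x y : GAlg n θ}
    (hx : x ∈ Submodule.span ℂ (generators n θ α))
    (hy : y ∈ Submodule.span ℂ (generators n θ β)) :
    bracket x y ∈ Submodule.span ℂ (generators n θ (α + β)) := by
  have h : Submodule.map₂ bracket (Submodule.span ℂ (generators n θ α))
      (Submodule.span ℂ (generators n θ β)) ≤ Submodule.span ℂ (generators n θ (α + β)) := by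
    rw [Submodule.map₂_span_span, Submodule.span_le]
    rintro _ ⟨x, hx, y, hy, rfl⟩
    exact bracket_generators_mem hθ α β hx hy
  exact h (Submodule.apply_mem_map₂ _ hx hy)

theorem isGradedLieSubalgebra_G2 (hθ : θ ≠ 0) : IsGradedLieSubalgebra (G2 n θ) where
  le_der := by
    rw [G2_eq hθ]
    exact iSup_mono (map_span_generators_le_der hθ)
  graded := by
    simp only [G2_inf_der hθ]
    exact G2_eq hθ
  bracket_mem α β X hX Y hY := by
    rw [G2_inf_der hθ] at hX hY ⊢
    obtain ⟨x, hx, rfl⟩ := hX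
    obtain ⟨y, hy, rfl⟩ := hY
    exact ⟨_, bracket_span_generators_mem hθ α β hx hy,
      (derBracket_Ad hθ α β (span_generators_le α hx) (span_generators_le β hy)).symm⟩

/-! ### The center -/

theorem mulA_oneA (hθ : θ ≠ 0) (a : GAlg n θ) : mulA a (oneA n θ) = a := by
  have h : oneA n θ = (oneM n θ, 0) := rfl
  rw [h, mulA_apply]
  simp [starM_oneM hθ]

theorem oneA_mulA (hθ : θ ≠ 0) (a : GAlg n θ) : mulA (oneA n θ) a = a := by
  have h : oneA n θ = (oneM n θ, 0) := rfl
  rw [h, mulA_apply]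
  simp [oneM_starM hθ]

/-- The center of the graded Moyal algebra consists of the constants. -/
theorem mem_center_iff (hθ : θ ≠ 0) {z : GAlg n θ} :
    z ∈ center n θ ↔ ∃ c : ℂ, z = c • oneA n θ := by
  rw [center, LinearMap.mem_ker]
  constructor
  · intro hz
    obtain ⟨z0, z1⟩ := z
    -- The even component of the bracket with the odd unit (0, 1) is 2 z₁.
    have h1 : z1 = 0 := by
      have h := congrArg Prod.fst (LinearMap.congr_fun hz (0, oneM n θ))
      rw [bracket_apply] at h
      simp only [map_zero, LinearMap.zero_apply, sub_zero, zero_add, starM_oneM hθ, oneM_starM hθ,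
        ← two_smul ℂ z1] at h
      exact (smul_eq_zero.1 h).resolve_left two_ne_zero
    subst h1
    obtain ⟨c, hc⟩ := exists_eq_smul_oneM hθ (T := z0) fun μ => by
      have h := congrArg Prod.fst (LinearMap.congr_fun hz (etaM n θ μ, 0))
      rw [bracket_even] at h
      exact sub_eq_zero.1 h
    exact ⟨c, by rw [hc, oneA, Prod.smul_mk, smul_zero]; rfl⟩
  · rintro ⟨c, rfl⟩
    rw [map_smul, bracket_oneA hθ, smul_zero]

theorem oneA_mem_homog : oneA n θ ∈ homog n θ 0 := mem_homog_zero.2 rfl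

/-- Constants are even, so an odd central element is zero. The alternative records that the sign in
the right action never matters. -/
theorem mem_center_inf_homog (hθ : θ ≠ 0) (γ : ZMod 2) {z : GAlg n θ}
    (hz : z ∈ center n θ ⊓ homog n θ γ) : ∃ c : ℂ, z = c • oneA n θ ∧ (γ = 0 ∨ c = 0) := by
  obtain ⟨c, rfl⟩ := (mem_center_iff hθ).1 hz.1
  have hz2 := hz.2
  clear hz
  revert γ
  rw [forall_zmod_two]
  refine ⟨fun _ => ⟨c, rfl, Or.inl rfl⟩, fun hz => ⟨0, ?_, Or.inr rfl⟩⟩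
  rw [zero_smul, homog_zero_inf_homog_one (Submodule.smul_mem _ c oneA_mem_homog) hz]

theorem actL_smul_oneA (hθ : θ ≠ 0) (c : ℂ) (X : GAlg n θ →ₗ[ℂ] GAlg n θ) :
    actL (c • oneA n θ) X = c • X := by
  refine LinearMap.ext fun a => ?_
  rw [actL, LinearMap.comp_apply, map_smul, LinearMap.smul_apply, oneA_mulA hθ,
    LinearMap.smul_apply]

theorem actR_smul_oneA (hθ : θ ≠ 0) {γ : ZMod 2} {c : ℂ} (h : γ = 0 ∨ c = 0)
    (X : GAlg n θ →ₗ[ℂ] GAlg n θ) : actR γ X (c • oneA n θ) = c • X := by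
  refine LinearMap.ext fun a => ?_
  simp only [actR, LinearMap.sum_apply, LinearMap.smul_apply, LinearMap.comp_apply,
    LinearMap.flip_apply, map_smul, mulA_oneA hθ]
  rcases h with rfl | rfl
  · simp only [sgn_zero_right, one_smul]
    rw [sum_zmod_two, ← smul_add, ← map_add]
    congr 2
    simp [comp_zero, comp_one]
  · simp

theorem actR_mulA (hθ : θ ≠ 0) (γ δ : ZMod 2) {z w : GAlg n θ}
    (hz : z ∈ center n θ ⊓ homog n θ γ) (hw : w ∈ center n θ ⊓ homog n θ δ)
    (X : GAlg n θ →ₗ[ℂ] GAlg n θ) : actR (γ + δ) X (mulA z w) = actR δ (actR γ X z) w := by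
  obtain ⟨c, rfl, hc⟩ := mem_center_inf_homog hθ γ hz
  obtain ⟨d, rfl, hd⟩ := mem_center_inf_homog hθ δ hw
  have h : γ + δ = 0 ∨ d * c = 0 := by
    rcases hc with hc | hc
    · rcases hd with hd | hd
      · exact Or.inl (by rw [hc, hd, add_zero])
      · exact Or.inr (by rw [hd, zero_mul])
    · exact Or.inr (by rw [hc, mul_zero])
  rw [map_smul, map_smul, LinearMap.smul_apply, oneA_mulA hθ, smul_smul, actR_smul_oneA hθ h,
    actR_smul_oneA hθ hc, actR_smul_oneA hθ hd, smul_smul]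

theorem smul_mem_der_of {γ α β : ZMod 2} {c : ℂ} (h : γ = 0 ∨ c = 0) (hβ : γ = 0 → β = α)
    {X : GAlg n θ →ₗ[ℂ] GAlg n θ} (hX : X ∈ Der n θ α) : c • X ∈ Der n θ β := by
  rcases h with h | h
  · rw [hβ h]
    exact Submodule.smul_mem _ c hX
  · rw [h, zero_smul]
    exact zero_mem _

theorem isCenterModule_G2 (hθ : θ ≠ 0) : IsCenterModule (G2 n θ) where
  one_mem := (mem_center_iff hθ).2 ⟨1, (one_smul ℂ _).symm⟩
  mul_mem z hz w hw := by
    obtain ⟨c, rfl⟩ := (mem_center_iff hθ).1 hz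
    rw [map_smul, LinearMap.smul_apply, oneA_mulA hθ]
    exact Submodule.smul_mem _ c hw
  center_graded := by
    refine le_antisymm (fun z hz => ?_) (iSup_le fun γ => inf_le_left)
    refine Submodule.mem_iSup_of_mem 0 ⟨hz, ?_⟩
    obtain ⟨c, rfl⟩ := (mem_center_iff hθ).1 hz
    exact Submodule.smul_mem _ c oneA_mem_homog
  actL_mem z hz X hX := by
    obtain ⟨c, rfl⟩ := (mem_center_iff hθ).1 hz
    rw [actL_smul_oneA hθ]
    exact Submodule.smul_mem _ c hX
  actL_deg γ α z hz X hX := by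
    obtain ⟨c, rfl, h⟩ := mem_center_inf_homog hθ γ hz
    rw [actL_smul_oneA hθ]
    exact smul_mem_der_of h (fun h => by rw [h, zero_add]) hX.2
  one_actL X _ := by
    rw [← one_smul ℂ (oneA n θ), actL_smul_oneA hθ, one_smul]
  mul_actL z hz w hw X _ := by
    obtain ⟨c, rfl⟩ := (mem_center_iff hθ).1 hz
    rw [map_smul, LinearMap.smul_apply, oneA_mulA hθ, actL_smul_oneA hθ, actL, map_smul]
    rfl
  actR_mem γ z hz X hX := by
    obtain ⟨c, rfl, h⟩ := mem_center_inf_homog hθ γ hz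
    rw [actR_smul_oneA hθ h]
    exact Submodule.smul_mem _ c hX
  actR_deg γ α z hz X hX := by
    obtain ⟨c, rfl, h⟩ := mem_center_inf_homog hθ γ hz
    rw [actR_smul_oneA hθ h]
    exact smul_mem_der_of h (fun h => by rw [h, add_zero]) hX.2
  actR_one X _ := by
    rw [← one_smul ℂ (oneA n θ), actR_smul_oneA hθ (Or.inl rfl), one_smul]
  actR_mul γ δ z hz w hw X _ := actR_mulA hθ γ δ hz hw X

/-! ### Antihermitian generators -/

theorem conjM_eta2M (hθ : θ ≠ 0) (μ ν : Idx n) : conjM (eta2M n θ μ ν) = -eta2M n θ μ ν := by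
  rw [eta2M_eq hθ, conjM_smul hθ, conjM_add hθ, conjM_starM hθ, conjM_starM hθ, conjM_etaM hθ,
    conjM_etaM hθ]
  simp only [map_neg, LinearMap.neg_apply, neg_neg, map_div₀, Complex.conj_I, map_ofNat]
  rw [add_comm, ← neg_smul]
  congr 1
  ring

theorem conjM_I_smul_oneM (hθ : θ ≠ 0) :
    conjM (Complex.I • oneM n θ) = -(Complex.I • oneM n θ) := by
  rw [conjM_smul hθ, conjM_oneM hθ, Complex.conj_I, neg_smul]

end GradedMoyal

end

theorem mainTheorem10 (n : ℕ) (θ : ℝ) (hθ : θ ≠ 0) :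
    GradedMoyal.WellDefined n θ ∧
    -- the generators are homogeneous derivations, even for `T`, `M` and odd for `U`, `J`
    (∀ μ : GradedMoyal.Idx n, GradedMoyal.Ad (GradedMoyal.gT θ μ) ∈ GradedMoyal.Der n θ 0) ∧
    (∀ μ ν : GradedMoyal.Idx n, GradedMoyal.Ad (GradedMoyal.gM θ μ ν) ∈ GradedMoyal.Der n θ 0) ∧
    (∀ μ : GradedMoyal.Idx n, GradedMoyal.Ad (GradedMoyal.gU θ μ) ∈ GradedMoyal.Der n θ 1) ∧
    GradedMoyal.Ad (GradedMoyal.gJ n θ) ∈ GradedMoyal.Der n θ 1 ∧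
    -- reality, up to a constant phase in odd degree
    (∀ μ : GradedMoyal.Idx n, GradedMoyal.IsReal (GradedMoyal.Ad (GradedMoyal.gT θ μ))) ∧
    (∀ μ ν : GradedMoyal.Idx n, GradedMoyal.IsReal (GradedMoyal.Ad (GradedMoyal.gM θ μ ν))) ∧
    (∀ μ : GradedMoyal.Idx n, GradedMoyal.IsReal
      (Complex.exp (Complex.I * Real.pi / 4) • GradedMoyal.Ad (GradedMoyal.gU θ μ))) ∧
    GradedMoyal.IsReal
      (Complex.exp (Complex.I * Real.pi / 4) • GradedMoyal.Ad (GradedMoyal.gJ n θ)) ∧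
    GradedMoyal.CommRel n θ ∧
    GradedMoyal.IsGradedLieSubalgebra (GradedMoyal.G2 n θ) ∧
    GradedMoyal.IsCenterModule (GradedMoyal.G2 n θ) := by
  refine ⟨GradedMoyal.wellDefined hθ,
    fun μ => GradedMoyal.Ad_mem_der hθ 0 (GradedMoyal.mem_homog_zero.2 rfl),
    fun μ ν => GradedMoyal.Ad_mem_der hθ 0 (GradedMoyal.mem_homog_zero.2 rfl),
    fun μ => GradedMoyal.Ad_mem_der hθ 1 (GradedMoyal.mem_homog_one.2 rfl),
    GradedMoyal.Ad_mem_der hθ 1 (GradedMoyal.mem_homog_one.2 rfl),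
    fun μ => GradedMoyal.isReal_even hθ (GradedMoyal.conjM_etaM hθ μ),
    fun μ ν => GradedMoyal.isReal_even hθ (GradedMoyal.conjM_eta2M hθ μ ν),
    fun μ => GradedMoyal.isReal_odd hθ (GradedMoyal.conjM_etaM hθ μ),
    GradedMoyal.isReal_odd hθ ?_, GradedMoyal.commRel hθ,
    GradedMoyal.isGradedLieSubalgebra_G2 hθ, GradedMoyal.isCenterModule_G2 hθ⟩
  rw [GradedMoyal.toM_constDist hθ]
  exact GradedMoyal.conjM_I_smul_oneM hθ
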